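/- Let $(\Omega,\mathbf P)$ be a probability space. For each $\omega\in\Omega$ let $\Gamma_\omega\subset\mathbb R^2$ be a set without accumulation points in $\mathbb R^2$, and let $\alpha(\omega)=\{\alpha_\gamma(\omega)\}_{\gamma\in\Gamma_\omega}$ be real numbers with $0\le\alpha_\gamma(\omega)<1$. For a Borel set $E\subset\mathbb R^2$ put $\Phi_\omega(E)=\sum_{\gamma\in\Gamma_\omega\cap E}\alpha_\gamma(\omega)\in[0,\infty]$, let $Q_0=\{x\in\mathbb R^2: -\tfrac12\le x_j<\tfrac12,\ j=1,2\}$, and let $B_x(r)$ be the open disc of radius $r$ centered at $x$. Assume: (i) for every Borel set $E\subset\mathbb R^2$, $\omega\mapsto\Phi_\omega(E)$ is measurable; (ii) for all finitely many distinct $n_1,\dots,n_J\in\mathbb Z^2$ and Borel sets $E_j\subset n_j+Q_0$, the random variables $\Phi(E_1),\dots,\Phi(E_J)$ are independent; (iii) for every Borel set $E\subset Q_0$, the random variables $\Phi(E+n)$, $n\in\mathbb Z^2$, are identically distributed; (iv) $0<\mathbf E[\Phi(Q_0)]<\infty$ and the variance of $\Phi(Q_0)$ is finite; (v) $\Phi_\omega(\partial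 Q_0)=0$ almost surely; (vi) at least one of the following holds: (a) there is a constant $0<c\le1$ such that, for every $\epsilon>0$, with positive probability one has both $\Phi_\omega(Q_0)<\epsilon$ and, for all $\gamma\ne\gamma'$ in $\Gamma_\omega\cap Q_0$, $B_\gamma(c\sqrt{\alpha_\gamma})\cap B_{\gamma'}(c\sqrt{\alpha_{\gamma'}})=\emptyset$ and $B_\gamma(c\sqrt{\alpha_\gamma})\cap\partial Q_0=\emptyset$; (b) for every $\epsilon>0$, with positive probability $\sum_{\gamma\in\Gamma_\omega\cap Q_0}\sqrt{\alpha_\gamma}<\epsilon$. Then for almost every $\omega$ the following holds. Let $\mathbf a_\omega=(a_1,a_2)\in C^\infty(\mathbb R^2\setminus\Gamma_\omega;\mathbb R^2)\cap L^1_{\rm loc}(\mathbb R^2;\mathbb R^2)$ be any vector potential with $\partial_1a_2-\partial_2a_1=\sum_{\gamma\in\Gamma_\omega}2\pi\alpha_\gamma(\omega)\delta_\gamma$ in the sense of distributions on $\mathbb R^2$, and let $H_\omega$ be the Friedrichs extension in $L^2(\mathbb R^2)$ of the operator $\left(\frac1i\nabla-\mathbf a_\omega\right)^2$ with operator domain $C_0^\infty(\mathbb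 R^2\setminus\Gamma_\omega)$. Then $\sigma(H_\omega)=[0,\infty)$. -/

import Mathlib

open MeasureTheory ProbabilityTheory Filter Topology
open scoped ENNReal

noncomputable section

namespace RandomDelta

/-! ### Unbounded operators: spectrum and Friedrichs extension -/

section Operators

variable {E : Type*} [NormedAddCommGroup E] [InnerProductSpace ℂ E]

/-- The spectrum of a partially defined operator `T`: the complement of the set of all `z` such
that `T - z` is a bijection from the domain of `T` onto the whole space with a bounded inverse. -/
def opSpectrum (T : E →ₗ.[ℂ] E) : Set ℂ :=
  {z | ¬ ∃ R : E →L[ℂ] E,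
    (∀ y : E, ∃ h : R y ∈ T.domain, T ⟨R y, h⟩ - z • R y = y) ∧
    ∀ x : T.domain, R (T x - z • (x : E)) = (x : E)}

/-- `T` is symmetric and non-negative. -/
structure IsNonnegSymmetric (T : E →ₗ.[ℂ] E) : Prop where
  symm : ∀ x y : T.domain, inner ℂ (T x) (y : E) = inner ℂ (x : E) (T y)
  nonneg : ∀ x : T.domain, 0 ≤ (inner ℂ (x : E) (T x)).re

/-- The quadratic form `⟨x, T x⟩` of `T` (real for symmetric `T`). -/
def energy (T : E →ₗ.[ℂ] E) (x : T.domain) : ℝ := (inner ℂ (x : E) (T x)).re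

lemma energy_add_le {T : E →ₗ.[ℂ] E} (hT : IsNonnegSymmetric T) (x y : T.domain) :
    energy T (x + y) ≤ 2 * energy T x + 2 * energy T y := by
  have h := hT.nonneg (x - y)
  have e : energy T (x + y) + (inner ℂ ((x - y : T.domain) : E) (T (x - y))).re
      = 2 * energy T x + 2 * energy T y := by
    simp only [energy, LinearPMap.map_add, LinearPMap.map_sub, Submodule.coe_add,
      Submodule.coe_sub, inner_add_left, inner_add_right, inner_sub_left, inner_sub_right,
      Complex.add_re, Complex.sub_re]
    ring
  linarith

lemma energy_smul {T : E →ₗ.[ℂ] E} (c : ℂ) (x : T.domain) :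
    energy T (c • x) = ‖c‖ ^ 2 * energy T x := by
  simp only [energy, LinearPMap.map_smul, Submodule.coe_smul, inner_smul_left, inner_smul_right]
  rw [← mul_assoc, Complex.mul_conj']
  norm_cast
  exact Complex.re_ofReal_mul _ _

/-- The domain of the closure of the quadratic form of `T`: the limits in `E` of sequences in the
domain of `T` that are Cauchy for the quadratic form. -/
def formDomain (T : E →ₗ.[ℂ] E) (hT : IsNonnegSymmetric T) : Submodule ℂ E where
  carrier := {x | ∃ u : ℕ → T.domain, Tendsto (fun n => (u n : E)) atTop (𝓝 x) ∧
    ∀ ε > 0, ∃ N, ∀ m ≥ N, ∀ n ≥ N, energy T (u m - u n) < ε}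
  zero_mem' := ⟨fun _ => 0, by simp, fun ε hε => ⟨0, fun _ _ _ _ => by simpa [energy] using hε⟩⟩
  add_mem' := by
    rintro x y ⟨u, hu, hu'⟩ ⟨v, hv, hv'⟩
    refine ⟨fun n => u n + v n, by simpa using hu.add hv, fun ε hε => ?_⟩
    obtain ⟨N, hN⟩ := hu' (ε / 4) (by positivity)
    obtain ⟨M, hM⟩ := hv' (ε / 4) (by positivity)
    refine ⟨max N M, fun m hm n hn => ?_⟩
    have h1 := hN m (le_trans (le_max_left _ _) hm) n (le_trans (le_max_left _ _) hn)
    have h2 := hM m (le_trans (le_max_right _ _) hm) n (le_trans (le_max_right _ _) hn)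
    have h3 := energy_add_le hT (u m - u n) (v m - v n)
    rw [add_sub_add_comm]
    linarith
  smul_mem' := by
    rintro c x ⟨u, hu, hu'⟩
    refine ⟨fun n => c • u n, by simpa using hu.const_smul c, fun ε hε => ?_⟩
    obtain ⟨N, hN⟩ := hu' (ε / (‖c‖ ^ 2 + 1)) (by positivity)
    refine ⟨N, fun m hm n hn => ?_⟩
    have h1 := hN m hm n hn
    rw [lt_div_iff₀ (by positivity)] at h1
    have h2 : 0 ≤ energy T (u m - u n) := hT.nonneg _
    rw [← smul_sub, energy_smul]
    nlinarith

/-- The Friedrichs extension of a (densely defined) symmetric non-negative operator `T`: the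
restriction of the adjoint `T†` to those elements of its domain that lie in the domain of the
closure of the quadratic form of `T`. -/
def friedrichsExtension [CompleteSpace E] (T : E →ₗ.[ℂ] E) (hT : IsNonnegSymmetric T) :
    E →ₗ.[ℂ] E :=
  T.adjoint.domRestrict (formDomain T hT)

end Operators

/-! ### The magnetic Schrödinger operator -/

section Magnetic

open scoped ContDiff

/-- The plane `ℝ²`. -/
abbrev Plane : Type := EuclideanSpace ℝ (Fin 2)

/-- The complex Hilbert space `L²(ℝ²)`. -/
abbrev L2 : Type := Lp ℂ 2 (volume : Measure Plane)

/-- The `j`-th standard basis vector of `ℝ²`. -/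
def basisVec (j : Fin 2) : Plane := EuclideanSpace.single j 1

/-- The partial derivative `∂ⱼ u (x)`. -/
def pderiv {F : Type*} [NormedAddCommGroup F] [NormedSpace ℝ F]
    (j : Fin 2) (u : Plane → F) (x : Plane) : F :=
  fderiv ℝ u x (basisVec j)

/-- `a ∈ C^∞(ℝ² \ Γ; ℝ²)` (for closed `Γ`). -/
def SmoothOff (Γ : Set Plane) (a : Plane → Plane) : Prop :=
  ∀ x ∉ Γ, ContDiffAt ℝ ∞ a x

/-- The space `C₀^∞(ℝ² \ Γ)` of complex-valued smooth functions with compact support contained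
in `ℝ² \ Γ`. -/
def testFun (Γ : Set Plane) : Submodule ℂ (Plane → ℂ) where
  carrier := {u | ContDiff ℝ ∞ u ∧ HasCompactSupport u ∧ tsupport u ⊆ Γᶜ}
  zero_mem' := ⟨contDiff_const, HasCompactSupport.zero, by simp [tsupport]⟩
  add_mem' := fun {u v} hu hv => ⟨hu.1.add hv.1, hu.2.1.add hv.2.1,
    (tsupport_add u v).trans (Set.union_subset hu.2.2 hv.2.2)⟩
  smul_mem' := fun c u hu => ⟨contDiff_const.smul hu.1, hu.2.1.smul_left (f := fun _ => c),
    (tsupport_smul_subset_right (fun _ => c) u).trans hu.2.2⟩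

/-- The `j`-th component of `(1/i) ∇ - a`, applied to `u`. -/
def covDeriv (a : Plane → Plane) (j : Fin 2) (u : Plane → ℂ) (x : Plane) : ℂ :=
  -Complex.I * pderiv j u x - (a x j : ℂ) * u x

lemma tsupport_covDeriv_subset (a : Plane → Plane) (j : Fin 2) (u : Plane → ℂ) :
    tsupport (covDeriv a j u) ⊆ tsupport u := by
  refine closure_minimal (fun x hx => ?_) (isClosed_tsupport u)
  by_contra h
  apply hx
  have h1 : u x = 0 := image_eq_zero_of_notMem_tsupport h
  have h2 : fderiv ℝ u x = 0 := by
    by_contra h2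
    exact h (support_fderiv_subset ℝ h2)
  simp [covDeriv, pderiv, h1, h2]

lemma covDeriv_mem {Γ : Set Plane} {a : Plane → Plane} (ha : SmoothOff Γ a) (j : Fin 2)
    {u : Plane → ℂ} (hu : u ∈ testFun Γ) : covDeriv a j u ∈ testFun Γ := by
  have hs := tsupport_covDeriv_subset a j u
  refine ⟨contDiff_iff_contDiffAt.2 fun x => ?_, ?_, hs.trans hu.2.2⟩
  · by_cases hx : x ∈ tsupport u
    · have hax : ContDiffAt ℝ ∞ (fun y => ((a y j : ℝ) : ℂ)) x := by
        have h1 : ContDiffAt ℝ ∞ (fun y => a y j) x := by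
          have := ha x (hu.2.2 hx)
          exact (contDiffAt_piLp 2).1 this j
        exact Complex.ofRealCLM.contDiff.contDiffAt.comp x h1
      have hd : ContDiff ℝ ∞ (fun y => pderiv j u y) :=
        (hu.1.fderiv_right (m := ∞) (by simp)).clm_apply contDiff_const
      exact (contDiffAt_const.mul hd.contDiffAt).sub (hax.mul hu.1.contDiffAt)
    · have : covDeriv a j u =ᶠ[𝓝 x] fun _ => 0 := by
        have := (isClosed_tsupport (covDeriv a j u)).isOpen_compl.mem_nhds
          (show x ∈ (tsupport (covDeriv a j u))ᶜ from fun h => hx (hs h))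
        filter_upwards [this] with y hy
        exact image_eq_zero_of_notMem_tsupport hy
      exact contDiffAt_const.congr_of_eventuallyEq this
  · exact hu.2.1.mono' (subset_closure.trans hs)

/-- The `j`-th component of `(1/i) ∇ - a` as a linear map on `C₀^∞(ℝ² \ Γ)`. -/
def covD {Γ : Set Plane} {a : Plane → Plane} (ha : SmoothOff Γ a) (j : Fin 2) :
    testFun Γ →ₗ[ℂ] testFun Γ where
  toFun u := ⟨covDeriv a j u, covDeriv_mem ha j u.2⟩
  map_add' u v := by
    ext x
    have hu : DifferentiableAt ℝ (u : Plane → ℂ) x := u.2.1.differentiable (by simp) x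
    have hv : DifferentiableAt ℝ (v : Plane → ℂ) x := v.2.1.differentiable (by simp) x
    simp only [covDeriv, pderiv, Submodule.coe_add, Pi.add_apply, fderiv_add hu hv,
      _root_.add_apply]
    ring
  map_smul' c u := by
    ext x
    have hu : DifferentiableAt ℝ (u : Plane → ℂ) x := u.2.1.differentiable (by simp) x
    simp only [covDeriv, pderiv, Submodule.coe_smul, Pi.smul_apply, fderiv_const_smul hu,
      _root_.smul_apply, RingHom.id_apply, smul_eq_mul]
    ring

/-- The differential expression `((1/i) ∇ - a)²` on `C₀^∞(ℝ² \ Γ)`. -/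
def magneticLaplacian {Γ : Set Plane} {a : Plane → Plane} (ha : SmoothOff Γ a) :
    testFun Γ →ₗ[ℂ] testFun Γ :=
  ∑ j, covD ha j ∘ₗ covD ha j

lemma memLp_of_mem_testFun {Γ : Set Plane} {u : Plane → ℂ} (hu : u ∈ testFun Γ) :
    MemLp u 2 (volume : Measure Plane) :=
  hu.1.continuous.memLp_of_hasCompactSupport hu.2.1

/-- The embedding of `C₀^∞(ℝ² \ Γ)` into `L²(ℝ²)`. -/
def toL2 (Γ : Set Plane) : testFun Γ →ₗ[ℂ] L2 where
  toFun u := (memLp_of_mem_testFun u.2).toLp u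
  map_add' _ _ := rfl
  map_smul' _ _ := rfl

lemma toL2_injective (Γ : Set Plane) : Function.Injective (toL2 Γ) := by
  intro u v h
  have h' : (u : Plane → ℂ) =ᵐ[volume] v := 
    (MemLp.toLp_eq_toLp_iff (memLp_of_mem_testFun u.2) (memLp_of_mem_testFun v.2)).1 h
  exact Subtype.ext (u.2.1.continuous.ae_eq_iff_eq volume v.2.1.continuous |>.1 h')

/-- The operator `((1/i) ∇ - a)²` in `L²(ℝ²)` with operator domain `C₀^∞(ℝ² \ Γ)`. -/
def minimalOperator {Γ : Set Plane} {a : Plane → Plane} (ha : SmoothOff Γ a) : L2 →ₗ.[ℂ] L2 where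
  domain := LinearMap.range (toL2 Γ)
  toFun := toL2 Γ ∘ₗ magneticLaplacian ha ∘ₗ
    (LinearEquiv.ofInjective (toL2 Γ) (toL2_injective Γ)).symm.toLinearMap

lemma minimalOperator_spec {Γ : Set Plane} {a : Plane → Plane} (ha : SmoothOff Γ a)
    (x : (minimalOperator ha).domain) :
    ∃ u : testFun Γ, (x : L2) = toL2 Γ u ∧
      minimalOperator ha x = toL2 Γ (magneticLaplacian ha u) :=
  ⟨(LinearEquiv.ofInjective (toL2 Γ) (toL2_injective Γ)).symm x,
    (congrArg Subtype.val ((LinearEquiv.ofInjective (toL2 Γ)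
      (toL2_injective Γ)).apply_symm_apply x)).symm, rfl⟩

lemma inner_toL2 {Γ : Set Plane} (u v : testFun Γ) :
    inner ℂ (toL2 Γ u) (toL2 Γ v)
      = ∫ x, (v : Plane → ℂ) x * (starRingEnd ℂ) ((u : Plane → ℂ) x) := by
  rw [L2.inner_def]
  refine integral_congr_ae ?_
  filter_upwards [(memLp_of_mem_testFun u.2).coeFn_toLp, (memLp_of_mem_testFun v.2).coeFn_toLp]
    with x hx hy
  change inner ℂ (((memLp_of_mem_testFun u.2).toLp u : L2) x)
    (((memLp_of_mem_testFun v.2).toLp v : L2) x) = _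
  rw [hx, hy]
  rfl

lemma inner_covD {Γ : Set Plane} {a : Plane → Plane} (ha : SmoothOff Γ a) (j : Fin 2)
    (u v : testFun Γ) :
    inner ℂ (toL2 Γ (covD ha j u)) (toL2 Γ v) = inner ℂ (toL2 Γ u) (toL2 Γ (covD ha j v)) := by
  have hint : ∀ f g : Plane → ℂ, Continuous f → Continuous g → HasCompactSupport f →
      Integrable (fun x => f x * (starRingEnd ℂ) (g x)) (volume : Measure Plane) :=
    fun f g hf hg hc =>
      (hf.mul (Complex.continuous_conj.comp hg)).integrable_of_hasCompactSupport hc.mul_right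
  have cu := u.2.1.continuous
  have cv := v.2.1.continuous
  have cdu : Continuous (fun x => fderiv ℝ (u : Plane → ℂ) x (basisVec j)) :=
    (u.2.1.continuous_fderiv (by simp)).clm_apply continuous_const
  have cdv : Continuous (fun x => fderiv ℝ (v : Plane → ℂ) x (basisVec j)) :=
    (v.2.1.continuous_fderiv (by simp)).clm_apply continuous_const
  have hdv : HasCompactSupport (fun x => fderiv ℝ (v : Plane → ℂ) x (basisVec j)) :=
    v.2.2.1.fderiv_apply (𝕜 := ℝ) (basisVec j)
  have hdiff : Differentiable ℝ (u : Plane → ℂ) := u.2.1.differentiable (by simp)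
  have hd : ∀ x, fderiv ℝ (fun y => (starRingEnd ℂ) ((u : Plane → ℂ) y)) x (basisVec j)
      = (starRingEnd ℂ) (fderiv ℝ (u : Plane → ℂ) x (basisVec j)) := by
    intro x
    have h := (Complex.conjCLE.toContinuousLinearMap.hasFDerivAt
      (x := (u : Plane → ℂ) x)).comp x (hdiff x).hasFDerivAt
    have h' : HasFDerivAt (fun y => (starRingEnd ℂ) ((u : Plane → ℂ) y)) _ x := h
    rw [h'.fderiv]
    simp
  have i1 := hint _ _ cv cdu v.2.2.1
  have i2 := hint _ _ cdv cu hdv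
  have ibp := integral_mul_fderiv_eq_neg_fderiv_mul_of_integrable
    (μ := (volume : Measure Plane)) (v := basisVec j)
    (f := (v : Plane → ℂ)) (g := fun y => (starRingEnd ℂ) ((u : Plane → ℂ) y))
    i2 (by simpa only [hd] using i1) (hint _ _ cv cu v.2.2.1)
    (fun x _ => v.2.1.differentiable (by simp) x)
    (fun x _ => Complex.conjCLE.toContinuousLinearMap.differentiableAt.comp x (hdiff x))
  simp only [hd] at ibp
  rw [inner_toL2, inner_toL2, ← sub_eq_zero, ← integral_sub
    (hint _ _ cv (covD ha j u).2.1.continuous v.2.2.1)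
    (hint _ _ (covD ha j v).2.1.continuous cu (covD ha j v).2.2.1)]
  have e : ∀ x, (v : Plane → ℂ) x * (starRingEnd ℂ) ((covD ha j u : Plane → ℂ) x)
      - (covD ha j v : Plane → ℂ) x * (starRingEnd ℂ) ((u : Plane → ℂ) x)
      = Complex.I * ((v : Plane → ℂ) x *
          (starRingEnd ℂ) (fderiv ℝ (u : Plane → ℂ) x (basisVec j))
        + fderiv ℝ (v : Plane → ℂ) x (basisVec j) * (starRingEnd ℂ) ((u : Plane → ℂ) x)) := by
    intro x
    simp only [covD, LinearMap.coe_mk, AddHom.coe_mk, covDeriv, pderiv, map_sub, map_mul, map_neg,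
      Complex.conj_I, Complex.conj_ofReal]
    ring
  simp only [e]
  rw [integral_const_mul, integral_add i1 i2, ibp]
  simp

lemma minimalOperator_nonnegSymmetric {Γ : Set Plane} {a : Plane → Plane} (ha : SmoothOff Γ a) :
    IsNonnegSymmetric (minimalOperator ha) where
  symm := by
    intro x y
    obtain ⟨u, hu, hu'⟩ := minimalOperator_spec ha x
    obtain ⟨v, hv, hv'⟩ := minimalOperator_spec ha y
    rw [hu, hv, hu', hv']
    simp only [magneticLaplacian, LinearMap.sum_apply, map_sum,
      LinearMap.comp_apply, sum_inner, inner_sum, inner_covD]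
  nonneg := by
    intro x
    obtain ⟨u, hu, hu'⟩ := minimalOperator_spec ha x
    rw [hu, hu']
    simp only [magneticLaplacian, LinearMap.sum_apply, map_sum,
      LinearMap.comp_apply, inner_sum, Complex.re_sum]
    refine Finset.sum_nonneg fun j _ => ?_
    rw [← inner_covD]
    exact inner_self_nonneg (𝕜 := ℂ)

/-- The Hamiltonian: the Friedrichs extension of `((1/i) ∇ - a)²` on `C₀^∞(ℝ² \ Γ)`. -/
def hamiltonian {Γ : Set Plane} {a : Plane → Plane} (ha : SmoothOff Γ a) : L2 →ₗ.[ℂ] L2 :=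
  friedrichsExtension (minimalOperator ha) (minimalOperator_nonnegSymmetric ha)

/-- `a` is a vector potential of the magnetic field `∑_{γ ∈ Γ} 2π α_γ δ_γ`: it is smooth off `Γ`,
locally integrable on `ℝ²`, and `∂₁ a₂ - ∂₂ a₁ = ∑_{γ ∈ Γ} 2π α_γ δ_γ` in the sense of
distributions on `ℝ²`. -/
structure IsVectorPotential (Γ : Set Plane) (α : Plane → ℝ) (a : Plane → Plane) : Prop where
  smooth : SmoothOff Γ a
  locallyIntegrable : LocallyIntegrable a volume
  curl_eq : ∀ η : Plane → ℝ, ContDiff ℝ ∞ η → HasCompactSupport η →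
    ∫ x, (a x 0 * pderiv 1 η x - a x 1 * pderiv 0 η x)
      = ∑' γ : Γ, 2 * Real.pi * α γ * η γ

end Magnetic

/-! ### The random fluxes -/

/-- The half-open unit square `Q₀` centered at the origin. -/
def unitSquare : Set Plane := {x | ∀ j, -(1 / 2) ≤ x j ∧ x j < 1 / 2}

/-- The translate `S + n` of `S` by the lattice vector `n ∈ ℤ²`. -/
def shift (S : Set Plane) (n : Fin 2 → ℤ) : Set Plane :=
  (fun x => x + WithLp.toLp 2 (fun j => (n j : ℝ))) '' S

/-- The total flux `Φ(E) = ∑_{γ ∈ Γ ∩ E} α_γ ∈ [0, ∞]`. -/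
def totalFlux (Γ : Set Plane) (α : Plane → ℝ) (E : Set Plane) : ℝ≥0∞ :=
  ∑' γ : (Γ ∩ E : Set Plane), ENNReal.ofReal (α γ)

/-- The sum `∑_{γ ∈ Γ ∩ Q₀} √α_γ ∈ [0, ∞]`. -/
def sqrtFlux (Γ : Set Plane) (α : Plane → ℝ) : ℝ≥0∞ :=
  ∑' γ : (Γ ∩ unitSquare : Set Plane), ENNReal.ofReal √(α γ)

/-- For all distinct `γ, γ' ∈ Γ ∩ Q₀`, the open discs of radii `c √α_γ`, `c √α_γ'` about them
are disjoint, and the disc about `γ` does not meet the boundary of `Q₀`. -/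
def Separated (Γ : Set Plane) (α : Plane → ℝ) (c : ℝ) : Prop :=
  ∀ γ ∈ Γ ∩ unitSquare, ∀ γ' ∈ Γ ∩ unitSquare, γ ≠ γ' →
    Metric.ball γ (c * √(α γ)) ∩ Metric.ball γ' (c * √(α γ')) = ∅ ∧
    Metric.ball γ (c * √(α γ)) ∩ frontier unitSquare = ∅

/-- The assumptions on the random points `Γ ω` and the random fluxes `α ω γ` (`γ ∈ Γ ω`). -/
structure FluxAssumptions {Ω : Type*} [MeasurableSpace Ω] (P : Measure Ω)
    (Γ : Ω → Set Plane) (α : Ω → Plane → ℝ) : Prop where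
  /-- The points do not accumulate anywhere in the plane. -/
  discrete : ∀ ω x, ¬ AccPt x (𝓟 (Γ ω))
  /-- The fluxes lie in `[0, 1)`. -/
  flux_mem : ∀ ω, ∀ γ ∈ Γ ω, 0 ≤ α ω γ ∧ α ω γ < 1
  /-- `Φ(E)` is a random variable for every Borel set `E`. -/
  measurable : ∀ E : Set Plane, MeasurableSet E → Measurable fun ω => totalFlux (Γ ω) (α ω) E
  /-- The fluxes through Borel subsets of distinct lattice squares are independent. -/
  indep : ∀ (J : ℕ) (n : Fin J → Fin 2 → ℤ) (E : Fin J → Set Plane), Function.Injective n →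
    (∀ j, MeasurableSet (E j)) → (∀ j, E j ⊆ shift unitSquare (n j)) →
    iIndepFun (fun j ω => totalFlux (Γ ω) (α ω) (E j)) P
  /-- The fluxes through the lattice translates of a Borel set `E ⊆ Q₀` have the same law. -/
  identDistrib : ∀ E : Set Plane, MeasurableSet E → E ⊆ unitSquare → ∀ m n : Fin 2 → ℤ,
    IdentDistrib (fun ω => totalFlux (Γ ω) (α ω) (shift E m))
      (fun ω => totalFlux (Γ ω) (α ω) (shift E n)) P P
  /-- The mean of `Φ(Q₀)` is positive and finite. -/
  mean_pos : 0 < ∫⁻ ω, totalFlux (Γ ω) (α ω) unitSquare ∂P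
  mean_lt_top : ∫⁻ ω, totalFlux (Γ ω) (α ω) unitSquare ∂P < ⊤
  /-- The variance of `Φ(Q₀)` is finite. -/
  variance_lt_top : evariance (fun ω => (totalFlux (Γ ω) (α ω) unitSquare).toReal) P < ⊤
  /-- Almost surely there is no flux on the boundary of `Q₀`. -/
  boundary : ∀ᵐ ω ∂P, totalFlux (Γ ω) (α ω) (frontier unitSquare) = 0
  /-- Small fluxes have positive probability, in one of two senses. -/
  small :
    (∃ c : ℝ, 0 < c ∧ c ≤ 1 ∧ ∀ ε : ℝ, 0 < ε →
      0 < P {ω | totalFlux (Γ ω) (α ω) unitSquare < ENNReal.ofReal ε ∧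
        Separated (Γ ω) (α ω) c}) ∨
    (∀ ε : ℝ, 0 < ε → 0 < P {ω | sqrtFlux (Γ ω) (α ω) < ENNReal.ofReal ε})

end RandomDelta

end

/-! The argument is deterministic apart from one event: almost surely there are discs of every
radius whose total flux is as small as desired. Both alternatives in the smallness hypothesis give
`Φ(Q₀) < ε` with positive probability. By independence and equal distribution, a box of `(2M+1)²`
cells has small flux in every cell with a positive probability that does not depend on the box, and
the second Borel-Cantelli lemma applied to disjoint boxes finishes (`ae_exists_latticeBox`,
`FluxAssumptions.ae_exists_totalFlux_lt`).

Fix such an `ω`. The minimal operator has the form `D*D`, where `D` is the magnetic gradient.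
Projecting `(y, 0)` orthogonally onto the closed graph of `D` yields `(H + 1)⁻¹`, an operator
between `0` and `1`, so `σ(H) ⊆ [0, ∞)`. Conversely, a Weyl criterion in the form sense shows that
`|k|²` lies in the spectrum as soon as some test function `u` makes every `(D_j - k_j) u` small
relative to `u`; second derivatives of `u` are never needed.

Such a `u` is `exp(i(φ + k·x)) f`, with `f` supported in a disc of radius `R`. On the concentric
disc of radius `2R` the potential splits as `a = b + A`, where `A` is the sum of the Aharonov-Bohm
potentials of the fluxes there and `b` is curl-free. Mollification and the Poincaré lemma give `φ`
with `∇φ` close to `b` on the support of `f` (`exists_gauge`). It remains to find `f` vanishing near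
the points, close to `1` in mean, with `∇f` and `A f` small in `L²`. The bound must depend on the
total flux only, since the points may be arbitrarily close together.

The key is the product `m = ∏ (|x - γ|/L)^{α_γ}`. Off the points `log m` is harmonic, and its
gradient `G` is `A` rotated by a right angle. For a cutoff `q` vanishing near `0`, with `P' = q` and
`ℓ'(t) = P(t)/t`, one has `Δ ℓ(m) = div(P(m) G) = q(m) m |G|²`. Integrating against a cutoff `χ`
gives `∫ χ q(m) m |G|² = ∫ Δχ (ℓ(m) - ℓ(1))`, and `|ℓ(m) - ℓ(1)| ≤ 1 - m ≤ ∑ α_γ L/|x - γ|` has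
integral bounded by a constant times the flux. A smooth function `f` of `m` that vanishes for `m ≤
1/2` has both `|∇f|²` and `|G f|²` dominated by `q(m) m |G|²` (`exists_amplitude`).

Finally, the cutoff costs `∫ |∇χ|² = O(1)` while `∫ |u|²` grows like `R²`. One therefore takes `R`
large first, then the flux small depending on `R`. -/

noncomputable section

namespace RandomDelta

/-! ### Friedrichs extensions via closed graphs: resolvent and Weyl criterion -/

section FormMethod

variable {E F : Type*} [NormedAddCommGroup E] [InnerProductSpace ℂ E]
  [NormedAddCommGroup F] [InnerProductSpace ℂ F]

/-- The closure of the graph of a square root `D` of the form of an operator. -/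
def formGraph {T : E →ₗ.[ℂ] E} (D : T.domain →ₗ[ℂ] F) : Submodule ℂ (WithLp 2 (E × F)) :=
  (LinearMap.range ((WithLp.linearEquiv 2 ℂ (E × F)).symm.toLinearMap ∘ₗ
    T.domain.subtype.prod D)).topologicalClosure

lemma mem_formGraph_iff {T : E →ₗ.[ℂ] E} {D : T.domain →ₗ[ℂ] F} {p : WithLp 2 (E × F)} :
    p ∈ formGraph D ↔ ∃ u : ℕ → T.domain, Tendsto (fun n => (u n : E)) atTop (𝓝 p.fst) ∧
      Tendsto (fun n => D (u n)) atTop (𝓝 p.snd) := by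
  have hcont : Continuous (fun q : E × F => WithLp.toLp 2 q) := WithLp.prod_continuous_toLp 2 E F
  have hcont' : Continuous (fun q : WithLp 2 (E × F) => WithLp.ofLp q) :=
    WithLp.prod_continuous_ofLp 2 E F
  rw [formGraph, ← SetLike.mem_coe, Submodule.topologicalClosure_coe, mem_closure_iff_seq_limit]
  constructor
  · rintro ⟨v, hv, hlim⟩
    choose u hu using hv
    refine ⟨u, ?_, ?_⟩
    · have := ((continuous_fst.comp hcont').tendsto p).comp hlim
      refine this.congr fun n => ?_
      simp [← hu]
    · have := ((continuous_snd.comp hcont').tendsto p).comp hlim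
      refine this.congr fun n => ?_
      simp [← hu]
  · rintro ⟨u, h1, h2⟩
    exact ⟨fun n => WithLp.toLp 2 ((u n : E), D (u n)), fun n => ⟨u n, rfl⟩,
      (hcont.tendsto (p.fst, p.snd)).comp (h1.prodMk_nhds h2)⟩

lemma graph_mem_formGraph {T : E →ₗ.[ℂ] E} (D : T.domain →ₗ[ℂ] F) (u : T.domain) :
    WithLp.toLp 2 ((u : E), D u) ∈ formGraph D :=
  mem_formGraph_iff.2 ⟨fun _ => u, tendsto_const_nhds, tendsto_const_nhds⟩

/-- The factorisation `hD` passes to limits in its first argument. With `p.fst = 0` it shows that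
`p.snd` is orthogonal to the range of `D`, so the closed graph is again a graph. -/
lemma inner_snd_of_mem_formGraph {T : E →ₗ.[ℂ] E} {D : T.domain →ₗ[ℂ] F}
    (hD : ∀ x y : T.domain, inner ℂ (D x) (D y) = inner ℂ (x : E) (T y))
    {p : WithLp 2 (E × F)} (hp : p ∈ formGraph D) (u : T.domain) :
    inner ℂ p.snd (D u) = inner ℂ p.fst (T u) := by
  obtain ⟨v, h1, h2⟩ := mem_formGraph_iff.1 hp
  refine tendsto_nhds_unique (h2.inner tendsto_const_nhds) ?_
  simpa only [hD] using h1.inner (tendsto_const_nhds (x := T u))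

lemma energy_eq_norm_sq {T : E →ₗ.[ℂ] E} {D : T.domain →ₗ[ℂ] F}
    (hD : ∀ x y : T.domain, inner ℂ (D x) (D y) = inner ℂ (x : E) (T y)) (u : T.domain) :
    energy T u = ‖D u‖ ^ 2 := by
  rw [energy, ← hD, inner_self_eq_norm_sq_to_K]
  norm_cast

/-- Since the energy is `‖D u‖²`, a sequence is Cauchy for the form exactly when its image under `D`
is Cauchy, hence convergent in the complete space `F`. -/
lemma mem_formDomain_iff [CompleteSpace F] {T : E →ₗ.[ℂ] E} (hT : IsNonnegSymmetric T)
    {D : T.domain →ₗ[ℂ] F}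
    (hD : ∀ x y : T.domain, inner ℂ (D x) (D y) = inner ℂ (x : E) (T y)) {x : E} :
    x ∈ formDomain T hT ↔ ∃ ξ : F, WithLp.toLp 2 (x, ξ) ∈ formGraph D := by
  constructor
  · rintro ⟨u, hu, hc⟩
    have : CauchySeq fun n => D (u n) := by
      rw [Metric.cauchySeq_iff]
      intro ε hε
      obtain ⟨N, hN⟩ := hc (ε ^ 2) (by positivity)
      refine ⟨N, fun m hm n hn => ?_⟩
      have := hN m hm n hn
      rw [energy_eq_norm_sq hD, map_sub] at this
      rw [dist_eq_norm]
      exact lt_of_pow_lt_pow_left₀ 2 hε.le this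
    obtain ⟨ξ, hξ⟩ := cauchySeq_tendsto_of_complete this
    exact ⟨ξ, mem_formGraph_iff.2 ⟨u, hu, hξ⟩⟩
  · rintro ⟨ξ, h⟩
    obtain ⟨u, h1, h2⟩ := mem_formGraph_iff.1 h
    refine ⟨u, h1, fun ε hε => ?_⟩
    obtain ⟨N, hN⟩ := Metric.cauchySeq_iff.1 h2.cauchySeq (√ε) (by positivity)
    refine ⟨N, fun m hm n hn => ?_⟩
    have := hN m hm n hn
    rw [dist_eq_norm, Real.lt_sqrt (norm_nonneg _)] at this
    rwa [energy_eq_norm_sq hD, map_sub]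

variable [CompleteSpace E] [CompleteSpace F]

/-- Reduces the extension to its weak formulation; density of the domain makes the value of the
adjoint unique. -/
lemma mem_friedrichsExtension_iff {T : E →ₗ.[ℂ] E} (hT : IsNonnegSymmetric T)
    (hd : Dense (T.domain : Set E)) {x y : E} :
    (∃ h : x ∈ (friedrichsExtension T hT).domain, friedrichsExtension T hT ⟨x, h⟩ = y) ↔
      x ∈ formDomain T hT ∧ ∀ u : T.domain, inner ℂ y (u : E) = inner ℂ x (T u) := by
  constructor
  · rintro ⟨h, rfl⟩
    exact ⟨h.1, fun u => LinearPMap.adjoint_isFormalAdjoint hd ⟨x, h.2⟩ u⟩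
  · rintro ⟨h1, h2⟩
    have hx : x ∈ T.adjoint.domain := LinearPMap.mem_adjoint_domain_of_exists _ ⟨y, h2⟩
    exact ⟨⟨h1, hx⟩, LinearPMap.adjoint_apply_eq hd ⟨x, hx⟩ h2⟩

instance formGraph.hasOrthogonalProjection {T : E →ₗ.[ℂ] E} (D : T.domain →ₗ[ℂ] F) :
    (formGraph D).HasOrthogonalProjection :=
  haveI : CompleteSpace (formGraph D) :=
    (Submodule.isClosed_topologicalClosure _).completeSpace_coe
  inferInstance

/-- The operator `(H + 1)⁻¹`, where `H` is the Friedrichs extension. -/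
def formResolvent {T : E →ₗ.[ℂ] E} (D : T.domain →ₗ[ℂ] F) : E →L[ℂ] E :=
  (ContinuousLinearMap.fst ℂ E F ∘L (WithLp.prodContinuousLinearEquiv 2 ℂ E F).toContinuousLinearMap)
    ∘L (formGraph D).starProjection ∘L
    ((WithLp.prodContinuousLinearEquiv 2 ℂ E F).symm.toContinuousLinearMap ∘L
      ContinuousLinearMap.inl ℂ E F)

lemma formResolvent_apply {T : E →ₗ.[ℂ] E} (D : T.domain →ₗ[ℂ] F) (y : E) :
    formResolvent D y = ((formGraph D).starProjection (WithLp.toLp 2 (y, 0))).fst := rfl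

/-- The assumption `h'` says that `(y, 0) - (x, ξ)` is orthogonal to the graph of `D`, hence to its
closure, so `(x, ξ)` is the projection of `(y, 0)`. -/
lemma formResolvent_eq_of_mem {T : E →ₗ.[ℂ] E} {D : T.domain →ₗ[ℂ] F} {x y : E} {ξ : F}
    (h : WithLp.toLp 2 (x, ξ) ∈ formGraph D)
    (h' : ∀ u : T.domain, inner ℂ (y - x) (u : E) = inner ℂ ξ (D u)) :
    formResolvent D y = x := by
  have : (formGraph D).starProjection (WithLp.toLp 2 (y, 0)) = WithLp.toLp 2 (x, ξ) := by
    refine Submodule.eq_starProjection_of_mem_of_inner_eq_zero h fun w hw => ?_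
    obtain ⟨u, h1, h2⟩ := mem_formGraph_iff.1 hw
    have h3 := (tendsto_const_nhds (x := y - x)).inner (𝕜 := ℂ) h1
    have h4 := (tendsto_const_nhds (x := ξ)).inner (𝕜 := ℂ) h2
    simp only [h'] at h3
    have := tendsto_nhds_unique h3 h4
    simp [WithLp.prod_inner_apply] at this ⊢
    simp [this]
  exact (formResolvent_apply D y).trans (congrArg WithLp.fst this)

lemma formResolvent_spec {T : E →ₗ.[ℂ] E} {D : T.domain →ₗ[ℂ] F}
    (hD : ∀ x y : T.domain, inner ℂ (D x) (D y) = inner ℂ (x : E) (T y)) (y : E) :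
    (∃ ξ, WithLp.toLp 2 (formResolvent D y, ξ) ∈ formGraph D) ∧
      ∀ u : T.domain, inner ℂ (y - formResolvent D y) (u : E)
        = inner ℂ (formResolvent D y) (T u) := by
  set p := (formGraph D).starProjection (WithLp.toLp 2 (y, 0)) with hp
  have hm : p ∈ formGraph D := Submodule.starProjection_apply_mem _ _
  refine ⟨⟨p.snd, hm⟩, fun u => ?_⟩
  have h := Submodule.starProjection_inner_eq_zero (K := formGraph D) (WithLp.toLp 2 (y, 0)) _
    (graph_mem_formGraph D u)
  rw [← hp] at h
  have h2 := inner_snd_of_mem_formGraph hD hm u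
  simp [WithLp.prod_inner_apply] at h
  rw [formResolvent_apply, ← hp, ← h2]
  linear_combination h

/-- `formResolvent D` is the compression to `E` of an orthogonal projection in `E ⊕ F`.
Self-adjointness and the bounds `0 ≤ formResolvent D ≤ 1` follow from this. -/
lemma inner_formResolvent {T : E →ₗ.[ℂ] E} (D : T.domain →ₗ[ℂ] F) (x y : E) :
    inner ℂ (formResolvent D x) y = inner ℂ
      ((formGraph D).starProjection (WithLp.toLp 2 (x, (0 : F)))) (WithLp.toLp 2 (y, (0 : F))) := by
  simp [WithLp.prod_inner_apply, formResolvent_apply]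

lemma formResolvent_nonneg {T : E →ₗ.[ℂ] E} (D : T.domain →ₗ[ℂ] F) :
    0 ≤ formResolvent D := by
  rw [ContinuousLinearMap.nonneg_iff_isPositive, ContinuousLinearMap.isPositive_def']
  refine ⟨?_, fun x => ?_⟩
  · rw [ContinuousLinearMap.isSelfAdjoint_iff_isSymmetric]
    intro x y
    change inner ℂ (formResolvent D x) y = inner ℂ x (formResolvent D y)
    rw [← inner_conj_symm x, inner_formResolvent, inner_formResolvent,
      Submodule.inner_starProjection_left_eq_right, inner_conj_symm]
  · rw [ContinuousLinearMap.reApplyInnerSelf_apply, inner_formResolvent,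
      Submodule.re_inner_starProjection_eq_normSq]
    positivity

lemma formResolvent_le_one {T : E →ₗ.[ℂ] E} (D : T.domain →ₗ[ℂ] F) :
    formResolvent D ≤ 1 := by
  rw [ContinuousLinearMap.le_def, ContinuousLinearMap.isPositive_def']
  refine ⟨(IsSelfAdjoint.one _).sub (formResolvent_nonneg D).isSelfAdjoint, fun x => ?_⟩
  rw [ContinuousLinearMap.reApplyInnerSelf_apply, sub_apply,
    inner_sub_left, map_sub, inner_formResolvent, Submodule.re_inner_starProjection_eq_normSq,
    one_apply_eq_self, inner_self_eq_norm_sq, sub_nonneg]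
  have h1 : ‖WithLp.toLp 2 (x, (0 : F))‖ = ‖x‖ := by simp
  have h2 := (formGraph D).norm_starProjection_apply_le (WithLp.toLp 2 (x, (0 : F)))
  rw [h1] at h2
  exact pow_le_pow_left₀ (norm_nonneg _) h2 2

lemma spectrum_formResolvent_subset {T : E →ₗ.[ℂ] E} (D : T.domain →ₗ[ℂ] F) {z : ℂ}
    (hz : z ∈ spectrum ℂ (formResolvent D)) : ∃ t : ℝ, 0 ≤ t ∧ t ≤ 1 ∧ z = t := by
  have h0 := formResolvent_nonneg D
  have hre : z = z.re := h0.isSelfAdjoint.mem_spectrum_eq_re hz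
  have hz' : z.re ∈ spectrum ℝ (formResolvent D) := by
    rw [hre] at hz
    exact spectrum.of_algebraMap_mem ℂ hz
  refine ⟨z.re, spectrum_nonneg_of_nonneg h0 hz', ?_, hre⟩
  have h1 : 0 ≤ 1 - formResolvent D := sub_nonneg.2 (formResolvent_le_one D)
  have : 1 - z.re ∈ spectrum ℝ (1 - formResolvent D) := by
    have := (spectrum.singleton_sub_eq (formResolvent D) (1 : ℝ)).symm ▸
      Set.sub_mem_sub (Set.mem_singleton (1 : ℝ)) hz'
    simpa using this
  linarith [spectrum_nonneg_of_nonneg h1 this]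

/-- The spectrum of the Friedrichs extension is contained in `[0, ∞)`. -/
theorem opSpectrum_friedrichsExtension_subset {T : E →ₗ.[ℂ] E} (hT : IsNonnegSymmetric T)
    (hd : Dense (T.domain : Set E)) {D : T.domain →ₗ[ℂ] F}
    (hD : ∀ x y : T.domain, inner ℂ (D x) (D y) = inner ℂ (x : E) (T y)) {z : ℂ}
    (hz : z ∈ opSpectrum (friedrichsExtension T hT)) : ∃ t : ℝ, 0 ≤ t ∧ z = t := by
  by_contra! hcon
  apply hz
  set R := formResolvent D with hR
  -- From `H - z = (H + 1) - (z + 1)` the resolvent must be `R (1 - (z + 1) R)⁻¹`. The inverse could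
  -- only fail to exist if `(z + 1)⁻¹ = t` with `0 < t ≤ 1`, that is `z = 1/t - 1 ≥ 0`.
  have hunit : IsUnit (1 - (z + 1) • R) := by
    by_cases h1 : z + 1 = 0
    · simp [h1]
    have : (z + 1)⁻¹ ∉ spectrum ℂ R := by
      intro h
      obtain ⟨t, ht0, ht1, ht⟩ := spectrum_formResolvent_subset D h
      have htne : t ≠ 0 := by
        rintro rfl
        simp [h1] at ht
      have htp : 0 < t := lt_of_le_of_ne ht0 htne.symm
      refine hcon (t⁻¹ - 1) (sub_nonneg.2 ((one_le_inv₀ htp).2 ht1)) ?_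
      push_cast
      rw [← ht, inv_inv]
      ring
    rw [spectrum.notMem_iff] at this
    have h2 := this.smul (Units.mk0 _ h1)
    convert h2 using 1
    rw [Units.smul_def, Units.val_mk0, smul_sub, Algebra.algebraMap_eq_smul_one, smul_smul,
      mul_inv_cancel₀ h1, one_smul]
  obtain ⟨S, hS⟩ := hunit
  have hcomm : Commute R (S : E →L[ℂ] E) := by
    rw [hS]
    exact (Commute.one_right R).sub_right ((Commute.refl R).smul_right _)
  have hS1 : ∀ y, (S : E →L[ℂ] E) ((↑S⁻¹ : E →L[ℂ] E) y) = y := fun y => by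
    rw [← mul_apply_eq_comp, S.mul_inv, one_apply_eq_self]
  have hS2 : ∀ y, (↑S⁻¹ : E →L[ℂ] E) ((S : E →L[ℂ] E) y) = y := fun y => by
    rw [← mul_apply_eq_comp, S.inv_mul, one_apply_eq_self]
  have hSa : ∀ y, (S : E →L[ℂ] E) y = y - (z + 1) • R y := fun y => by rw [hS]; rfl
  refine ⟨R * ↑S⁻¹, fun y => ?_, fun x => ?_⟩
  · set w := (↑S⁻¹ : E →L[ℂ] E) y with hw
    have hsp := formResolvent_spec hD w
    obtain ⟨h, he⟩ := (mem_friedrichsExtension_iff hT hd (x := R w) (y := w - R w)).2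
      ⟨(mem_formDomain_iff hT hD).2 hsp.1, hsp.2⟩
    refine ⟨h, ?_⟩
    have h3 := hSa w
    rw [hw, hS1, ← hw] at h3
    change friedrichsExtension T hT ⟨R w, h⟩ - z • R w = y
    rw [he, h3]
    module
  · obtain ⟨h1, h2⟩ := (mem_friedrichsExtension_iff hT hd).1
      ⟨x.2, rfl⟩
    obtain ⟨ξ, hξ⟩ := (mem_formDomain_iff hT hD).1 h1
    set Hx := friedrichsExtension T hT x with hHx
    have h3 : R (Hx + x) = x := by
      refine formResolvent_eq_of_mem hξ fun u => ?_
      rw [add_sub_cancel_right]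
      exact (h2 u).trans (inner_snd_of_mem_formGraph hD hξ u).symm
    have h4 : R (Hx - z • (x : E)) = (S : E →L[ℂ] E) x := by
      rw [hSa]
      conv_rhs => rw [← h3]
      rw [h3]
      have : Hx - z • (x : E) = (Hx + x) - (z + 1) • (x : E) := by module
      rw [this, map_sub, h3, map_smul]
    have h5 : Commute R (↑S⁻¹ : E →L[ℂ] E) := hcomm.units_inv_right
    rw [h5.eq, mul_apply_eq_comp, h4, hS2]

/-- A version of Weyl's criterion in terms of quadratic forms. -/
theorem mem_opSpectrum_friedrichsExtension {T : E →ₗ.[ℂ] E} (hT : IsNonnegSymmetric T)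
    (hd : Dense (T.domain : Set E)) {D : T.domain →ₗ[ℂ] F}
    (hD : ∀ x y : T.domain, inner ℂ (D x) (D y) = inner ℂ (x : E) (T y)) {t : ℝ}
    (ht : ∀ ε > 0, ∃ u : T.domain, ‖(u : E)‖ = 1 ∧ ∀ w : T.domain,
      ‖inner ℂ (D w) (D u) - t * inner ℂ (w : E) (u : E)‖ ≤ ε * (‖(w : E)‖ + ‖D w‖)) :
    (t : ℂ) ∈ opSpectrum (friedrichsExtension T hT) := by
  rintro ⟨S, hS, -⟩
  -- `M` will bound both `‖v‖` and `‖ξ‖` for `v = S u`, where `ξ` is the closure of `D` at `v`. With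
  -- `ε = 1/(4M)` the form estimate tested at `v` is at most `1/2`, whereas its left side equals
  -- `⟨u, u⟩ = 1`.
  set M := 1 + |t| * ‖S‖ + ‖S‖ with hM
  have hMpos : 0 < M := by positivity
  obtain ⟨u, hu1, hu⟩ := ht (1 / (4 * M)) (by positivity)
  obtain ⟨h, he⟩ := hS u
  set v := S u with hv
  set Hv := friedrichsExtension T hT ⟨v, h⟩ with hHv
  obtain ⟨h1, h2⟩ := (mem_friedrichsExtension_iff hT hd).1 ⟨h, hHv.symm⟩
  obtain ⟨ξ, hξ⟩ := (mem_formDomain_iff hT hD).1 h1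
  have hsnd : ∀ w : T.domain, inner ℂ ξ (D w) = inner ℂ Hv (w : E) := fun w =>
    (inner_snd_of_mem_formGraph hD hξ w).trans (h2 w).symm
  have hvS : ‖v‖ ≤ ‖S‖ := by simpa [hu1] using S.le_opNorm u
  have hHv' : Hv = u + (t : ℂ) • v := by rw [← he]; abel
  have hHvS : ‖Hv‖ ≤ 1 + |t| * ‖S‖ := by
    rw [hHv']
    refine (norm_add_le _ _).trans ?_
    rw [hu1, norm_smul, Complex.norm_real, Real.norm_eq_abs]
    gcongr
  obtain ⟨w, hw1, hw2⟩ := mem_formGraph_iff.1 hξ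
  have hξξ : inner ℂ ξ ξ = inner ℂ Hv v := by
    refine tendsto_nhds_unique ((tendsto_const_nhds (x := ξ)).inner hw2) ?_
    simp only [hsnd]
    exact (tendsto_const_nhds (x := Hv)).inner (𝕜 := ℂ) hw1
  have hξM : ‖ξ‖ ≤ M := by
    have h3 : ‖ξ‖ ^ 2 ≤ ‖Hv‖ * ‖v‖ := by
      have := norm_inner_le_norm (𝕜 := ℂ) Hv v
      rw [← hξξ, inner_self_eq_norm_sq_to_K] at this
      simpa using this
    have h4 : ‖Hv‖ * ‖v‖ ≤ M ^ 2 := by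
      rw [sq]
      have : 0 ≤ |t| * ‖S‖ := by positivity
      have : 0 ≤ ‖S‖ := by positivity
      gcongr <;> linarith
    exact le_of_sq_le_sq (h3.trans h4) hMpos.le
  -- The estimate is assumed only on the domain of `T`; it reaches `v` by approximation in the form
  -- norm.
  have hlim : ‖inner ℂ ξ (D u) - t * inner ℂ v (u : E)‖ ≤ 1 / (4 * M) * (‖v‖ + ‖ξ‖) := by
    exact le_of_tendsto_of_tendsto'
      ((hw2.inner tendsto_const_nhds).sub
        (tendsto_const_nhds.mul (hw1.inner tendsto_const_nhds))).norm
      ((hw1.norm.add hw2.norm).const_mul _) (fun n => hu (w n))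
  have hone : inner ℂ ξ (D u) - t * inner ℂ v (u : E) = 1 := by
    rw [hsnd, hHv', inner_add_left, inner_smul_left, inner_self_eq_norm_sq_to_K, hu1]
    simp
  rw [hone, norm_one] at hlim
  have : 1 / (4 * M) * (‖v‖ + ‖ξ‖) ≤ 1 / (4 * M) * (M + M) := by
    have : 0 ≤ |t| * ‖S‖ := by positivity
    gcongr
    linarith
  have h5 : 1 / (4 * M) * (M + M) = 1 / 2 := by field_simp; norm_num
  linarith

end FormMethod

/-! ### The magnetic gradient and its approximate joint eigenfunctions -/

section Gradient

open scoped ContDiff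

variable {Γ : Set Plane} {a : Plane → Plane}

/-- Compactly supported smooth functions on the complement of a closed null set are dense. -/
lemma dense_range_toL2 (hc : IsClosed Γ) (h0 : volume Γ = 0) :
    Dense (LinearMap.range (toL2 Γ) : Set L2) := by
  rw [Submodule.dense_iff_topologicalClosure_eq_top, Submodule.topologicalClosure_eq_top_iff,
    Submodule.eq_bot_iff]
  intro f hf
  rw [Submodule.mem_orthogonal] at hf
  have hloc : LocallyIntegrable (f : Plane → ℂ) volume :=
    (Lp.memLp f).locallyIntegrable (by norm_num)
  have key := hc.isOpen_compl.ae_eq_zero_of_integral_contDiff_smul_eq_zero (μ := volume)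
    (hloc.locallyIntegrableOn _) (fun g hg hgc hgs => by
      let u : testFun Γ := ⟨fun x => (g x : ℂ), Complex.ofRealCLM.contDiff.comp hg,
        hgc.comp_left (g := ((↑) : ℝ → ℂ)) Complex.ofReal_zero,
        (tsupport_comp_subset (g := ((↑) : ℝ → ℂ)) Complex.ofReal_zero g).trans hgs⟩
      have h := hf _ ⟨u, rfl⟩
      rw [L2.inner_def] at h
      rw [← h]
      refine integral_congr_ae ?_
      filter_upwards [(memLp_of_mem_testFun u.2).coeFn_toLp] with x hx
      change _ = inner ℂ (((memLp_of_mem_testFun u.2).toLp u : L2) x) (f x)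
      rw [hx]
      simp [u, mul_comm])
  refine (Lp.eq_zero_iff_ae_eq_zero).2 ?_
  filter_upwards [key, measure_eq_zero_iff_ae_notMem.1 h0] with x hx hx'
  exact hx hx'

/-- The magnetic gradient `(1/i) ∇ - a` on the domain of the minimal operator. -/
def magneticGradient (ha : SmoothOff Γ a) :
    (minimalOperator ha).domain →ₗ[ℂ] PiLp 2 (fun _ : Fin 2 => L2) :=
  (WithLp.linearEquiv 2 ℂ (Fin 2 → L2)).symm.toLinearMap ∘ₗ
    LinearMap.pi (fun j => toL2 Γ ∘ₗ covD ha j) ∘ₗ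
      (LinearEquiv.ofInjective (toL2 Γ) (toL2_injective Γ)).symm.toLinearMap

lemma minimalOperator_domain_cases (ha : SmoothOff Γ a) (x : (minimalOperator ha).domain) :
    ∃ u : testFun Γ, (x : L2) = toL2 Γ u ∧
      minimalOperator ha x = toL2 Γ (magneticLaplacian ha u) ∧
      ∀ j, magneticGradient ha x j = toL2 Γ (covD ha j u) :=
  ⟨(LinearEquiv.ofInjective (toL2 Γ) (toL2_injective Γ)).symm x,
    (congrArg Subtype.val ((LinearEquiv.ofInjective (toL2 Γ)
      (toL2_injective Γ)).apply_symm_apply x)).symm, rfl, fun _ => rfl⟩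

lemma inner_magneticGradient (ha : SmoothOff Γ a) (x y : (minimalOperator ha).domain) :
    inner ℂ (magneticGradient ha x) (magneticGradient ha y)
      = inner ℂ (x : L2) (minimalOperator ha y) := by
  obtain ⟨u, hu, -, hu'⟩ := minimalOperator_domain_cases ha x
  obtain ⟨v, -, hv, hv'⟩ := minimalOperator_domain_cases ha y
  rw [hu, hv, PiLp.inner_apply]
  simp only [hu', hv', magneticLaplacian, LinearMap.sum_apply, map_sum, LinearMap.comp_apply,
    inner_sum, inner_covD]

lemma norm_toL2_sq (u : testFun Γ) : ‖toL2 Γ u‖ ^ 2 = ∫ x, ‖(u : Plane → ℂ) x‖ ^ 2 := by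
  have h := inner_toL2 u u
  rw [inner_self_eq_norm_sq_to_K] at h
  have h2 : ∀ x, (u : Plane → ℂ) x * (starRingEnd ℂ) ((u : Plane → ℂ) x)
      = ((‖(u : Plane → ℂ) x‖ ^ 2 : ℝ) : ℂ) := fun x => by
    rw [Complex.mul_conj']; norm_cast
  simp only [h2, integral_complex_ofReal] at h
  refine Complex.ofReal_injective (Eq.trans ?_ h)
  norm_cast

theorem opSpectrum_hamiltonian_subset (ha : SmoothOff Γ a) (hc : IsClosed Γ) (h0 : volume Γ = 0)
    {z : ℂ} (hz : z ∈ opSpectrum (hamiltonian ha)) : ∃ t : ℝ, 0 ≤ t ∧ z = t :=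
  opSpectrum_friedrichsExtension_subset _ (dense_range_toL2 hc h0)
    (inner_magneticGradient ha) hz

/-- Approximate joint eigenfunctions of the components of the magnetic gradient produce
points of the spectrum of the Hamiltonian. -/
theorem mem_opSpectrum_hamiltonian (ha : SmoothOff Γ a) (hc : IsClosed Γ) (h0 : volume Γ = 0)
    (k : Fin 2 → ℝ)
    (h : ∀ ε > 0, ∃ u ∈ testFun Γ, 0 < ∫ x, ‖u x‖ ^ 2 ∧
      ∀ j, ∫ x, ‖covDeriv a j u x - k j * u x‖ ^ 2 ≤ ε ^ 2 * ∫ x, ‖u x‖ ^ 2) :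
    ((∑ j, k j ^ 2 : ℝ) : ℂ) ∈ opSpectrum (hamiltonian ha) := by
  refine mem_opSpectrum_friedrichsExtension (minimalOperator_nonnegSymmetric ha)
    (dense_range_toL2 hc h0) (inner_magneticGradient ha) fun ε hε => ?_
  -- This is `∑ j, (1 + |k j|)`, the loss in passing from the two components to the quadratic form.
  set C : ℝ := 2 + ∑ j, |k j| with hC
  have hCpos : 0 < C := by positivity
  obtain ⟨u₀, hu₀, hpos, hu⟩ := h (ε / C) (by positivity)
  set u : testFun Γ := ⟨u₀, hu₀⟩ with hudef
  have hun : ‖toL2 Γ u‖ ^ 2 = ∫ x, ‖u₀ x‖ ^ 2 := norm_toL2_sq u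
  have hupos : 0 < ‖toL2 Γ u‖ := by
    refine lt_of_le_of_ne (norm_nonneg _) fun h => ?_
    rw [← h] at hun
    simp [← hun] at hpos
  set r : ℂ := ((‖toL2 Γ u‖⁻¹ : ℝ) : ℂ) with hr
  have hrn : ‖r‖ = ‖toL2 Γ u‖⁻¹ := by
    rw [hr, Complex.norm_real, norm_inv, norm_norm]
  set v : testFun Γ := r • u with hv
  have hv1 : ‖toL2 Γ v‖ = 1 := by
    rw [hv, map_smul, norm_smul, hrn, inv_mul_cancel₀ hupos.ne']
  have herr : ∀ j, ‖toL2 Γ (covD ha j v) - (k j : ℂ) • toL2 Γ v‖ ≤ ε / C := by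
    intro j
    have e : toL2 Γ (covD ha j v) - (k j : ℂ) • toL2 Γ v
        = r • toL2 Γ (covD ha j u - (k j : ℂ) • u) := by
      rw [hv]
      simp only [map_smul, map_sub]
      module
    rw [e, norm_smul, hrn, inv_mul_le_iff₀ hupos]
    refine le_of_sq_le_sq ?_ (by positivity)
    rw [norm_toL2_sq, mul_pow, hun, mul_comm]
    exact hu j
  refine ⟨⟨toL2 Γ v, v, rfl⟩, hv1, fun w => ?_⟩
  obtain ⟨v', hvv', -, hgv⟩ := minimalOperator_domain_cases ha ⟨toL2 Γ v, v, rfl⟩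
  obtain rfl : v = v' := toL2_injective Γ hvv'
  obtain ⟨w', hw', -, hgw⟩ := minimalOperator_domain_cases ha w
  have hgn : ∀ j, ‖toL2 Γ (covD ha j w')‖ ≤ ‖magneticGradient ha w‖ := fun j => by
    rw [← hgw]
    exact PiLp.norm_apply_le _ j
  -- The factorisation `D_j² - k_j² = (D_j + k_j)(D_j - k_j)` in weak form, with `D_j + k_j` moved
  -- onto `w` by symmetry.
  have e : inner ℂ (magneticGradient ha w) (magneticGradient ha ⟨toL2 Γ v, v, rfl⟩)
      - ((∑ j, k j ^ 2 : ℝ) : ℂ) * inner ℂ (w : L2) (toL2 Γ v)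
      = ∑ j, (inner ℂ (toL2 Γ (covD ha j w')) (toL2 Γ (covD ha j v) - (k j : ℂ) • toL2 Γ v)
        + k j * inner ℂ (toL2 Γ w') (toL2 Γ (covD ha j v) - (k j : ℂ) • toL2 Γ v)) := by
    rw [PiLp.inner_apply, hw']
    simp only [hgv, hgw, inner_sub_right, inner_smul_right, inner_covD ha _ w' v,
      Complex.ofReal_sum, Finset.sum_mul, ← Finset.sum_sub_distrib, Complex.ofReal_pow]
    refine Finset.sum_congr rfl fun j _ => ?_
    ring
  change ‖inner ℂ (magneticGradient ha w) (magneticGradient ha ⟨toL2 Γ v, v, rfl⟩)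
      - ((∑ j, k j ^ 2 : ℝ) : ℂ) * inner ℂ (w : L2) (toL2 Γ v)‖ ≤ _
  rw [e]
  have hj : ∀ j, ‖inner ℂ (toL2 Γ (covD ha j w')) (toL2 Γ (covD ha j v) - (k j : ℂ) • toL2 Γ v)
        + k j * inner ℂ (toL2 Γ w') (toL2 Γ (covD ha j v) - (k j : ℂ) • toL2 Γ v)‖
      ≤ (1 + |k j|) * (ε / C * (‖(w : L2)‖ + ‖magneticGradient ha w‖)) := by
    intro j
    have h1 : ‖inner ℂ (toL2 Γ (covD ha j w')) (toL2 Γ (covD ha j v) - (k j : ℂ) • toL2 Γ v)‖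
        ≤ ‖magneticGradient ha w‖ * (ε / C) :=
      (norm_inner_le_norm _ _).trans (by gcongr; exacts [hgn j, herr j])
    have h2 : ‖(k j : ℂ) * inner ℂ (toL2 Γ w') (toL2 Γ (covD ha j v) - (k j : ℂ) • toL2 Γ v)‖
        ≤ |k j| * (‖(w : L2)‖ * (ε / C)) := by
      rw [norm_mul, Complex.norm_real, Real.norm_eq_abs, hw']
      gcongr
      exact (norm_inner_le_norm _ _).trans (by gcongr; exact herr j)
    refine (norm_add_le _ _).trans ((add_le_add h1 h2).trans ?_)
    have h3 : 0 ≤ ‖(w : L2)‖ * (ε / C) := by positivity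
    have h4 : 0 ≤ |k j| * (‖magneticGradient ha w‖ * (ε / C)) := by positivity
    linarith
  refine (norm_sum_le _ _).trans ((Finset.sum_le_sum fun j _ => hj j).trans (le_of_eq ?_))
  rw [← Finset.sum_mul]
  have : ∑ j, (1 + |k j|) = C := by
    rw [Finset.sum_add_distrib, hC]
    simp
  rw [this]
  field_simp

end Gradient

/-! ### Aharonov-Bohm potentials and their magnetic field -/

section AharonovBohm

open scoped ContDiff

lemma locallyIntegrable_inv_norm_sub (γ : Plane) :
    LocallyIntegrable (fun x : Plane => ‖x - γ‖⁻¹) volume := by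
  have h0 : LocallyIntegrable (fun x : Plane => ‖x‖⁻¹) volume := by
    refine locallyIntegrable_of_norm_le_rpow (C := 1) (α := 1) (by simp) (by simp)
      (ae_of_all _ fun x => ?_) (by fun_prop)
    rw [Real.rpow_neg_one, norm_inv, norm_norm, one_mul]
  rw [locallyIntegrable_iff] at h0 ⊢
  intro K hK
  have := (measurePreserving_sub_right (volume : Measure Plane) γ).integrableOn_comp_preimage
    (MeasurableEquiv.subRight γ).measurableEmbedding (f := fun x => ‖x‖⁻¹) (s := (· - γ) '' K)
  have h2 := this.2 (h0 _ (hK.image (f := fun x => x - γ) (by fun_prop)))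
  exact h2.mono_set (Set.subset_preimage_image _ _)

lemma integral_eq_integral_sphere {g : Plane → ℝ} (hg : Integrable g volume) :
    ∫ x, g x = ∫ θ : Metric.sphere (0 : Plane) 1,
      (∫ r in Set.Ioi (0 : ℝ), r * g (r • (θ : Plane)))
        ∂(volume : Measure Plane).toSphere := by
  have hmp := (volume : Measure Plane).measurePreserving_homeomorphUnitSphereProd
  have hemb := (homeomorphUnitSphereProd Plane).measurableEmbedding
  set G : Metric.sphere (0 : Plane) 1 × Set.Ioi (0 : ℝ) → ℝ :=
    fun p => g ((p.2 : ℝ) • (p.1 : Plane)) with hG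
  have hGc : ∀ x : ({0}ᶜ : Set Plane), G (homeomorphUnitSphereProd Plane x) = g x := by
    intro x
    have hx : ‖(x : Plane)‖ ≠ 0 := norm_ne_zero_iff.2 x.2
    simp [hG, smul_smul, hx]
  have h1 : ∫ x, g x = ∫ p, G p ∂((volume : Measure Plane).toSphere.prod
      (Measure.volumeIoiPow (Module.finrank ℝ Plane - 1))) := by
    rw [← hmp.integral_comp hemb]
    simp only [hGc]
    rw [integral_subtype_comap (measurableSet_singleton _).compl g,
      restrict_compl_singleton]
  have h2 : Integrable G ((volume : Measure Plane).toSphere.prod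
      (Measure.volumeIoiPow (Module.finrank ℝ Plane - 1))) := by
    rw [← hmp.integrable_comp_emb hemb]
    have : G ∘ homeomorphUnitSphereProd Plane = g ∘ Subtype.val := funext hGc
    rw [this, ← integrableOn_iff_comap_subtypeVal (measurableSet_singleton _).compl]
    exact hg.integrableOn
  rw [h1, integral_prod _ h2]
  refine integral_congr_ae (ae_of_all _ fun θ => ?_)
  simp only [Measure.volumeIoiPow]
  rw [integral_withDensity_eq_integral_toReal_smul (by fun_prop) (by simp)]
  rw [integral_subtype_comap measurableSet_Ioi
    (fun r : ℝ => (ENNReal.ofReal (r ^ (Module.finrank ℝ Plane - 1))).toReal • g (r • (θ : Plane)))]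
  refine setIntegral_congr_fun measurableSet_Ioi fun r hr => ?_
  have hr' : (0 : ℝ) < r := hr
  simp [ENNReal.toReal_ofReal hr'.le]

/-- In polar coordinates the weight `r` turns the integrand into the radial derivative of `η`. Each
ray contributes `-η 0`, and the unit circle has length `2π`. -/
lemma integral_fderiv_self_div_norm_sq {η : Plane → ℝ} (hη : ContDiff ℝ ∞ η)
    (hc : HasCompactSupport η) :
    ∫ x, fderiv ℝ η x x / ‖x‖ ^ 2 = -(2 * Real.pi * η 0) := by
  have hdc : Continuous (fderiv ℝ η) := hη.continuous_fderiv (by simp)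
  have hint : Integrable (fun x => fderiv ℝ η x x / ‖x‖ ^ 2) (volume : Measure Plane) := by
    have h1 : Integrable (fun x => ‖fderiv ℝ η x‖ * ‖x - 0‖⁻¹) (volume : Measure Plane) :=
      (locallyIntegrable_inv_norm_sub 0).integrable_smul_left_of_hasCompactSupport hdc.norm
        (hc.fderiv ℝ).norm
    refine h1.mono' ((hdc.clm_apply continuous_id).measurable.div
      (by fun_prop)).aestronglyMeasurable (ae_of_all _ fun x => ?_)
    rw [norm_div, norm_pow, norm_norm, sub_zero]
    by_cases hx : ‖x‖ = 0
    · simp [hx]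
    rw [div_le_iff₀ (by positivity)]
    calc ‖fderiv ℝ η x x‖ ≤ ‖fderiv ℝ η x‖ * ‖x‖ := ContinuousLinearMap.le_opNorm _ _
      _ = _ := by field_simp
  rw [integral_eq_integral_sphere hint]
  have key : ∀ θ : Metric.sphere (0 : Plane) 1, ∫ r in Set.Ioi (0 : ℝ),
      r * (fderiv ℝ η (r • (θ : Plane)) (r • (θ : Plane)) / ‖r • (θ : Plane)‖ ^ 2) = - η 0 := by
    intro θ
    have hθ : ‖(θ : Plane)‖ = 1 := by simp
    have e : ∫ r in Set.Ioi (0 : ℝ),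
      r * (fderiv ℝ η (r • (θ : Plane)) (r • (θ : Plane)) / ‖r • (θ : Plane)‖ ^ 2)
      = ∫ r in Set.Ioi (0 : ℝ), fderiv ℝ η (r • (θ : Plane)) (θ : Plane) := by
      refine setIntegral_congr_fun measurableSet_Ioi fun r hr => ?_
      have hr' : (0 : ℝ) < r := hr
      simp only [map_smul, norm_smul, hθ, smul_eq_mul, Real.norm_eq_abs, mul_one, sq_abs]
      field_simp
    rw [e]
    have hcomp : HasCompactSupport (fun r : ℝ => η (r • (θ : Plane))) := by
      refine hc.comp_isClosedEmbedding (g := fun r : ℝ => r • (θ : Plane)) ?_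
      exact isClosedEmbedding_smul_left (by rintro h; simp [h] at hθ)
    have hder : ∀ r : ℝ, HasDerivAt (fun r : ℝ => η (r • (θ : Plane)))
        (fderiv ℝ η (r • (θ : Plane)) (θ : Plane)) r := by
      intro r
      have h1 := ((hη.differentiable (by simp)) (r • (θ : Plane))).hasFDerivAt
      have h2 : HasDerivAt (fun r : ℝ => r • (θ : Plane)) ((1 : ℝ) • (θ : Plane)) r :=
        (hasDerivAt_id r).smul_const _
      rw [one_smul] at h2
      exact h1.comp_hasDerivAt r h2
    have hcont : Continuous fun r : ℝ => fderiv ℝ η (r • (θ : Plane)) (θ : Plane) :=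
      (hdc.comp (by fun_prop)).clm_apply continuous_const
    have hdc' : HasCompactSupport fun r : ℝ => fderiv ℝ η (r • (θ : Plane)) (θ : Plane) := by
      have := hcomp.deriv
      rwa [show deriv (fun r : ℝ => η (r • (θ : Plane)))
        = fun r : ℝ => fderiv ℝ η (r • (θ : Plane)) (θ : Plane) from
          funext fun r => (hder r).deriv] at this
    have := integral_Ioi_of_hasDerivAt_of_tendsto (a := 0) (m := 0) (f := fun r : ℝ => η (r • (θ : Plane)))
      (hder 0).continuousAt.continuousWithinAt (fun r _ => hder r)
      (hcont.integrable_of_hasCompactSupport hdc').integrableOn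
      (hcomp.is_zero_at_infty.mono_left atTop_le_cocompact)
    rw [this]
    simp
  simp only [key]
  rw [integral_const, Measure.toSphere_real_apply_univ]
  have : (volume : Measure Plane).real (Metric.ball 0 1) = Real.pi := by
    rw [Measure.real, EuclideanSpace.volume_ball_fin_two]
    simp [Real.pi_pos.le]
  rw [this]
  simp

/-- The Aharonov-Bohm potential `x^⊥ / |x|²`, centred at `γ`. -/
def abPotential (γ x : Plane) : Plane :=
  (‖x - γ‖ ^ 2)⁻¹ • !₂[-(x 1 - γ 1), x 0 - γ 0]

lemma abPotential_zero (γ x : Plane) : abPotential γ x 0 = -((x 1 - γ 1) / ‖x - γ‖ ^ 2) := by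
  simp [abPotential]; ring

lemma abPotential_one (γ x : Plane) : abPotential γ x 1 = (x 0 - γ 0) / ‖x - γ‖ ^ 2 := by
  simp [abPotential]; ring

lemma norm_abPotential (γ x : Plane) : ‖abPotential γ x‖ = ‖x - γ‖⁻¹ := by
  have h : ‖!₂[-(x 1 - γ 1), x 0 - γ 0]‖ = ‖x - γ‖ := by
    rw [EuclideanSpace.norm_eq, EuclideanSpace.norm_eq]
    simp only [Fin.sum_univ_two, Real.norm_eq_abs, sq_abs, PiLp.sub_apply]
    congr 1
    simp
    ring
  rw [abPotential, norm_smul, h, norm_inv, norm_pow, norm_norm]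
  by_cases hx : ‖x - γ‖ = 0
  · simp [hx]
  field_simp

lemma contDiffAt_abPotential {γ x : Plane} (h : x ≠ γ) : ContDiffAt ℝ ∞ (abPotential γ) x := by
  have h1 : ‖x - γ‖ ^ 2 ≠ 0 := by simpa [sub_eq_zero] using h
  have h2 : ContDiffAt ℝ ∞ (fun x : Plane => ‖x - γ‖ ^ 2) x :=
    (contDiffAt_id.sub contDiffAt_const).norm_sq ℝ
  refine (h2.inv h1).smul ?_
  rw [contDiffAt_piLp]
  have hc : ∀ i : Fin 2, ContDiffAt ℝ ∞ (fun x : Plane => x i - γ i) x := fun i =>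
    ((contDiffAt_piLp 2).1 contDiffAt_id i).sub contDiffAt_const
  intro i
  fin_cases i
  · exact (hc 1).neg
  · exact hc 0

lemma measurable_abPotential (γ : Plane) : Measurable (abPotential γ) := by
  unfold abPotential
  have h : Measurable fun x : Plane => (‖x - γ‖ ^ 2)⁻¹ := by fun_prop
  refine h.smul ?_
  refine (WithLp.measurable_toLp 2 _).comp (measurable_pi_iff.2 fun i => ?_)
  fin_cases i <;> simp <;> fun_prop

lemma locallyIntegrable_abPotential (γ : Plane) :
    LocallyIntegrable (abPotential γ) volume :=
  (locallyIntegrable_inv_norm_sub γ).mono (measurable_abPotential γ).aestronglyMeasurable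
    (ae_of_all _ fun x => by rw [norm_abPotential, norm_inv, norm_norm])

lemma fderiv_apply_eq_sum_pderiv (η : Plane → ℝ) (x v : Plane) :
    fderiv ℝ η x v = v 0 * pderiv 0 η x + v 1 * pderiv 1 η x := by
  have : v = v 0 • basisVec 0 + v 1 • basisVec 1 := by
    ext i
    fin_cases i <;> simp [basisVec]
  conv_lhs => rw [this]
  simp [pderiv]

/-- The Aharonov-Bohm potential has the magnetic field `2π δ`. -/
lemma integral_abPotential_curl (γ : Plane) {η : Plane → ℝ} (hη : ContDiff ℝ ∞ η)
    (hc : HasCompactSupport η) :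
    ∫ x, (abPotential γ x 0 * pderiv 1 η x - abPotential γ x 1 * pderiv 0 η x)
      = 2 * Real.pi * η γ := by
  have h := integral_fderiv_self_div_norm_sq (η := fun x => η (x + γ))
    (hη.comp (contDiff_id.add contDiff_const))
    (hc.comp_homeomorph (Homeomorph.addRight γ))
  rw [zero_add] at h
  rw [← neg_inj, ← h, ← integral_neg,
    ← integral_add_right_eq_self (μ := (volume : Measure Plane)) _ γ]
  refine integral_congr_ae (ae_of_all _ fun x => ?_)
  simp only [fderiv_comp_add_right]
  rw [abPotential_zero, abPotential_one, fderiv_apply_eq_sum_pderiv]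
  simp
  ring

end AharonovBohm

/-! ### One-variable profiles: the functions `q`, `P`, `ℓ` -/

section Profile

/-- A smooth non-negative function of `t` that vanishes for `t ≤ 1/4` and equals `1` for
`t ≥ 1/2`. -/
def profileDensity (t : ℝ) : ℝ := Real.smoothTransition (4 * t - 1)

lemma continuous_profileDensity : Continuous profileDensity :=
  Real.smoothTransition.continuous.comp (by fun_prop)

lemma profileDensity_nonneg (t : ℝ) : 0 ≤ profileDensity t := Real.smoothTransition.nonneg _

lemma profileDensity_le_one (t : ℝ) : profileDensity t ≤ 1 := Real.smoothTransition.le_one _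

lemma profileDensity_of_le {t : ℝ} (h : t ≤ 1 / 4) : profileDensity t = 0 :=
  Real.smoothTransition.zero_of_nonpos (by linarith)

lemma profileDensity_of_ge {t : ℝ} (h : 1 / 2 ≤ t) : profileDensity t = 1 :=
  Real.smoothTransition.one_of_one_le (by linarith)

/-- The primitive of `profileDensity`. -/
def profile (t : ℝ) : ℝ := ∫ r in (0 : ℝ)..t, profileDensity r

lemma hasDerivAt_profile (t : ℝ) : HasDerivAt profile (profileDensity t) t :=
  (continuous_profileDensity.integral_hasStrictDerivAt 0 t).hasDerivAt

lemma profile_of_le {t : ℝ} (h : t ≤ 1 / 4) : profile t = 0 := by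
  rw [profile, intervalIntegral.integral_congr (g := fun _ => 0), intervalIntegral.integral_zero]
  intro r hr
  refine profileDensity_of_le (hr.2.trans ?_)
  exact sup_le (by norm_num) h

lemma contDiff_profile : ContDiff ℝ 1 profile := by
  rw [contDiff_one_iff_deriv]
  refine ⟨fun t => (hasDerivAt_profile t).differentiableAt, ?_⟩
  rw [show deriv profile = profileDensity from funext fun t => (hasDerivAt_profile t).deriv]
  exact continuous_profileDensity

lemma profile_nonneg {t : ℝ} (h : 0 ≤ t) : 0 ≤ profile t :=
  intervalIntegral.integral_nonneg h fun r _ => profileDensity_nonneg r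

lemma profile_le {t : ℝ} (h : 0 ≤ t) : profile t ≤ t := by
  have := intervalIntegral.integral_mono_on (a := 0) (b := t) (μ := volume) h
    (continuous_profileDensity.intervalIntegrable _ _)
    (intervalIntegrable_const (c := (1 : ℝ))) (fun r _ => profileDensity_le_one r)
  simpa [profile] using this

/-- There is no singularity at `0`, because `profile` vanishes up to `1/4`. -/
lemma continuous_profile_div : Continuous fun t => profile t / t := by
  rw [continuous_iff_continuousAt]
  intro t
  by_cases ht : t = 0
  · have : (fun t => profile t / t) =ᶠ[𝓝 t] fun _ => 0 := by
      rw [ht]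
      filter_upwards [Iio_mem_nhds (show (0 : ℝ) < 1 / 4 by norm_num)] with r hr
      rw [profile_of_le (le_of_lt hr), zero_div]
    exact continuousAt_const.congr this.symm
  · exact contDiff_profile.continuous.continuousAt.div continuousAt_id ht

/-- A primitive of `profile t / t`. -/
def logProfile (t : ℝ) : ℝ := ∫ r in (0 : ℝ)..t, profile r / r

lemma hasDerivAt_logProfile (t : ℝ) : HasDerivAt logProfile (profile t / t) t :=
  (continuous_profile_div.integral_hasStrictDerivAt 0 t).hasDerivAt

lemma contDiff_logProfile : ContDiff ℝ 1 logProfile := by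
  rw [contDiff_one_iff_deriv]
  refine ⟨fun t => (hasDerivAt_logProfile t).differentiableAt, ?_⟩
  rw [show deriv logProfile = fun t => profile t / t from
    funext fun t => (hasDerivAt_logProfile t).deriv]
  exact continuous_profile_div

lemma logProfile_of_le {t : ℝ} (h : t ≤ 1 / 4) : logProfile t = 0 := by
  rw [logProfile, intervalIntegral.integral_congr (g := fun _ => 0), intervalIntegral.integral_zero]
  intro r hr
  change profile r / r = 0
  rw [profile_of_le (hr.2.trans (sup_le (by norm_num) h)), zero_div]

/-- The derivative `profile t / t` lies between `0` and `1` on `[0, 1]`. This is what makes the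
energy linear in the flux. -/
lemma abs_logProfile_sub_le {t : ℝ} (h0 : 0 ≤ t) (h1 : t ≤ 1) :
    |logProfile t - logProfile 1| ≤ 1 - t := by
  have := Convex.norm_image_sub_le_of_norm_hasDerivWithin_le (f := logProfile) (C := 1)
    (s := Set.Icc 0 1) (x := 1) (y := t)
    (fun r _ => (hasDerivAt_logProfile r).hasDerivWithinAt) (fun r hr => by
      rw [Real.norm_eq_abs, abs_of_nonneg (div_nonneg (profile_nonneg hr.1) hr.1)]
      exact div_le_one_of_le₀ (profile_le hr.1) hr.1)
    (convex_Icc 0 1) (by simp) ⟨h0, h1⟩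
  rw [Real.norm_eq_abs, Real.norm_eq_abs, abs_sub_comm t, abs_of_nonneg (sub_nonneg.2 h1)] at this
  linarith

end Profile

/-! ### The flux product and its energy identity -/

section Amplitude

open scoped ContDiff

variable {s : Finset Plane} {α : Plane → ℝ} {L : ℝ}

/-- The product of the powers `(|x - γ| / L) ^ α_γ` over `γ ∈ s`. -/
def fluxProduct (s : Finset Plane) (α : Plane → ℝ) (L : ℝ) (x : Plane) : ℝ :=
  ∏ γ ∈ s, (‖x - γ‖ / L) ^ α γ

/-- The `j`-th component of the gradient of `∑ γ ∈ s, α_γ log |x - γ|`. -/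
def fluxGrad (s : Finset Plane) (α : Plane → ℝ) (j : Fin 2) (x : Plane) : ℝ :=
  ∑ γ ∈ s, α γ * ((x j - γ j) / ‖x - γ‖ ^ 2)

lemma continuous_fluxProduct (hα : ∀ γ ∈ s, 0 < α γ) : Continuous (fluxProduct s α L) :=
  continuous_finsetProd _ fun γ hγ =>
    Continuous.rpow_const (by fun_prop) fun _ => Or.inr (hα γ hγ).le

lemma fluxProduct_of_mem (hα : ∀ γ ∈ s, 0 < α γ) {x : Plane} (hx : x ∈ s) :
    fluxProduct s α L x = 0 :=
  Finset.prod_eq_zero hx (by simp [Real.zero_rpow (hα x hx).ne'])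

lemma fluxProduct_nonneg (hL : 0 < L) (x : Plane) : 0 ≤ fluxProduct s α L x :=
  Finset.prod_nonneg fun _ _ => by positivity

lemma fluxProduct_le_one (hα : ∀ γ ∈ s, 0 < α γ) (hL : 0 < L) {x : Plane}
    (hx : ∀ γ ∈ s, ‖x - γ‖ ≤ L) : fluxProduct s α L x ≤ 1 :=
  Finset.prod_le_one (fun _ _ => by positivity) fun γ hγ =>
    Real.rpow_le_one (by positivity) (div_le_one_of_le₀ (hx γ hγ) hL.le) (hα γ hγ).le

lemma fluxProduct_eq_exp (hL : 0 < L) {x : Plane} (hx : x ∉ s) :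
    fluxProduct s α L x = Real.exp (∑ γ ∈ s, α γ * Real.log (‖x - γ‖ / L)) := by
  rw [Real.exp_sum, fluxProduct]
  refine Finset.prod_congr rfl fun γ hγ => ?_
  have : 0 < ‖x - γ‖ := norm_pos_iff.2 (sub_ne_zero.2 fun h => hx (h ▸ hγ))
  rw [Real.rpow_def_of_pos (by positivity), mul_comm]

/-- Uses `1 - exp S ≤ -S` for `S = ∑ α_γ log(|x - γ|/L)`, then `log y ≤ y - 1` with `y = L/|x - γ|`.
The resulting singularity is integrable in the plane. -/
lemma one_sub_fluxProduct_le (hα : ∀ γ ∈ s, 0 < α γ) (hL : 0 < L) {x : Plane} (hx : x ∉ s) :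
    1 - fluxProduct s α L x ≤ ∑ γ ∈ s, α γ * (L * ‖x - γ‖⁻¹) := by
  rw [fluxProduct_eq_exp hL hx]
  have h1 := Real.add_one_le_exp (∑ γ ∈ s, α γ * Real.log (‖x - γ‖ / L))
  have h2 : -∑ γ ∈ s, α γ * Real.log (‖x - γ‖ / L) ≤ ∑ γ ∈ s, α γ * (L * ‖x - γ‖⁻¹) := by
    rw [← Finset.sum_neg_distrib]
    refine Finset.sum_le_sum fun γ hγ => ?_
    have hp : 0 < ‖x - γ‖ := norm_pos_iff.2 (sub_ne_zero.2 fun h => hx (h ▸ hγ))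
    have h3 := Real.log_le_sub_one_of_pos (show 0 < L * ‖x - γ‖⁻¹ by positivity)
    have h4 : Real.log (‖x - γ‖ / L) = -Real.log (L * ‖x - γ‖⁻¹) := by
      rw [← Real.log_inv]
      congr 1
      field_simp
    rw [h4, mul_neg, neg_neg]
    exact mul_le_mul_of_nonneg_left (by linarith) (hα γ hγ).le
  linarith

lemma eventually_notMem_finset {x : Plane} (hx : x ∉ s) : ∀ᶠ y in 𝓝 x, y ∉ s :=
  s.finite_toSet.isClosed.isOpen_compl.mem_nhds hx

lemma hasFDerivAt_norm_sub_sq (γ x : Plane) :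
    HasFDerivAt (fun x : Plane => ‖x - γ‖ ^ 2) (2 • innerSL ℝ (x - γ)) x := by
  simpa using ((hasFDerivAt_id x).sub_const γ).norm_sq

lemma inner_basisVec (v : Plane) (j : Fin 2) : inner ℝ v (basisVec j) = v j := by
  simp [basisVec, EuclideanSpace.inner_single_right]

lemma contDiffAt_norm_sub_sq (γ x : Plane) :
    ContDiffAt ℝ ∞ (fun x : Plane => ‖x - γ‖ ^ 2) x :=
  (contDiffAt_id.sub contDiffAt_const).norm_sq ℝ

lemma contDiffAt_coord_sub (γ x : Plane) (j : Fin 2) :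
    ContDiffAt ℝ ∞ (fun x : Plane => x j - γ j) x :=
  ((contDiffAt_piLp 2).1 contDiffAt_id j).sub contDiffAt_const

lemma contDiffAt_fluxGrad {x : Plane} (hx : x ∉ s) (j : Fin 2) :
    ContDiffAt ℝ ∞ (fluxGrad s α j) x := by
  refine ContDiffAt.sum fun γ hγ => contDiffAt_const.mul ?_
  have : ‖x - γ‖ ^ 2 ≠ 0 := by
    have : x - γ ≠ 0 := sub_ne_zero.2 fun h => hx (h ▸ hγ)
    simpa using this
  exact (contDiffAt_coord_sub γ x j).div (contDiffAt_norm_sub_sq γ x) this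

/-- Harmonicity of `log |x - γ|` in the plane. -/
lemma sum_pderiv_fluxGrad {x : Plane} (hx : x ∉ s) :
    ∑ j, pderiv j (fluxGrad s α j) x = 0 := by
  have h : ∀ j, pderiv j (fluxGrad s α j) x = ∑ γ ∈ s, α γ *
      ((‖x - γ‖ ^ 2 - 2 * (x j - γ j) ^ 2) / (‖x - γ‖ ^ 2) ^ 2) := by
    intro j
    have hsum : ∀ γ ∈ s, HasFDerivAt (fun x : Plane => α γ * ((x j - γ j) / ‖x - γ‖ ^ 2))
        (α γ • ((‖x - γ‖ ^ 2) ^ 2)⁻¹ • (‖x - γ‖ ^ 2 • (EuclideanSpace.proj j : Plane →L[ℝ] ℝ)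
          - (x j - γ j) • (2 • innerSL ℝ (x - γ)))) x := by
      intro γ hγ
      have hne : ‖x - γ‖ ^ 2 ≠ 0 := by
        have : x - γ ≠ 0 := sub_ne_zero.2 fun h => hx (h ▸ hγ)
        simpa using this
      have h1 : HasFDerivAt (fun x : Plane => x j - γ j) (EuclideanSpace.proj j : Plane →L[ℝ] ℝ) x :=
        (EuclideanSpace.proj j : Plane →L[ℝ] ℝ).hasFDerivAt.sub_const (γ j)
      have h2 := (hasDerivAt_inv hne).comp_hasFDerivAt x (hasFDerivAt_norm_sub_sq γ x)
      refine ((h1.mul h2).const_mul (α γ)).congr_fderiv ?_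
      ext v
      simp only [smul_apply, sub_apply, add_apply, smul_eq_mul, Function.comp_apply]
      field_simp
      ring
    have := HasFDerivAt.fun_sum hsum
    change fderiv ℝ (fun x => ∑ γ ∈ s, α γ * ((x j - γ j) / ‖x - γ‖ ^ 2)) x (basisVec j) = _
    rw [this.fderiv, sum_apply]
    refine Finset.sum_congr rfl fun γ _ => ?_
    have hb : (EuclideanSpace.proj j : Plane →L[ℝ] ℝ) (basisVec j) = 1 := by simp [basisVec]
    simp only [smul_apply, sub_apply, innerSL_apply_apply, inner_basisVec, smul_eq_mul,
      PiLp.sub_apply, nsmul_eq_mul, Nat.cast_ofNat, hb]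
    ring
  simp only [h]
  rw [Finset.sum_comm]
  refine Finset.sum_eq_zero fun γ _ => ?_
  rw [← Finset.mul_sum, ← Finset.sum_div]
  have : ∑ j, (‖x - γ‖ ^ 2 - 2 * (x j - γ j) ^ 2) = 0 := by
    rw [EuclideanSpace.norm_sq_eq]
    simp [Fin.sum_univ_two]
  rw [this, zero_div, mul_zero]

lemma hasFDerivAt_fluxProduct (hL : 0 < L) {x : Plane} (hx : x ∉ s) :
    ∃ f' : Plane →L[ℝ] ℝ, HasFDerivAt (fluxProduct s α L) f' x ∧
      ∀ j, f' (basisVec j) = fluxProduct s α L x * fluxGrad s α j x := by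
  have hlog : ∀ γ ∈ s, HasFDerivAt (fun x : Plane => α γ * Real.log (‖x - γ‖ / L))
      (α γ • (2 : ℝ)⁻¹ • (‖x - γ‖ ^ 2)⁻¹ • (2 • innerSL ℝ (x - γ))) x := by
    intro γ hγ
    have hp : x - γ ≠ 0 := sub_ne_zero.2 fun h => hx (h ▸ hγ)
    have hne : ‖x - γ‖ ^ 2 ≠ 0 := by simpa using hp
    have h1 := (((hasFDerivAt_norm_sub_sq γ x).log hne).const_mul (2 : ℝ)⁻¹).sub_const (Real.log L)
    refine (h1.congr_of_eventuallyEq ?_).const_mul (α γ)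
    filter_upwards [(isOpen_compl_singleton (x := γ)).mem_nhds (sub_ne_zero.1 hp)] with y hy
    have hy' : 0 < ‖y - γ‖ := norm_pos_iff.2 (sub_ne_zero.2 hy)
    rw [Real.log_div hy'.ne' hL.ne', Real.log_pow]
    push_cast
    ring
  have h2 := (HasFDerivAt.fun_sum hlog).exp
  refine ⟨_, h2.congr_of_eventuallyEq ?_, fun j => ?_⟩
  · filter_upwards [eventually_notMem_finset hx] with y hy
    exact fluxProduct_eq_exp hL hy
  · rw [← fluxProduct_eq_exp hL hx, fluxGrad]
    simp only [smul_apply, sum_apply, innerSL_apply_apply, inner_basisVec, smul_eq_mul]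
    congr 1
    refine Finset.sum_congr rfl fun γ _ => ?_
    rw [PiLp.sub_apply, nsmul_eq_mul, Nat.cast_ofNat]
    ring

lemma contDiffAt_fluxProduct (hL : 0 < L) {x : Plane} (hx : x ∉ s) :
    ContDiffAt ℝ ∞ (fluxProduct s α L) x := by
  have h : ContDiffAt ℝ ∞ (fun x => Real.exp (∑ γ ∈ s, α γ * Real.log (‖x - γ‖ / L))) x := by
    refine ContDiffAt.exp (ContDiffAt.sum fun γ hγ => contDiffAt_const.mul ?_)
    have hp : x - γ ≠ 0 := sub_ne_zero.2 fun h => hx (h ▸ hγ)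
    have h1 : ContDiffAt ℝ ∞ (fun x : Plane => ‖x - γ‖) x :=
      (contDiffAt_id.sub contDiffAt_const).norm ℝ hp
    exact (h1.div_const L).log (by have := norm_pos_iff.2 hp; positivity)
  refine h.congr_of_eventuallyEq ?_
  filter_upwards [eventually_notMem_finset hx] with y hy
  exact fluxProduct_eq_exp hL hy

lemma eventually_fluxProduct_lt (hα : ∀ γ ∈ s, 0 < α γ) {x : Plane} (hx : x ∈ s) {r : ℝ}
    (hr : 0 < r) : ∀ᶠ y in 𝓝 x, fluxProduct s α L y < r := by
  refine (continuous_fluxProduct hα).continuousAt.eventually_lt_const ?_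
  rwa [fluxProduct_of_mem hα hx]

/-- Functions of `fluxProduct` that vanish near `0` are smooth, also if multiplied by
functions that are smooth off the singularities. -/
lemma contDiff_comp_fluxProduct_mul {n : ℕ∞} (hα : ∀ γ ∈ s, 0 < α γ) (hL : 0 < L) {F : ℝ → ℝ}
    (hF : ContDiff ℝ n F) {r : ℝ} (hr : 0 < r) (hF0 : ∀ t ≤ r, F t = 0) {G : Plane → ℝ}
    (hG : ∀ x ∉ s, ContDiffAt ℝ n G x) :
    ContDiff ℝ n fun x => F (fluxProduct s α L x) * G x := by
  rw [contDiff_iff_contDiffAt]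
  intro x
  by_cases hx : x ∈ s
  · refine (contDiffAt_const (c := (0 : ℝ))).congr_of_eventuallyEq ?_
    filter_upwards [eventually_fluxProduct_lt (L := L) hα hx hr] with y hy
    rw [hF0 _ hy.le, zero_mul]
  · exact (hF.contDiffAt.comp x ((contDiffAt_fluxProduct hL hx).of_le (mod_cast le_top))).mul
      (hG x hx)

/-- The chain rule for functions of `fluxProduct` that vanish near `0`. -/
lemma pderiv_comp_fluxProduct (hα : ∀ γ ∈ s, 0 < α γ) (hL : 0 < L) {F F' : ℝ → ℝ}
    (hF : ∀ t, HasDerivAt F (F' t) t) {r : ℝ} (hr : 0 < r) (hF0 : ∀ t ≤ r, F t = 0)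
    (j : Fin 2) (x : Plane) :
    pderiv j (fun x => F (fluxProduct s α L x)) x
      = F' (fluxProduct s α L x) * fluxProduct s α L x * fluxGrad s α j x := by
  by_cases hx : x ∈ s
  · have h : (fun x => F (fluxProduct s α L x)) =ᶠ[𝓝 x] fun _ => 0 := by
      filter_upwards [eventually_fluxProduct_lt (L := L) hα hx hr] with y hy
      exact hF0 _ hy.le
    rw [pderiv, h.fderiv_eq, fluxProduct_of_mem hα hx]
    simp
  · obtain ⟨f', hf', hj⟩ := hasFDerivAt_fluxProduct (α := α) hL hx
    have h := (hF (fluxProduct s α L x)).comp_hasFDerivAt x hf'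
    change fderiv ℝ (F ∘ fluxProduct s α L) x (basisVec j) = _
    rw [h.fderiv, smul_apply, hj, smul_eq_mul]
    ring

lemma integral_mul_pderiv {f g : Plane → ℝ} (hf : ContDiff ℝ 1 f) (hc : HasCompactSupport f)
    (hg : ContDiff ℝ 1 g) (j : Fin 2) :
    ∫ x, f x * pderiv j g x = -∫ x, pderiv j f x * g x := by
  have cf : Continuous (fun x => fderiv ℝ f x (basisVec j)) :=
    (hf.continuous_fderiv one_ne_zero).clm_apply continuous_const
  have cg : Continuous (fun x => fderiv ℝ g x (basisVec j)) :=
    (hg.continuous_fderiv one_ne_zero).clm_apply continuous_const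
  exact integral_mul_fderiv_eq_neg_fderiv_mul_of_integrable (v := basisVec j)
    ((cf.mul hg.continuous).integrable_of_hasCompactSupport
      (hc.fderiv_apply (𝕜 := ℝ) (basisVec j)).mul_right)
    ((hf.continuous.mul cg).integrable_of_hasCompactSupport hc.mul_right)
    ((hf.continuous.mul hg.continuous).integrable_of_hasCompactSupport hc.mul_right)
    (fun x _ => hf.differentiable one_ne_zero x) (fun x _ => hg.differentiable one_ne_zero x)

lemma hasCompactSupport_pderiv {F : Type*} [NormedAddCommGroup F] [NormedSpace ℝ F]
    {f : Plane → F} (hc : HasCompactSupport f) (j : Fin 2) : HasCompactSupport (pderiv j f) :=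
  hc.fderiv_apply (𝕜 := ℝ) (basisVec j)

lemma contDiff_pderiv {F : Type*} [NormedAddCommGroup F] [NormedSpace ℝ F] {f : Plane → F}
    (hf : ContDiff ℝ ∞ f) (j : Fin 2) : ContDiff ℝ ∞ (pderiv j f) :=
  (hf.fderiv_right (m := ∞) (by simp)).clm_apply contDiff_const

/-- With `m` the flux product and `G` the gradient of `log m`, the field `Y = profile(m) G` equals
`∇ logProfile(m)`. Since `div G = 0` off the points and `∇m = m G`, its divergence is
`profileDensity(m) m |G|²`. Two integrations by parts move both derivatives onto `χ`. The subtracted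
constant `logProfile 1` has no gradient; it makes the right side small where `m` is near `1`. -/
lemma integral_mul_density_mul_fluxGrad_sq (hα : ∀ γ ∈ s, 0 < α γ) (hL : 0 < L)
    {χ : Plane → ℝ} (hχ : ContDiff ℝ ∞ χ) (hc : HasCompactSupport χ) :
    ∫ x, χ x * (profileDensity (fluxProduct s α L x) * fluxProduct s α L x
        * ∑ j, fluxGrad s α j x ^ 2)
      = ∫ x, (∑ j, pderiv j (pderiv j χ) x)
        * (logProfile (fluxProduct s α L x) - logProfile 1) := by
  have hr : (0 : ℝ) < 1 / 4 := by norm_num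
  set Y : Fin 2 → Plane → ℝ := fun j x => profile (fluxProduct s α L x) * fluxGrad s α j x with hY
  have hYc : ∀ j, ContDiff ℝ 1 (Y j) := fun j =>
    contDiff_comp_fluxProduct_mul (n := 1) hα hL contDiff_profile hr (fun t => profile_of_le)
      fun x hx => (contDiffAt_fluxGrad hx j).of_le (mod_cast le_top)
  set ℓ : Plane → ℝ := fun x => logProfile (fluxProduct s α L x) with hℓ
  have hℓc : ContDiff ℝ 1 ℓ := by
    have := contDiff_comp_fluxProduct_mul (n := 1) hα hL contDiff_logProfile hr
      (fun t => logProfile_of_le) (G := fun _ => 1) fun x _ => contDiffAt_const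
    simpa using this
  have hℓd : ∀ j x, pderiv j (fun x => ℓ x - logProfile 1) x = Y j x := by
    intro j x
    have h := pderiv_comp_fluxProduct hα hL hasDerivAt_logProfile hr (fun t => logProfile_of_le) j x
    rw [pderiv, fderiv_sub_const]
    refine h.trans ?_
    rw [hY]
    by_cases hm : fluxProduct s α L x = 0
    · simp [hm, profile_of_le (t := 0) hr.le]
    · simp [hm]
  have hdiv : ∀ x, ∑ j, pderiv j (Y j) x = profileDensity (fluxProduct s α L x)
      * fluxProduct s α L x * ∑ j, fluxGrad s α j x ^ 2 := by
    intro x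
    -- At a point of `s` both sides vanish: `m` is `0` there and, by continuity, below `1/4` nearby,
    -- so `Y` is locally zero.
    by_cases hx : x ∈ s
    · have h : ∀ j, pderiv j (Y j) x = 0 := by
        intro j
        have h : Y j =ᶠ[𝓝 x] fun _ => 0 := by
          filter_upwards [eventually_fluxProduct_lt (L := L) hα hx hr] with y hy
          rw [hY]
          simp only [profile_of_le hy.le, zero_mul]
        rw [pderiv, h.fderiv_eq]
        simp
      simp [h, fluxProduct_of_mem hα hx]
    · have h : ∀ j, pderiv j (Y j) x = profileDensity (fluxProduct s α L x)
          * fluxProduct s α L x * fluxGrad s α j x ^ 2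
          + profile (fluxProduct s α L x) * pderiv j (fluxGrad s α j) x := by
        intro j
        have h1 := pderiv_comp_fluxProduct hα hL hasDerivAt_profile hr (fun t => profile_of_le) j x
        have h2 : DifferentiableAt ℝ (fun x => profile (fluxProduct s α L x)) x :=
          ((contDiff_profile.contDiffAt.comp x ((contDiffAt_fluxProduct hL hx).of_le
            (mod_cast le_top)))).differentiableAt one_ne_zero
        have h3 : DifferentiableAt ℝ (fluxGrad s α j) x :=
          (contDiffAt_fluxGrad hx j).differentiableAt (by simp)
        rw [pderiv] at h1
        rw [hY, pderiv, fderiv_fun_mul h2 h3]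
        simp only [add_apply, smul_apply, h1, smul_eq_mul, pderiv]
        ring
      simp only [h, Finset.sum_add_distrib, ← Finset.mul_sum, sum_pderiv_fluxGrad hx, mul_zero,
        add_zero]
  have hχ1 : ContDiff ℝ 1 χ := hχ.of_le (mod_cast le_top)
  have hdχ1 : ∀ j, ContDiff ℝ 1 (pderiv j χ) := fun j =>
    (contDiff_pderiv hχ j).of_le (mod_cast le_top)
  simp only [← hdiv, Finset.mul_sum, Finset.sum_mul]
  have hint : ∀ {f g : Plane → ℝ}, ContDiff ℝ 1 f → HasCompactSupport f → ContDiff ℝ 1 g →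
      ∀ j, Integrable (fun x => f x * pderiv j g x) (volume : Measure Plane) :=
    fun hf hc hg j => (hf.continuous.mul ((hg.continuous_fderiv one_ne_zero).clm_apply
      continuous_const)).integrable_of_hasCompactSupport hc.mul_right
  have hint' : ∀ j, Integrable (fun x => pderiv j (pderiv j χ) x * (ℓ x - logProfile 1))
      (volume : Measure Plane) := fun j =>
    ((contDiff_pderiv (contDiff_pderiv hχ j) j).continuous.mul (hℓc.continuous.sub
      continuous_const)).integrable_of_hasCompactSupport
      (hasCompactSupport_pderiv (hasCompactSupport_pderiv hc j) j).mul_right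
  rw [integral_finsetSum _ fun j _ => hint hχ1 hc (hYc j) j,
    integral_finsetSum _ fun j _ => hint' j]
  refine Finset.sum_congr rfl fun j _ => ?_
  rw [integral_mul_pderiv hχ1 hc (hYc j) j]
  simp only [← hℓd]
  rw [integral_mul_pderiv (hdχ1 j) (hasCompactSupport_pderiv hc j)
    (hℓc.sub contDiff_const) j, neg_neg]

end Amplitude

/-! ### Amplitudes with energy controlled by the total flux -/

section AmplitudeBounds

open scoped ContDiff

variable {s : Finset Plane} {α : Plane → ℝ} {L : ℝ}

lemma integrableOn_inv_norm_sub (γ : Plane) {K : Set Plane} (hK : IsCompact K) :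
    IntegrableOn (fun x : Plane => ‖x - γ‖⁻¹) K volume :=
  (locallyIntegrable_iff.1 (locallyIntegrable_inv_norm_sub γ)) K hK

/-- The disc about `c` lies in the disc of radius `3R` about `γ`, which is then translated to the
origin; the bound no longer sees the position of `γ`. -/
lemma setIntegral_inv_norm_sub_le {c γ : Plane} {R : ℝ} (hγ : γ ∈ Metric.closedBall c (2 * R)) :
    ∫ x in Metric.closedBall c R, ‖x - γ‖⁻¹ ≤ ∫ x in Metric.closedBall (0 : Plane) (3 * R), ‖x‖⁻¹ := by
  have h1 : ∫ x in Metric.closedBall (0 : Plane) (3 * R), ‖x‖⁻¹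
      = ∫ x in Metric.closedBall γ (3 * R), ‖x - γ‖⁻¹ := by
    have := (measurePreserving_sub_right (volume : Measure Plane) γ).setIntegral_preimage_emb
      (MeasurableEquiv.subRight γ).measurableEmbedding (fun x => ‖x‖⁻¹)
      (Metric.closedBall 0 (3 * R))
    rw [← this]
    congr 2
    ext x
    simp [dist_eq_norm]
  rw [h1]
  refine setIntegral_mono_set (integrableOn_inv_norm_sub γ (isCompact_closedBall _ _))
    (ae_of_all _ fun x => by positivity) (Metric.closedBall_subset_closedBall' ?_).eventuallyLE
  rw [Metric.mem_closedBall, dist_comm] at hγ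
  linarith

lemma notMem_finset_ae (s : Finset Plane) : ∀ᵐ x ∂(volume : Measure Plane), x ∉ s :=
  measure_eq_zero_iff_ae_notMem.1 (s.finite_toSet.measure_zero _)

/-- A smooth function of `t` that vanishes for `t ≤ 1/2` and equals `1` for `t ≥ 3/4`. -/
def amplitudeProfile (t : ℝ) : ℝ := Real.smoothTransition (4 * t - 2)

lemma contDiff_amplitudeProfile : ContDiff ℝ ∞ amplitudeProfile :=
  Real.smoothTransition.contDiff.comp (by fun_prop)

lemma amplitudeProfile_nonneg (t : ℝ) : 0 ≤ amplitudeProfile t := Real.smoothTransition.nonneg _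

lemma amplitudeProfile_le_one (t : ℝ) : amplitudeProfile t ≤ 1 := Real.smoothTransition.le_one _

lemma amplitudeProfile_of_le {t : ℝ} (h : t ≤ 1 / 2) : amplitudeProfile t = 0 :=
  Real.smoothTransition.zero_of_nonpos (by linarith)

lemma one_sub_amplitudeProfile_le {t : ℝ} (h : t ≤ 1) :
    1 - amplitudeProfile t ≤ 4 * (1 - t) := by
  rcases le_total t (3 / 4) with h1 | h1
  · linarith [amplitudeProfile_nonneg t]
  · rw [amplitudeProfile, Real.smoothTransition.one_of_one_le (by linarith)]
    linarith

/-- The left side vanishes for `t ≤ 1/2`; beyond that it is at most `1 ≤ 2 t` and the density is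
`1`. It bounds `|G f|²` by the energy density. -/
lemma amplitudeProfile_sq_le {t : ℝ} (h : 0 ≤ t) :
    amplitudeProfile t ^ 2 ≤ 2 * (profileDensity t * t) := by
  rcases le_total t (1 / 2) with h1 | h1
  · rw [amplitudeProfile_of_le h1]
    have := mul_nonneg (profileDensity_nonneg t) h
    linarith
  · rw [profileDensity_of_ge h1]
    have := pow_le_one₀ (n := 2) (amplitudeProfile_nonneg t) (amplitudeProfile_le_one t)
    linarith

/-- The companion bound for `|∇f|²`, since `∇ f(m) = f'(m) m G`. The derivative vanishes below
`1/2`, and `t² ≤ t` above. -/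
lemma exists_deriv_amplitudeProfile_sq_le : ∃ C : ℝ, 0 ≤ C ∧ ∀ t : ℝ, 0 ≤ t → t ≤ 1 →
    (deriv amplitudeProfile t * t) ^ 2 ≤ C * (profileDensity t * t) := by
  have hc : Continuous (deriv amplitudeProfile) :=
    contDiff_amplitudeProfile.continuous_deriv (by simp)
  obtain ⟨C, hC⟩ := (isCompact_Icc (a := (0 : ℝ)) (b := 1)).exists_bound_of_continuousOn
    hc.continuousOn
  refine ⟨C ^ 2, sq_nonneg C, fun t h0 h1 => ?_⟩
  rcases lt_or_ge t (1 / 2) with h | h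
  · have : deriv amplitudeProfile t = 0 := by
      have h2 : amplitudeProfile =ᶠ[𝓝 t] fun _ => 0 := by
        filter_upwards [Iio_mem_nhds h] with r hr
        exact amplitudeProfile_of_le (le_of_lt hr)
      rw [h2.deriv_eq]
      simp
    rw [this, zero_mul, zero_pow two_ne_zero]
    exact mul_nonneg (sq_nonneg C) (mul_nonneg (profileDensity_nonneg t) h0)
  · rw [profileDensity_of_ge h, one_mul, mul_pow]
    have h2 := hC t ⟨h0, h1⟩
    rw [Real.norm_eq_abs] at h2
    have h3 : deriv amplitudeProfile t ^ 2 ≤ C ^ 2 := by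
      rw [← sq_abs]
      exact pow_le_pow_left₀ (abs_nonneg _) h2 2
    have h4 : t ^ 2 ≤ t := by nlinarith
    exact mul_le_mul h3 h4 (sq_nonneg t) (sq_nonneg C)

lemma setIntegral_one_sub_fluxProduct_le {c : Plane} {R : ℝ} (hR : 0 < R)
    (hs : ∀ γ ∈ s, γ ∈ Metric.closedBall c (2 * R)) (hα : ∀ γ ∈ s, 0 < α γ) :
    ∫ x in Metric.closedBall c R, (1 - fluxProduct s α (3 * R) x)
      ≤ 3 * R * (∫ x in Metric.closedBall (0 : Plane) (3 * R), ‖x‖⁻¹) * ∑ γ ∈ s, α γ := by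
  have hK : IsCompact (Metric.closedBall c R) := isCompact_closedBall _ _
  have hi : ∀ γ ∈ s, IntegrableOn (fun x : Plane => α γ * (3 * R * ‖x - γ‖⁻¹))
      (Metric.closedBall c R) volume := fun γ _ =>
    ((integrableOn_inv_norm_sub γ hK).const_mul _).const_mul _
  calc ∫ x in Metric.closedBall c R, (1 - fluxProduct s α (3 * R) x)
      ≤ ∫ x in Metric.closedBall c R, ∑ γ ∈ s, α γ * (3 * R * ‖x - γ‖⁻¹) := by
        refine integral_mono_ae ?_ (integrable_finsetSum _ hi) ?_
        · exact ((continuous_const.sub (continuous_fluxProduct hα)).continuousOn).integrableOn_compact hK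
        · filter_upwards [ae_restrict_of_ae (notMem_finset_ae s)] with x hx
          exact one_sub_fluxProduct_le hα (by positivity) hx
    _ = ∑ γ ∈ s, α γ * (3 * R * ∫ x in Metric.closedBall c R, ‖x - γ‖⁻¹) := by
        rw [integral_finsetSum _ hi]
        simp only [integral_const_mul]
    _ ≤ ∑ γ ∈ s, α γ * (3 * R * ∫ x in Metric.closedBall (0 : Plane) (3 * R), ‖x‖⁻¹) := by
        refine Finset.sum_le_sum fun γ hγ => ?_
        have := (hα γ hγ).le
        gcongr
        exact setIntegral_inv_norm_sub_le (hs γ hγ)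
    _ = _ := by rw [← Finset.sum_mul, mul_comm]

/-- In the energy identity the Laplacian of `χ` is at most `M` and `|logProfile m - logProfile 1| ≤
1 - m`, whose integral is linear in the flux. The scale `L = 3R` ensures `m ≤ 1` on the disc of
radius `R`, as the points lie within `2R` of its centre. -/
lemma integral_mul_density_le {c : Plane} {R M : ℝ} (hR : 0 < R)
    (hs : ∀ γ ∈ s, γ ∈ Metric.closedBall c (2 * R)) (hα : ∀ γ ∈ s, 0 < α γ)
    {χ : Plane → ℝ} (hχ : ContDiff ℝ ∞ χ) (hsupp : tsupport χ ⊆ Metric.closedBall c R)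
    (hM : ∀ x, |∑ j, pderiv j (pderiv j χ) x| ≤ M) :
    ∫ x, χ x * (profileDensity (fluxProduct s α (3 * R) x) * fluxProduct s α (3 * R) x
        * ∑ j, fluxGrad s α j x ^ 2) ≤
      M * (3 * R * (∫ x in Metric.closedBall (0 : Plane) (3 * R), ‖x‖⁻¹) * ∑ γ ∈ s, α γ) := by
  have hM0 : 0 ≤ M := (abs_nonneg _).trans (hM 0)
  have hK : IsCompact (Metric.closedBall c R) := isCompact_closedBall _ _
  have hc : HasCompactSupport χ := HasCompactSupport.of_support_subset_isCompact hK
    ((subset_tsupport χ).trans hsupp)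
  have hL : 0 < 3 * R := by positivity
  rw [integral_mul_density_mul_fluxGrad_sq hα hL hχ hc]
  have hzero : ∀ x ∉ Metric.closedBall c R, (∑ j, pderiv j (pderiv j χ) x)
      * (logProfile (fluxProduct s α (3 * R) x) - logProfile 1) = 0 := by
    intro x hx
    have h1 : ∀ j, pderiv j (pderiv j χ) x = 0 := by
      intro j
      have h2 : x ∉ tsupport (pderiv j (pderiv j χ)) := fun h => hx (hsupp
        ((tsupport_fderiv_apply_subset ℝ (basisVec j)).trans
          (tsupport_fderiv_apply_subset ℝ (basisVec j)) h))
      exact image_eq_zero_of_notMem_tsupport h2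
    simp [h1]
  rw [← setIntegral_eq_integral_of_forall_compl_eq_zero hzero]
  have hcm : Continuous (fluxProduct s α (3 * R)) := continuous_fluxProduct hα
  refine le_trans (integral_mono_ae (g := fun x => M * (1 - fluxProduct s α (3 * R) x))
    ?_ ?_ ?_) ?_
  · refine (Continuous.continuousOn ?_).integrableOn_compact hK
    refine Continuous.mul (continuous_finsetSum _ fun j _ => ?_)
      ((contDiff_logProfile.continuous.comp hcm).sub continuous_const)
    exact (contDiff_pderiv (contDiff_pderiv hχ j) j).continuous
  · exact (continuous_const.mul (continuous_const.sub hcm)).continuousOn.integrableOn_compact hK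
  · filter_upwards [ae_restrict_mem measurableSet_closedBall] with x hx
    refine (le_abs_self _).trans ?_
    rw [abs_mul]
    refine mul_le_mul (hM x) ?_ (abs_nonneg _) hM0
    refine abs_logProfile_sub_le (fluxProduct_nonneg hL x) (fluxProduct_le_one hα hL fun γ hγ => ?_)
    have h1 := Metric.mem_closedBall.1 hx
    have h2 := Metric.mem_closedBall'.1 (hs γ hγ)
    rw [← dist_eq_norm]
    linarith [dist_triangle x c γ]
  · rw [integral_const_mul]
    exact mul_le_mul_of_nonneg_left (setIntegral_one_sub_fluxProduct_le hR hs hα) hM0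

/-- Functions that vanish near prescribed points and are close to `1` in the magnetic Sobolev
space, with an error controlled by the total flux, irrespective of the position of the points. -/
theorem exists_amplitude {R : ℝ} (hR : 0 < R) (M : ℝ) : ∃ C : ℝ, 0 ≤ C ∧
    ∀ (c : Plane) (s : Finset Plane) (α : Plane → ℝ),
    (∀ γ ∈ s, γ ∈ Metric.closedBall c (2 * R)) → (∀ γ ∈ s, 0 < α γ) →
    ∃ f : Plane → ℝ, ContDiff ℝ ∞ f ∧ (∀ γ ∈ s, ∀ᶠ y in 𝓝 γ, f y = 0) ∧
      (∀ x, 0 ≤ f x) ∧ (∀ x, f x ≤ 1) ∧ (∀ j, Continuous fun x => fluxGrad s α j x * f x) ∧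
      ∫ x in Metric.closedBall c R, (1 - f x) ≤ C * ∑ γ ∈ s, α γ ∧
      ∀ χ : Plane → ℝ, ContDiff ℝ ∞ χ → tsupport χ ⊆ Metric.closedBall c R → (∀ x, 0 ≤ χ x) →
        (∀ x, |∑ j, pderiv j (pderiv j χ) x| ≤ M) → ∀ j,
        ∫ x, χ x * pderiv j f x ^ 2 ≤ C * ∑ γ ∈ s, α γ ∧
        ∫ x, χ x * (fluxGrad s α j x * f x) ^ 2 ≤ C * ∑ γ ∈ s, α γ := by
  obtain ⟨C₁, hC₁, hC₁'⟩ := exists_deriv_amplitudeProfile_sq_le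
  set κ : ℝ := 3 * R * ∫ x in Metric.closedBall (0 : Plane) (3 * R), ‖x‖⁻¹ with hκ
  have hκ0 : 0 ≤ κ := mul_nonneg (by positivity) (integral_nonneg fun x => by positivity)
  -- The `4` serves the mean of `1 - f`; `C₁ + 2` dominates the factors `C₁` and `2` needed for
  -- `|∇f|²` and `|G f|²`.
  refine ⟨(4 + (C₁ + 2) * |M|) * κ, by positivity, fun c s α hs hα => ?_⟩
  have hL : 0 < 3 * R := by positivity
  have hr : (0 : ℝ) < 1 / 2 := by norm_num
  have hsum0 : 0 ≤ ∑ γ ∈ s, α γ := Finset.sum_nonneg fun γ hγ => (hα γ hγ).le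
  set m := fluxProduct s α (3 * R) with hm
  have hm0 : ∀ x, 0 ≤ m x := fluxProduct_nonneg hL
  have hm1 : ∀ x ∈ Metric.closedBall c R, m x ≤ 1 := by
    intro x hx
    refine fluxProduct_le_one hα hL fun γ hγ => ?_
    have h1 := Metric.mem_closedBall.1 hx
    have h2 := Metric.mem_closedBall'.1 (hs γ hγ)
    rw [← dist_eq_norm]
    linarith [dist_triangle x c γ]
  have hmc : Continuous m := continuous_fluxProduct hα
  have hK : IsCompact (Metric.closedBall c R) := isCompact_closedBall _ _
  have hfc : ContDiff ℝ ∞ fun x => amplitudeProfile (m x) := by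
    have := contDiff_comp_fluxProduct_mul (n := ⊤) hα hL contDiff_amplitudeProfile hr
      (fun t => amplitudeProfile_of_le) (G := fun _ => 1) fun x _ => contDiffAt_const
    simpa using this
  have hGc : ∀ j, Continuous fun x => fluxGrad s α j x * amplitudeProfile (m x) := by
    intro j
    have := (contDiff_comp_fluxProduct_mul (n := ⊤) hα hL contDiff_amplitudeProfile hr
      (fun t => amplitudeProfile_of_le) (G := fluxGrad s α j)
      fun x hx => contDiffAt_fluxGrad hx j).continuous
    exact this.congr fun x => mul_comm _ _
  refine ⟨fun x => amplitudeProfile (m x), hfc, fun γ hγ => ?_, fun x => amplitudeProfile_nonneg _,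
    fun x => amplitudeProfile_le_one _, hGc, ?_, fun χ hχ hsupp hχ0 hM j => ?_⟩
  · filter_upwards [eventually_fluxProduct_lt (L := 3 * R) hα hγ hr] with y hy
    exact amplitudeProfile_of_le hy.le
  · have h1 := setIntegral_one_sub_fluxProduct_le hR hs hα
    calc ∫ x in Metric.closedBall c R, (1 - amplitudeProfile (m x))
        ≤ ∫ x in Metric.closedBall c R, 4 * (1 - m x) := by
          refine setIntegral_mono_on ?_ ?_ measurableSet_closedBall fun x hx =>
            one_sub_amplitudeProfile_le (hm1 x hx)
          · exact (continuous_const.sub hfc.continuous).continuousOn.integrableOn_compact hK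
          · exact (continuous_const.mul
              (continuous_const.sub hmc)).continuousOn.integrableOn_compact hK
      _ ≤ 4 * (κ * ∑ γ ∈ s, α γ) := by
          rw [integral_const_mul]
          exact mul_le_mul_of_nonneg_left h1 (by norm_num)
      _ ≤ _ := by
          have h2 : 0 ≤ (C₁ + 2) * |M| * (κ * ∑ γ ∈ s, α γ) := by positivity
          nlinarith
  · have hc : HasCompactSupport χ := HasCompactSupport.of_support_subset_isCompact hK
      ((subset_tsupport χ).trans hsupp)
    set e : Plane → ℝ := fun x => profileDensity (m x) * m x * ∑ j, fluxGrad s α j x ^ 2 with he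
    have hec : Continuous e := by
      have h1 : ContDiff ℝ ((0 : ℕ∞) : WithTop ℕ∞) fun t : ℝ => profileDensity t * t :=
        contDiff_zero.2 (continuous_profileDensity.mul continuous_id)
      exact (contDiff_comp_fluxProduct_mul (n := 0) hα hL h1 (r := 1 / 4) (by norm_num)
        (fun t ht => by rw [profileDensity_of_le ht, zero_mul])
        (G := fun x => ∑ j, fluxGrad s α j x ^ 2)
        fun x hx => ContDiffAt.sum fun j _ =>
          ((contDiffAt_fluxGrad hx j).of_le (mod_cast le_top)).pow 2).continuous
    have he0 : ∀ x, 0 ≤ profileDensity (m x) * m x := fun x =>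
      mul_nonneg (profileDensity_nonneg _) (hm0 x)
    have hE := integral_mul_density_le hR hs hα hχ hsupp hM
    rw [← hm, ← hκ] at hE
    have hEM : ∫ x, χ x * e x ≤ |M| * (κ * ∑ γ ∈ s, α γ) :=
      hE.trans (mul_le_mul_of_nonneg_right (le_abs_self M) (by positivity))
    have hG : ∀ x, fluxGrad s α j x ^ 2 ≤ ∑ j, fluxGrad s α j x ^ 2 := fun x =>
      Finset.single_le_sum (f := fun j => fluxGrad s α j x ^ 2) (fun _ _ => sq_nonneg _)
        (Finset.mem_univ j)
    -- Both energy bounds reduce to a pointwise comparison with the density `e` on the support of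
    -- `χ`.
    have hcomp : ∀ (A : ℝ) (g : Plane → ℝ), 0 ≤ A → A ≤ C₁ + 2 → Continuous g →
        (∀ x ∈ Metric.closedBall c R, g x ≤ A * e x) →
        ∫ x, χ x * g x ≤ (4 + (C₁ + 2) * |M|) * κ * ∑ γ ∈ s, α γ := by
      intro A g hA hA' hg hge
      calc ∫ x, χ x * g x ≤ ∫ x, A * (χ x * e x) := by
            refine integral_mono ((hχ.continuous.mul hg).integrable_of_hasCompactSupport
              hc.mul_right) (((hχ.continuous.mul hec).integrable_of_hasCompactSupport
              hc.mul_right).const_mul A) fun x => ?_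
            by_cases hx : x ∈ Metric.closedBall c R
            · have := mul_le_mul_of_nonneg_left (hge x hx) (hχ0 x)
              simp only
              linarith
            · have : χ x = 0 := image_eq_zero_of_notMem_tsupport fun h => hx (hsupp h)
              simp [this]
        _ ≤ A * (|M| * (κ * ∑ γ ∈ s, α γ)) := by
            rw [integral_const_mul]
            exact mul_le_mul_of_nonneg_left hEM hA
        _ ≤ (C₁ + 2) * (|M| * (κ * ∑ γ ∈ s, α γ)) :=
            mul_le_mul_of_nonneg_right hA' (by positivity)
        _ ≤ _ := by
            have : 0 ≤ κ * ∑ γ ∈ s, α γ := by positivity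
            nlinarith
    constructor
    · refine hcomp C₁ _ hC₁ (by linarith) ((contDiff_pderiv hfc j).continuous.pow 2) fun x hx => ?_
      have h1 := pderiv_comp_fluxProduct hα hL
        (fun t => ((contDiff_amplitudeProfile.differentiable (by simp)) t).hasDerivAt) hr
        (fun t => amplitudeProfile_of_le) j x
      rw [h1, mul_pow, he]
      simp only [← hm]
      calc (deriv amplitudeProfile (m x) * m x) ^ 2 * fluxGrad s α j x ^ 2
          ≤ C₁ * (profileDensity (m x) * m x) * ∑ j, fluxGrad s α j x ^ 2 :=
            mul_le_mul (hC₁' _ (hm0 x) (hm1 x hx)) (hG x) (sq_nonneg _)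
              (mul_nonneg hC₁ (he0 x))
        _ = _ := by ring
    · refine hcomp 2 _ (by norm_num) (by linarith) ((hGc j).pow 2) fun x hx => ?_
      rw [mul_pow, he, mul_comm]
      simp only
      calc amplitudeProfile (m x) ^ 2 * fluxGrad s α j x ^ 2
          ≤ 2 * (profileDensity (m x) * m x) * ∑ j, fluxGrad s α j x ^ 2 :=
            mul_le_mul (amplitudeProfile_sq_le (hm0 x)) (hG x) (sq_nonneg _)
              (mul_nonneg zero_le_two (he0 x))
        _ = _ := by ring

end AmplitudeBounds

/-! ### Approximate gauge functions for curl-free fields -/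

section Gauge

open scoped ContDiff Convolution

lemma fderiv_convolution_lsmul {ψ : Plane → ℝ} (hψ : ContDiff ℝ ∞ ψ) (hc : HasCompactSupport ψ)
    {b : Plane → Plane} (hb : LocallyIntegrable b volume) (x v : Plane) :
    fderiv ℝ (ψ ⋆[ContinuousLinearMap.lsmul ℝ ℝ, volume] b) x v
      = ∫ t, fderiv ℝ ψ (x - t) v • b t := by
  have hψ1 : ContDiff ℝ 1 ψ := hψ.of_le (mod_cast le_top)
  rw [← convolution_flip]
  have h := hc.hasFDerivAt_convolution_right (ContinuousLinearMap.lsmul ℝ ℝ).flip hb hψ1 x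
  rw [h.fderiv, convolution_precompR_apply _ hb (hc.fderiv ℝ) (hψ1.continuous_fderiv one_ne_zero)]
  rfl

/-- The mollification of a vector field is curl-free where the field is, in the sense of
distributions. -/
lemma fderiv_convolution_symm {ψ : Plane → ℝ} (hψ : ContDiff ℝ ∞ ψ) (hc : HasCompactSupport ψ)
    {b : Plane → Plane} (hb : LocallyIntegrable b volume) {U : Set Plane}
    (hcurl : ∀ η : Plane → ℝ, ContDiff ℝ ∞ η → HasCompactSupport η → tsupport η ⊆ U →
      ∫ x, (b x 0 * pderiv 1 η x - b x 1 * pderiv 0 η x) = 0)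
    {x : Plane} (hx : ∀ t, x - t ∈ tsupport ψ → t ∈ U) :
    fderiv ℝ (ψ ⋆[ContinuousLinearMap.lsmul ℝ ℝ, volume] b) x (basisVec 0) 1
      = fderiv ℝ (ψ ⋆[ContinuousLinearMap.lsmul ℝ ℝ, volume] b) x (basisVec 1) 0 := by
  have hdc : ∀ v, Continuous fun t => fderiv ℝ ψ (x - t) v := fun v =>
    ((hψ.continuous_fderiv (by simp)).comp (by fun_prop)).clm_apply continuous_const
  have hds : ∀ v, HasCompactSupport fun t => fderiv ℝ ψ (x - t) v := fun v =>
    (hc.fderiv_apply (𝕜 := ℝ) v).comp_homeomorph (Homeomorph.subLeft x)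
  have hint : ∀ v, Integrable (fun t => fderiv ℝ ψ (x - t) v • b t) (volume : Measure Plane) :=
    fun v => hb.integrable_smul_left_of_hasCompactSupport (hdc v) (hds v)
  have hcoord : ∀ v (i : Fin 2), (∫ t, fderiv ℝ ψ (x - t) v • b t) i
      = ∫ t, fderiv ℝ ψ (x - t) v * b t i := fun v i =>
    ((EuclideanSpace.proj i : Plane →L[ℝ] ℝ).integral_comp_comm (hint v)).symm
  have hinti : ∀ v (i : Fin 2), Integrable (fun t => fderiv ℝ ψ (x - t) v * b t i)
      (volume : Measure Plane) := fun v i =>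
    (EuclideanSpace.proj i : Plane →L[ℝ] ℝ).integrable_comp (hint v)
  rw [fderiv_convolution_lsmul hψ hc hb, fderiv_convolution_lsmul hψ hc hb, hcoord, hcoord,
    ← sub_eq_zero, ← integral_sub (hinti _ _) (hinti _ _)]
  have hη := hcurl (fun t => ψ (x - t)) (hψ.comp (contDiff_const.sub contDiff_id))
    (hc.comp_homeomorph (Homeomorph.subLeft x)) (fun t ht => hx t ?_)
  · rw [← hη]
    refine integral_congr_ae (ae_of_all _ fun t => ?_)
    have hp : ∀ j, pderiv j (fun t => ψ (x - t)) t = -fderiv ℝ ψ (x - t) (basisVec j) := by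
      intro j
      have h1 : HasFDerivAt (fun t => ψ (x - t)) _ t :=
        ((hψ.differentiable (by simp)) (x - t)).hasFDerivAt.comp t
          ((hasFDerivAt_id t).const_sub x)
      rw [pderiv, h1.fderiv]
      simp
    simp only [hp]
    ring
  · exact tsupport_comp_subset_preimage ψ (f := fun t => x - t) (by fun_prop) ht

/-- A distributionally curl-free vector field is, on compact subsets of the set where it is
continuous, uniformly approximated by gradients. -/
theorem exists_gauge {b : Plane → Plane} (hb : LocallyIntegrable b volume) {c : Plane} {r ρ : ℝ}
    (hr : r < ρ) (hcurl : ∀ η : Plane → ℝ, ContDiff ℝ ∞ η → HasCompactSupport η →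
      tsupport η ⊆ Metric.ball c ρ → ∫ x, (b x 0 * pderiv 1 η x - b x 1 * pderiv 0 η x) = 0)
    {K : Set Plane} (hK : IsCompact K) (hKr : K ⊆ Metric.ball c r)
    (hbK : ∀ x ∈ K, ContinuousAt b x) {δ : ℝ} (hδ : 0 < δ) :
    ∃ φ : Plane → ℝ, ContDiffOn ℝ ∞ φ (Metric.ball c r) ∧
      ∀ x ∈ K, ∀ j, |pderiv j φ x - b x j| ≤ δ := by
  -- The point `y` need not lie in `K`: `b` is continuous at the points of the compact set `K` as a
  -- function on the whole plane, and mollification samples it off `K`.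
  obtain ⟨d, hd, hdK⟩ : ∃ d > 0, ∀ x ∈ K, ∀ y, dist y x < d → dist (b y) (b x) ≤ δ := by
    have := hK.uniformContinuousAt_of_continuousAt b hbK (Metric.dist_mem_uniformity hδ)
    obtain ⟨d, hd, h⟩ := Metric.mem_uniformity_dist.1 this
    refine ⟨d, hd, fun x hx y hy => ?_⟩
    rw [dist_comm] at hy ⊢
    exact (h hy hx).le
  -- The mollification radius: `d` keeps the mollified field within `δ` of `b` on `K`, and `ρ - r`
  -- keeps the shifted kernels inside the disc where `b` is curl-free.
  set d' := min d (ρ - r) with hd'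
  have hd'0 : 0 < d' := lt_min hd (sub_pos.2 hr)
  let β : ContDiffBump (0 : Plane) := ⟨d' / 2, d', by positivity, by linarith⟩
  set ψ : Plane → ℝ := β.normed volume with hψdef
  have hψ : ContDiff ℝ ∞ ψ := β.contDiff_normed
  have hψc : HasCompactSupport ψ := β.hasCompactSupport_normed
  set B : Plane → Plane := ψ ⋆[ContinuousLinearMap.lsmul ℝ ℝ, volume] b with hB
  have hBs : ContDiff ℝ ∞ B := hψc.contDiff_convolution_left _ hψ hb
  have hBd : ∀ x, HasFDerivAt B (fderiv ℝ B x) x := fun x =>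
    ((hBs.differentiable (by simp)) x).hasFDerivAt
  have hωs : ContDiff ℝ ∞ fun x => innerSL ℝ (B x) := (innerSL ℝ).contDiff.comp hBs
  have hω : ∀ x u v, fderiv ℝ (fun x => innerSL ℝ (B x)) x u v = inner ℝ (fderiv ℝ B x u) v := by
    intro x u v
    have h : HasFDerivAt (fun x => innerSL ℝ (B x)) ((innerSL ℝ).comp (fderiv ℝ B x)) x :=
      (innerSL ℝ).hasFDerivAt.comp x (hBd x)
    rw [h.fderiv]
    rfl
  have hsymm : ∀ x ∈ Metric.ball c r, ∀ u v : Plane,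
      fderiv ℝ (fun x => innerSL ℝ (B x)) x u v = fderiv ℝ (fun x => innerSL ℝ (B x)) x v u := by
    intro x hx u v
    have h1 : fderiv ℝ B x (basisVec 0) 1 = fderiv ℝ B x (basisVec 1) 0 := by
      refine fderiv_convolution_symm hψ hψc hb hcurl fun t ht => ?_
      rw [hψdef, β.tsupport_normed_eq, Metric.mem_closedBall, dist_zero_right] at ht
      have h2 : ‖x - t‖ ≤ ρ - r := ht.trans (min_le_right _ _)
      rw [Metric.mem_ball] at hx ⊢
      rw [← dist_eq_norm, dist_comm] at h2
      linarith [dist_triangle t x c]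
    have hexp : ∀ w : Plane, w = w 0 • basisVec 0 + w 1 • basisVec 1 := fun w => by
      ext i
      fin_cases i <;> simp [basisVec]
    rw [hω, hω]
    have hu : ∀ w : Plane, fderiv ℝ B x w
        = w 0 • fderiv ℝ B x (basisVec 0) + w 1 • fderiv ℝ B x (basisVec 1) := fun w => by
      conv_lhs => rw [hexp w]
      simp only [map_add, map_smul]
    rw [hu u, hu v]
    simp only [PiLp.inner_apply, Fin.sum_univ_two, PiLp.add_apply, PiLp.smul_apply, smul_eq_mul,
      RCLike.inner_apply, conj_trivial]
    linear_combination (u 0 * v 1 - v 0 * u 1) * h1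
  -- Poincaré lemma for the smooth 1-form dual to the mollified field; vanishing curl is symmetry of
  -- its derivative.
  obtain ⟨φ, hφ⟩ := (convex_ball c r).exists_forall_hasFDerivAt_of_fderiv_symmetric
    Metric.isOpen_ball (hωs.differentiable (by simp)).differentiableOn hsymm
  refine ⟨φ, ?_, fun x hx j => ?_⟩
  · rw [contDiffOn_infty_iff_fderiv_of_isOpen Metric.isOpen_ball]
    exact ⟨fun x hx => (hφ x hx).differentiableAt.differentiableWithinAt,
      hωs.contDiffOn.congr fun x hx => (hφ x hx).fderiv⟩
  · have h1 : dist (B x) (b x) ≤ δ := by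
      refine β.dist_normed_convolution_le hb.aestronglyMeasurable fun y hy => hdK x hx y ?_
      exact (Metric.mem_ball.1 hy).trans_le (min_le_left _ _)
    rw [pderiv, (hφ x (hKr hx)).fderiv, innerSL_apply_apply, inner_basisVec, ← PiLp.sub_apply,
      ← Real.norm_eq_abs]
    exact (PiLp.norm_apply_le _ j).trans (by rwa [← dist_eq_norm])

end Gauge

/-! ### Wave packets and cutoff functions -/

section WavePacket

open scoped ContDiff

/-- The function `exp (i (φ + k · x)) f`. -/
def wavePacket (φ f : Plane → ℝ) (k x : Plane) : ℂ :=
  Complex.exp (Complex.I * ((φ x + inner ℝ k x : ℝ) : ℂ)) * (f x : ℂ)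

lemma norm_wavePacket (φ f : Plane → ℝ) (k x : Plane) : ‖wavePacket φ f k x‖ = |f x| := by
  rw [wavePacket, norm_mul, mul_comm Complex.I, Complex.norm_exp_ofReal_mul_I, one_mul,
    Complex.norm_real, Real.norm_eq_abs]

lemma tsupport_wavePacket_subset (φ f : Plane → ℝ) (k : Plane) :
    tsupport (wavePacket φ f k) ⊆ tsupport f := by
  refine closure_mono fun x hx => ?_
  have : ‖wavePacket φ f k x‖ ≠ 0 := norm_ne_zero_iff.2 hx
  rw [norm_wavePacket] at this
  exact abs_ne_zero.1 this

variable {φ f : Plane → ℝ} {c : Plane} {r : ℝ}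

lemma contDiff_wavePacket (hφ : ContDiffOn ℝ ∞ φ (Metric.ball c r)) (hf : ContDiff ℝ ∞ f)
    (hfr : tsupport f ⊆ Metric.ball c r) (k : Plane) : ContDiff ℝ ∞ (wavePacket φ f k) := by
  rw [contDiff_iff_contDiffAt]
  intro x
  by_cases hx : x ∈ tsupport f
  · have h1 : ContDiffAt ℝ ∞ φ x := hφ.contDiffAt (Metric.isOpen_ball.mem_nhds (hfr hx))
    have h2 : ContDiffAt ℝ ∞ (fun x => φ x + inner ℝ k x) x :=
      h1.add (contDiffAt_const.inner ℝ contDiffAt_id)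
    exact (contDiffAt_const.mul (Complex.ofRealCLM.contDiff.contDiffAt.comp x h2)).cexp.mul
      (Complex.ofRealCLM.contDiff.contDiffAt.comp x hf.contDiffAt)
  · refine (contDiffAt_const (c := (0 : ℂ))).congr_of_eventuallyEq ?_
    filter_upwards [(isClosed_tsupport f).isOpen_compl.mem_nhds hx] with y hy
    rw [wavePacket, image_eq_zero_of_notMem_tsupport hy]
    simp

lemma wavePacket_mem_testFun {Γ : Set Plane} (hφ : ContDiffOn ℝ ∞ φ (Metric.ball c r))
    (hf : ContDiff ℝ ∞ f) (hfr : tsupport f ⊆ Metric.ball c r) (hfc : HasCompactSupport f)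
    (hΓ : tsupport f ⊆ Γᶜ) (k : Plane) : wavePacket φ f k ∈ testFun Γ :=
  ⟨contDiff_wavePacket hφ hf hfr k,
    hfc.mono' ((subset_tsupport _).trans (tsupport_wavePacket_subset φ f k)),
    (tsupport_wavePacket_subset φ f k).trans hΓ⟩

/-- The phase turns the operator `-i∂_j - a_j - k_j` into multiplication of `f` by `∂_jφ - a_j` plus
`-i∂_j f`. Off the support of `f` nothing is known about `φ`, but the left side is zero. -/
lemma norm_covDeriv_wavePacket_le (hφ : ContDiffOn ℝ ∞ φ (Metric.ball c r))
    (hf : ContDiff ℝ ∞ f) (hfr : tsupport f ⊆ Metric.ball c r) (k : Plane) (a : Plane → Plane)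
    (j : Fin 2) (x : Plane) :
    ‖covDeriv a j (wavePacket φ f k) x - k j * wavePacket φ f k x‖
      ≤ |pderiv j φ x - a x j| * |f x| + |pderiv j f x| := by
  by_cases hx : x ∈ tsupport f
  · have h1 : HasFDerivAt φ (fderiv ℝ φ x) x := ((hφ.contDiffAt (Metric.isOpen_ball.mem_nhds
      (hfr hx))).differentiableAt (by simp)).hasFDerivAt
    have h2 : HasFDerivAt (fun x => φ x + inner ℝ k x) (fderiv ℝ φ x + innerSL ℝ k) x :=
      h1.add (innerSL ℝ k).hasFDerivAt
    have h3 : HasFDerivAt (fun x => ((φ x + inner ℝ k x : ℝ) : ℂ))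
        (Complex.ofRealCLM.comp (fderiv ℝ φ x + innerSL ℝ k)) x :=
      Complex.ofRealCLM.hasFDerivAt.comp x h2
    have h4 : HasFDerivAt (fun x => (f x : ℂ)) (Complex.ofRealCLM.comp (fderiv ℝ f x)) x :=
      Complex.ofRealCLM.hasFDerivAt.comp x ((hf.differentiable (by simp)) x).hasFDerivAt
    have h5 := ((h3.const_mul Complex.I).cexp).mul h4
    have h6 : pderiv j (wavePacket φ f k) x
        = Complex.exp (Complex.I * ((φ x + inner ℝ k x : ℝ) : ℂ)) * (((pderiv j f x : ℝ) : ℂ)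
          + Complex.I * ((pderiv j φ x + k j : ℝ) : ℂ) * (f x : ℂ)) := by
      have h7 : HasFDerivAt (wavePacket φ f k) _ x := h5
      rw [pderiv, h7.fderiv]
      simp only [add_apply, smul_apply, ContinuousLinearMap.comp_apply, innerSL_apply_apply,
        inner_basisVec, smul_eq_mul, Complex.ofRealCLM_apply, pderiv]
      push_cast
      ring
    have h8 : covDeriv a j (wavePacket φ f k) x - k j * wavePacket φ f k x
        = Complex.exp (Complex.I * ((φ x + inner ℝ k x : ℝ) : ℂ))
          * (((pderiv j φ x - a x j) * f x : ℝ) + -Complex.I * (pderiv j f x : ℝ)) := by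
      rw [covDeriv, h6, wavePacket]
      push_cast
      linear_combination (-Complex.exp (Complex.I * (φ x + (inner ℝ k x : ℝ)))
        * ((((pderiv j φ x : ℝ) : ℂ) + k j) * f x)) * Complex.I_mul_I
    rw [h8, norm_mul, mul_comm Complex.I, Complex.norm_exp_ofReal_mul_I, one_mul]
    refine (norm_add_le _ _).trans (le_of_eq ?_)
    rw [norm_mul, norm_neg, Complex.norm_I, Complex.norm_real, Complex.norm_real,
      Real.norm_eq_abs, Real.norm_eq_abs, abs_mul, one_mul]
  · have h1 : wavePacket φ f k x = 0 :=
      image_eq_zero_of_notMem_tsupport fun h => hx (tsupport_wavePacket_subset φ f k h)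
    have h2 : covDeriv a j (wavePacket φ f k) x = 0 :=
      image_eq_zero_of_notMem_tsupport fun h => hx (tsupport_wavePacket_subset φ f k
        (tsupport_covDeriv_subset a j _ h))
    rw [h1, h2]
    simp only [mul_zero, sub_zero, norm_zero]
    positivity

/-- Smooth cutoff functions with gradients decaying as the radius grows. -/
lemma exists_cutoff : ∃ C : ℝ, 0 ≤ C ∧ ∀ R > 0, ∃ M : ℝ, ∀ c : Plane, ∃ χ : Plane → ℝ,
    ContDiff ℝ ∞ χ ∧ tsupport χ ⊆ Metric.closedBall c R ∧ (∀ x, 0 ≤ χ x) ∧ (∀ x, χ x ≤ 1) ∧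
    (∀ x ∈ Metric.closedBall c (R / 2), χ x = 1) ∧ (∀ j x, |pderiv j χ x| ≤ C / R) ∧
    ∀ x, |∑ j, pderiv j (pderiv j χ) x| ≤ M := by
  let β : ContDiffBump (0 : Plane) := ⟨1 / 2, 1, by norm_num, by norm_num⟩
  have hβ : ContDiff ℝ ∞ β := β.contDiff
  obtain ⟨C, hC⟩ := (hβ.continuous_fderiv (by simp)).bounded_above_of_compact_support
    (β.hasCompactSupport.fderiv ℝ)
  have hC0 : 0 ≤ C := (norm_nonneg _).trans (hC 0)
  refine ⟨C, hC0, fun R hR => ?_⟩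
  -- Rescaling one fixed bump makes the gradient bound `C / R` with `C` independent of `R`; the
  -- Laplacian bound `M` may depend on `R` but, by translation, not on the centre.
  set χ₀ : Plane → ℝ := fun x => β (R⁻¹ • x) with hχ₀
  have hχs : ContDiff ℝ ∞ χ₀ := hβ.comp (contDiff_const_smul _)
  have hts : tsupport χ₀ ⊆ Metric.closedBall 0 R := by
    refine (tsupport_comp_subset_preimage β (f := fun x : Plane => R⁻¹ • x) (by fun_prop)).trans ?_
    intro x hx
    rw [Set.mem_preimage, β.tsupport_eq, mem_closedBall_zero_iff, norm_smul, norm_inv,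
      Real.norm_of_nonneg hR.le, inv_mul_le_iff₀ hR] at hx
    simpa [β] using hx
  have hcs : HasCompactSupport χ₀ := HasCompactSupport.of_support_subset_isCompact
    (isCompact_closedBall 0 R) ((subset_tsupport _).trans hts)
  have hcont : Continuous fun x => ∑ j, pderiv j (pderiv j χ₀) x :=
    continuous_finsetSum _ fun j _ => (contDiff_pderiv (contDiff_pderiv hχs j) j).continuous
  have hcs2 : HasCompactSupport fun x => ∑ j, pderiv j (pderiv j χ₀) x := by
    refine hcs.mono' fun x hx => ?_
    by_contra h
    refine hx (Finset.sum_eq_zero fun j _ => ?_)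
    exact image_eq_zero_of_notMem_tsupport fun h2 => h
      ((tsupport_fderiv_apply_subset ℝ (basisVec j)).trans
        (tsupport_fderiv_apply_subset ℝ (basisVec j)) h2)
  obtain ⟨M, hM⟩ := hcont.bounded_above_of_compact_support hcs2
  have hd : ∀ j x, |pderiv j χ₀ x| ≤ C / R := by
    intro j x
    have h1 : HasFDerivAt χ₀ ((fderiv ℝ β (R⁻¹ • x)).comp
        (R⁻¹ • ContinuousLinearMap.id ℝ Plane)) x :=
      ((hβ.differentiable (by simp)) (R⁻¹ • x)).hasFDerivAt.comp x
        ((hasFDerivAt_id x).const_smul R⁻¹)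
    rw [pderiv, h1.fderiv, ← Real.norm_eq_abs]
    simp only [ContinuousLinearMap.comp_apply, smul_apply,
      ContinuousLinearMap.id_apply, map_smul, norm_smul, norm_inv, Real.norm_of_nonneg hR.le]
    rw [inv_mul_le_iff₀ hR, mul_div_cancel₀ _ hR.ne']
    refine (ContinuousLinearMap.le_opNorm _ _).trans ?_
    have : ‖(basisVec j : Plane)‖ = 1 := by simp [basisVec]
    rw [this, mul_one]
    exact hC _
  refine ⟨M, fun c => ⟨fun x => χ₀ (x + -c), hχs.comp (contDiff_id.add contDiff_const), ?_,
    fun x => β.nonneg, fun x => β.le_one, fun x hx => ?_, fun j x => ?_, fun x => ?_⟩⟩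
  · refine (tsupport_comp_subset_preimage χ₀ (f := fun x : Plane => x + -c) (by fun_prop)).trans ?_
    intro x hx
    have := hts hx
    rw [mem_closedBall_zero_iff] at this
    rwa [Metric.mem_closedBall, dist_eq_norm, sub_eq_add_neg]
  · refine β.one_of_mem_closedBall ?_
    rw [mem_closedBall_zero_iff, norm_smul, norm_inv, Real.norm_of_nonneg hR.le,
      inv_mul_le_iff₀ hR, ← sub_eq_add_neg, ← dist_eq_norm]
    simpa [β, div_eq_mul_inv] using hx
  · rw [pderiv, fderiv_comp_add_right]
    exact hd j _
  · have h1 : ∀ j, pderiv j (fun x => χ₀ (x + -c)) = fun x => pderiv j χ₀ (x + -c) := fun j =>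
      funext fun x => by rw [pderiv, fderiv_comp_add_right]; rfl
    have h2 : ∀ j, pderiv j (fun x => pderiv j χ₀ (x + -c)) x
        = pderiv j (pderiv j χ₀) (x + -c) := fun j => by
      rw [pderiv, fderiv_comp_add_right]; rfl
    simp only [h1, h2]
    exact hM _

end WavePacket

/-! ### Small flux on large discs gives the full half-line as spectrum -/

section SmallFlux

open scoped ContDiff

variable {Γ : Set Plane} {α : Plane → ℝ}

lemma isClosed_of_forall_not_accPt (h : ∀ x, ¬ AccPt x (𝓟 Γ)) : IsClosed Γ :=
  isClosed_iff_accPt.2 fun x hx => absurd hx (h x)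

lemma finite_inter_of_forall_not_accPt (h : ∀ x, ¬ AccPt x (𝓟 Γ)) {K : Set Plane}
    (hK : IsCompact K) : (Γ ∩ K).Finite := by
  by_contra hinf
  obtain ⟨x, -, hx⟩ := Set.Infinite.exists_accPt_of_subset_isCompact hinf hK Set.inter_subset_right
  exact h x (hx.mono (Filter.principal_mono.2 Set.inter_subset_left))

lemma volume_eq_zero_of_forall_not_accPt (h : ∀ x, ¬ AccPt x (𝓟 Γ)) : volume Γ = 0 := by
  have : Γ = ⋃ n : ℕ, Γ ∩ Metric.closedBall 0 n := by
    rw [← Set.inter_iUnion, Metric.iUnion_closedBall_nat, Set.inter_univ]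
  rw [this, measure_iUnion_null_iff]
  exact fun n => (finite_inter_of_forall_not_accPt h (isCompact_closedBall 0 _)).measure_zero _

lemma sum_lt_of_totalFlux_lt {E : Set Plane} {ε : ℝ} (hε : 0 < ε)
    (h : totalFlux Γ α E < ENNReal.ofReal ε) {s : Finset Plane} (hs : ∀ γ ∈ s, γ ∈ Γ ∩ E)
    (hα : ∀ γ ∈ s, 0 ≤ α γ) : ∑ γ ∈ s, α γ < ε := by
  rw [← ENNReal.ofReal_lt_ofReal_iff hε, ENNReal.ofReal_sum_of_nonneg hα]
  refine lt_of_le_of_lt ?_ h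
  rw [totalFlux, tsum_subtype (Γ ∩ E) fun γ => ENNReal.ofReal (α γ)]
  refine le_trans (le_of_eq ?_) (ENNReal.sum_le_tsum s)
  exact Finset.sum_congr rfl fun γ hγ => by rw [Set.indicator_of_mem (hs γ hγ)]

/-- The sum of the Aharonov-Bohm potentials of the fluxes `α_γ`, `γ ∈ s`. -/
def abSum (s : Finset Plane) (α : Plane → ℝ) (x : Plane) : Plane :=
  ∑ γ ∈ s, α γ • abPotential γ x

lemma abSum_apply (s : Finset Plane) (α : Plane → ℝ) (x : Plane) (j : Fin 2) :
    abSum s α x j = ∑ γ ∈ s, α γ * abPotential γ x j := by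
  rw [abSum]
  simp

/-- The potential is the gradient `fluxGrad` rotated by a right angle, so the energy bounds for the
one serve the other. -/
lemma exists_abs_abSum_eq (s : Finset Plane) (α : Plane → ℝ) (j : Fin 2) :
    ∃ i, ∀ x, |abSum s α x j| = |fluxGrad s α i x| := by
  fin_cases j
  · refine ⟨1, fun x => ?_⟩
    change |abSum s α x 0| = _
    simp only [abSum_apply, abPotential_zero, mul_neg, Finset.sum_neg_distrib, abs_neg, fluxGrad]
  · refine ⟨0, fun x => ?_⟩
    change |abSum s α x 1| = _
    simp only [abSum_apply, abPotential_one, fluxGrad]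

lemma locallyIntegrable_abSum (s : Finset Plane) (α : Plane → ℝ) :
    LocallyIntegrable (abSum s α) volume :=
  locallyIntegrable_finsetSum s fun γ _ => (locallyIntegrable_abPotential γ).smul (α γ)

lemma continuousAt_abSum {s : Finset Plane} {α : Plane → ℝ} {x : Plane} (hx : x ∉ s) :
    ContinuousAt (abSum s α) x :=
  tendsto_finsetSum s fun γ hγ =>
    ((contDiffAt_abPotential (fun h => hx (by rwa [h]))).continuousAt).const_smul (α γ)

lemma integrable_curl {a : Plane → Plane} (ha : LocallyIntegrable a volume) {η : Plane → ℝ}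
    (hη : ContDiff ℝ ∞ η) (hc : HasCompactSupport η) :
    Integrable (fun x => a x 0 * pderiv 1 η x - a x 1 * pderiv 0 η x)
      (volume : Measure Plane) := by
  have h : ∀ i j, Integrable (fun x => a x i * pderiv j η x) (volume : Measure Plane) := by
    intro i j
    have h1 := ha.integrable_smul_left_of_hasCompactSupport (contDiff_pderiv hη j).continuous
      (hasCompactSupport_pderiv hc j)
    have h2 := (EuclideanSpace.proj i : Plane →L[ℝ] ℝ).integrable_comp h1
    refine h2.congr (ae_of_all _ fun x => ?_)
    simp [mul_comm]
  exact (h 0 1).sub (h 1 0)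

lemma integral_abSum_curl (s : Finset Plane) (α : Plane → ℝ) {η : Plane → ℝ}
    (hη : ContDiff ℝ ∞ η) (hc : HasCompactSupport η) :
    ∫ x, (abSum s α x 0 * pderiv 1 η x - abSum s α x 1 * pderiv 0 η x)
      = ∑ γ ∈ s, 2 * Real.pi * α γ * η γ := by
  have h : ∀ x, abSum s α x 0 * pderiv 1 η x - abSum s α x 1 * pderiv 0 η x
      = ∑ γ ∈ s, α γ * (abPotential γ x 0 * pderiv 1 η x - abPotential γ x 1 * pderiv 0 η x) := by
    intro x
    rw [abSum_apply, abSum_apply, Finset.sum_mul, Finset.sum_mul, ← Finset.sum_sub_distrib]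
    exact Finset.sum_congr rfl fun γ _ => by ring
  simp only [h]
  rw [integral_finsetSum _ fun γ _ =>
    (integrable_curl (locallyIntegrable_abPotential γ) hη hc).const_mul (α γ)]
  refine Finset.sum_congr rfl fun γ _ => ?_
  rw [integral_const_mul, integral_abPotential_curl γ hη hc]
  ring

/-- Near a ball, a vector potential differs from the Aharonov-Bohm potential of the fluxes in
that ball by a curl-free field. -/
lemma integral_sub_abSum_curl {a : Plane → Plane} (ha : IsVectorPotential Γ α a)
    {U : Set Plane} {s : Finset Plane} (hsΓ : ∀ γ ∈ s, γ ∈ Γ)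
    (hsU : ∀ γ ∈ Γ, γ ∈ U → α γ ≠ 0 → γ ∈ s) {η : Plane → ℝ}
    (hη : ContDiff ℝ ∞ η) (hc : HasCompactSupport η) (hU : tsupport η ⊆ U) :
    ∫ x, ((a x - abSum s α x) 0 * pderiv 1 η x - (a x - abSum s α x) 1 * pderiv 0 η x) = 0 := by
  have h1 := ha.curl_eq η hη hc
  have h2 := integral_abSum_curl s α hη hc
  have h3 : ∑' γ : Γ, 2 * Real.pi * α γ * η γ = ∑ γ ∈ s, 2 * Real.pi * α γ * η γ := by
    rw [tsum_subtype Γ fun γ => 2 * Real.pi * α γ * η γ, tsum_eq_sum (s := s)]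
    · exact Finset.sum_congr rfl fun γ hγ => by rw [Set.indicator_of_mem (hsΓ γ hγ)]
    · intro γ hγ
      by_cases hΓ : γ ∈ Γ
      · rw [Set.indicator_of_mem hΓ]
        by_cases hU' : γ ∈ U
        · have : α γ = 0 := by
            by_contra h
            exact hγ (hsU γ hΓ hU' h)
          simp [this]
        · rw [image_eq_zero_of_notMem_tsupport fun h => hU' (hU h), mul_zero]
      · rw [Set.indicator_of_notMem hΓ]
  have h4 := integral_sub (integrable_curl ha.locallyIntegrable hη hc)
    (integrable_curl (locallyIntegrable_abSum s α) hη hc)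
  rw [h1, h2, h3, sub_self] at h4
  rw [← h4]
  refine integral_congr_ae (ae_of_all _ fun x => ?_)
  simp only [PiLp.sub_apply]
  ring

lemma volume_real_closedBall (c : Plane) {R : ℝ} (hR : 0 ≤ R) :
    (volume : Measure Plane).real (Metric.closedBall c R) = R ^ 2 * Real.pi := by
  rw [Measure.real, EuclideanSpace.volume_closedBall_fin_two, ENNReal.toReal_mul,
    ENNReal.toReal_pow, ENNReal.toReal_ofReal hR, ENNReal.toReal_ofReal Real.pi_pos.le]

lemma sq_add_five_le {x y₁ y₂ y₃ y₄ y₅ : ℝ} (h0 : 0 ≤ x) (h : x ≤ y₁ + y₂ + y₃ + y₄ + y₅) :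
    x ^ 2 ≤ 5 * (y₁ ^ 2 + y₂ ^ 2 + y₃ ^ 2 + y₄ ^ 2 + y₅ ^ 2) := by
  have h1 : x ^ 2 ≤ (y₁ + y₂ + y₃ + y₄ + y₅) ^ 2 := pow_le_pow_left₀ h0 h 2
  nlinarith [sq_nonneg (y₁ - y₂), sq_nonneg (y₁ - y₃), sq_nonneg (y₁ - y₄), sq_nonneg (y₁ - y₅),
    sq_nonneg (y₂ - y₃), sq_nonneg (y₂ - y₄), sq_nonneg (y₂ - y₅), sq_nonneg (y₃ - y₄),
    sq_nonneg (y₃ - y₅), sq_nonneg (y₄ - y₅)]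

/-- The magnetic Sobolev norms of a cutoff times two amplitudes. -/
lemma integral_sq_le_of_pointwise {c : Plane} {R C η δ : ℝ} (hR : 0 < R) {Cχ : ℝ}
    {χ f₁ f₀ G D : Plane → ℝ} (hχ : ContDiff ℝ ∞ χ)
    (hsupp : tsupport χ ⊆ Metric.closedBall c R) (hχ0 : ∀ x, 0 ≤ χ x) (hχ1 : ∀ x, χ x ≤ 1)
    {j : Fin 2} (hχd : ∀ x, |pderiv j χ x| ≤ Cχ / R)
    (hf₁ : ContDiff ℝ ∞ f₁) (hf₁0 : ∀ x, 0 ≤ f₁ x) (hf₁1 : ∀ x, f₁ x ≤ 1)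
    (hf₀ : ContDiff ℝ ∞ f₀) (hf₀0 : ∀ x, 0 ≤ f₀ x) (hf₀1 : ∀ x, f₀ x ≤ 1)
    (hG : Continuous fun x => G x * f₁ x)
    (h₁ : ∫ x, χ x * pderiv j f₁ x ^ 2 ≤ C * η) (h₀ : ∫ x, χ x * pderiv j f₀ x ^ 2 ≤ C * η)
    (hGi : ∫ x, χ x * (G x * f₁ x) ^ 2 ≤ C * η) (hD0 : ∀ x, 0 ≤ D x)
    (hD : ∀ x, D x ≤ (δ + |G x|) * |χ x * (f₁ x * f₀ x)|
      + |pderiv j (fun x => χ x * (f₁ x * f₀ x)) x|) :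
    ∫ x, D x ^ 2 ≤ 5 * (δ ^ 2 * (∫ x, (χ x * (f₁ x * f₀ x)) ^ 2) + 3 * (C * η)
      + Cχ ^ 2 * Real.pi) := by
  have hc : HasCompactSupport χ := HasCompactSupport.of_support_subset_isCompact
    (isCompact_closedBall c R) ((subset_tsupport χ).trans hsupp)
  have hint : ∀ g : Plane → ℝ, Continuous g → Integrable (fun x => χ x * g x)
      (volume : Measure Plane) := fun g hg =>
    (hχ.continuous.mul hg).integrable_of_hasCompactSupport hc.mul_right
  have i1 : Integrable (fun x => (χ x * (f₁ x * f₀ x)) ^ 2) (volume : Measure Plane) := by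
    have := hint (fun x => χ x * (f₁ x * f₀ x) ^ 2)
      (hχ.continuous.mul ((hf₁.continuous.mul hf₀.continuous).pow 2))
    refine this.congr (ae_of_all _ fun x => ?_)
    ring
  have i2 := hint (fun x => (G x * f₁ x) ^ 2) (hG.pow 2)
  have i3 : Integrable (fun x => pderiv j χ x ^ 2) (volume : Measure Plane) := by
    simp only [sq]
    exact ((contDiff_pderiv hχ j).continuous.mul
      (contDiff_pderiv hχ j).continuous).integrable_of_hasCompactSupport
      (hasCompactSupport_pderiv hc j).mul_right
  have i4 := hint (fun x => pderiv j f₁ x ^ 2) ((contDiff_pderiv hf₁ j).continuous.pow 2)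
  have i5 := hint (fun x => pderiv j f₀ x ^ 2) ((contDiff_pderiv hf₀ j).continuous.pow 2)
  have hder : ∀ x, pderiv j (fun x => χ x * (f₁ x * f₀ x)) x
      = pderiv j χ x * (f₁ x * f₀ x) + χ x * pderiv j f₁ x * f₀ x + χ x * pderiv j f₀ x * f₁ x := by
    intro x
    have d1 := (hχ.differentiable (by simp)) x
    have d2 := (hf₁.differentiable (by simp)) x
    have d3 := (hf₀.differentiable (by simp)) x
    rw [pderiv, fderiv_fun_mul d1 (d2.fun_mul d3), fderiv_fun_mul d2 d3]
    simp only [add_apply, smul_apply, smul_eq_mul, pderiv]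
    ring
  have hpt : ∀ x, D x ^ 2 ≤ 5 * (δ ^ 2 * (χ x * (f₁ x * f₀ x)) ^ 2 + χ x * (G x * f₁ x) ^ 2
      + pderiv j χ x ^ 2 + χ x * pderiv j f₁ x ^ 2 + χ x * pderiv j f₀ x ^ 2) := by
    intro x
    have a1 := hχ0 x
    have a2 := hχ1 x
    have hff : |χ x * (f₁ x * f₀ x)| = χ x * (f₁ x * f₀ x) :=
      abs_of_nonneg (mul_nonneg a1 (mul_nonneg (hf₁0 x) (hf₀0 x)))
    have b1 : D x ≤ δ * (χ x * (f₁ x * f₀ x)) + χ x * (|G x| * f₁ x) + |pderiv j χ x|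
        + χ x * |pderiv j f₁ x| + χ x * |pderiv j f₀ x| := by
      refine (hD x).trans ?_
      rw [hder, hff]
      have t1 : |pderiv j χ x * (f₁ x * f₀ x) + χ x * pderiv j f₁ x * f₀ x
          + χ x * pderiv j f₀ x * f₁ x| ≤ |pderiv j χ x| * (f₁ x * f₀ x)
          + χ x * |pderiv j f₁ x| * f₀ x + χ x * |pderiv j f₀ x| * f₁ x := by
        refine (abs_add_three _ _ _).trans (le_of_eq ?_)
        simp only [abs_mul, abs_of_nonneg a1, abs_of_nonneg (hf₁0 x), abs_of_nonneg (hf₀0 x)]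
      have t2 : |pderiv j χ x| * (f₁ x * f₀ x) ≤ |pderiv j χ x| :=
        mul_le_of_le_one_right (abs_nonneg _) (mul_le_one₀ (hf₁1 x) (hf₀0 x) (hf₀1 x))
      have t3 : χ x * |pderiv j f₁ x| * f₀ x ≤ χ x * |pderiv j f₁ x| :=
        mul_le_of_le_one_right (by positivity) (hf₀1 x)
      have t4 : χ x * |pderiv j f₀ x| * f₁ x ≤ χ x * |pderiv j f₀ x| :=
        mul_le_of_le_one_right (by positivity) (hf₁1 x)
      have t5 : |G x| * (χ x * (f₁ x * f₀ x)) ≤ χ x * (|G x| * f₁ x) := by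
        have : χ x * (|G x| * f₁ x) * f₀ x ≤ χ x * (|G x| * f₁ x) :=
          mul_le_of_le_one_right (mul_nonneg a1 (mul_nonneg (abs_nonneg _) (hf₁0 x))) (hf₀1 x)
        linarith
      linarith
    refine (sq_add_five_le (hD0 x) b1).trans ?_
    -- The energy estimates carry the weight `χ`, not `χ²`; `0 ≤ χ ≤ 1` gives `χ² ≤ χ`.
    have hsq : ∀ y : ℝ, (χ x * y) ^ 2 ≤ χ x * y ^ 2 := fun y => by
      rw [mul_pow]
      exact mul_le_mul_of_nonneg_right (by nlinarith) (sq_nonneg y)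
    have s2 := hsq (|G x| * f₁ x)
    have s4 := hsq |pderiv j f₁ x|
    have s5 := hsq |pderiv j f₀ x|
    rw [mul_pow |G x|, sq_abs, ← mul_pow] at s2
    rw [sq_abs (pderiv j f₁ x)] at s4
    rw [sq_abs (pderiv j f₀ x)] at s5
    rw [sq_abs, mul_pow δ]
    linarith
  -- In two dimensions the factor `R⁻²` cancels against the area `π R²`, so the cutoff error does
  -- not depend on `R`.
  have e3 : ∫ x, pderiv j χ x ^ 2 ≤ Cχ ^ 2 * Real.pi := by
    have hz : ∀ x ∉ Metric.closedBall c R, pderiv j χ x ^ 2 = 0 := fun x hx => by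
      have : pderiv j χ x = 0 := image_eq_zero_of_notMem_tsupport fun h =>
        hx (hsupp (tsupport_fderiv_apply_subset ℝ (basisVec j) h))
      rw [this, zero_pow two_ne_zero]
    rw [← setIntegral_eq_integral_of_forall_compl_eq_zero hz]
    calc ∫ x in Metric.closedBall c R, pderiv j χ x ^ 2
        ≤ ∫ _ in Metric.closedBall c R, (Cχ / R) ^ 2 := by
          refine setIntegral_mono_on i3.integrableOn
            (continuous_const.continuousOn.integrableOn_compact (isCompact_closedBall c R))
            measurableSet_closedBall fun x _ => ?_
          rw [← sq_abs]
          exact pow_le_pow_left₀ (abs_nonneg _) (hχd x) 2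
      _ = Cχ ^ 2 * Real.pi := by
          rw [setIntegral_const, volume_real_closedBall c hR.le, smul_eq_mul]
          field_simp
  have k1 : Integrable (fun x => δ ^ 2 * (χ x * (f₁ x * f₀ x)) ^ 2) (volume : Measure Plane) :=
    i1.const_mul _
  have k2 : Integrable (fun x => δ ^ 2 * (χ x * (f₁ x * f₀ x)) ^ 2 + χ x * (G x * f₁ x) ^ 2)
    (volume : Measure Plane) := k1.add i2
  have k3 : Integrable (fun x => δ ^ 2 * (χ x * (f₁ x * f₀ x)) ^ 2 + χ x * (G x * f₁ x) ^ 2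
    + pderiv j χ x ^ 2) (volume : Measure Plane) := k2.add i3
  have k4 : Integrable (fun x => δ ^ 2 * (χ x * (f₁ x * f₀ x)) ^ 2 + χ x * (G x * f₁ x) ^ 2
    + pderiv j χ x ^ 2 + χ x * pderiv j f₁ x ^ 2) (volume : Measure Plane) := k3.add i4
  calc ∫ x, D x ^ 2 ≤ ∫ x, 5 * (δ ^ 2 * (χ x * (f₁ x * f₀ x)) ^ 2 + χ x * (G x * f₁ x) ^ 2
      + pderiv j χ x ^ 2 + χ x * pderiv j f₁ x ^ 2 + χ x * pderiv j f₀ x ^ 2) :=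
        integral_mono_of_nonneg (ae_of_all _ fun x => sq_nonneg _)
          ((k4.add i5).const_mul 5) (ae_of_all _ hpt)
    _ = 5 * (δ ^ 2 * (∫ x, (χ x * (f₁ x * f₀ x)) ^ 2) + (∫ x, χ x * (G x * f₁ x) ^ 2)
      + (∫ x, pderiv j χ x ^ 2) + (∫ x, χ x * pderiv j f₁ x ^ 2)
      + ∫ x, χ x * pderiv j f₀ x ^ 2) := by
        rw [integral_const_mul, integral_add k4 i5, integral_add k3 i4, integral_add k2 i3,
          integral_add k1 i2, integral_const_mul]
    _ ≤ _ := by linarith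

/-- On the half-size disc `χ = 1` and `(f₁ f₀)² ≥ 1 - 2(1 - f₁) - 2(1 - f₀)`. -/
lemma le_integral_sq_cutoff_mul {c : Plane} {R B : ℝ} (hR : 0 < R)
    {χ f₁ f₀ : Plane → ℝ} (hχ : ContDiff ℝ ∞ χ)
    (hsupp : tsupport χ ⊆ Metric.closedBall c R)
    (hχ1 : ∀ x ∈ Metric.closedBall c (R / 2), χ x = 1)
    (hf₁ : Continuous f₁) (hf₁0 : ∀ x, 0 ≤ f₁ x) (hf₁1 : ∀ x, f₁ x ≤ 1)
    (hf₀ : Continuous f₀) (hf₀0 : ∀ x, 0 ≤ f₀ x) (hf₀1 : ∀ x, f₀ x ≤ 1)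
    (h₁ : ∫ x in Metric.closedBall c R, (1 - f₁ x) ≤ B)
    (h₀ : ∫ x in Metric.closedBall c R, (1 - f₀ x) ≤ B) :
    R ^ 2 / 4 * Real.pi - 4 * B ≤ ∫ x, (χ x * (f₁ x * f₀ x)) ^ 2 := by
  have hc : HasCompactSupport χ := HasCompactSupport.of_support_subset_isCompact
    (isCompact_closedBall c R) ((subset_tsupport χ).trans hsupp)
  have hi : Integrable (fun x => (χ x * (f₁ x * f₀ x)) ^ 2) (volume : Measure Plane) := by
    simp only [sq]
    have h := hχ.continuous.mul (hf₁.mul hf₀)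
    exact (h.mul h).integrable_of_hasCompactSupport hc.mul_right.mul_right
  have hsub : Metric.closedBall c (R / 2) ⊆ Metric.closedBall c R :=
    Metric.closedBall_subset_closedBall (by linarith)
  have hK : ∀ r, IsCompact (Metric.closedBall c r) := fun r => isCompact_closedBall c r
  have hhalf : ∀ f : Plane → ℝ, Continuous f → (∀ x, f x ≤ 1) →
      ∫ x in Metric.closedBall c R, (1 - f x) ≤ B →
      ∫ x in Metric.closedBall c (R / 2), (1 - f x) ≤ B := by
    intro f hf hf1 h
    refine le_trans ?_ h
    exact setIntegral_mono_set ((continuous_const.sub hf).continuousOn.integrableOn_compact (hK R))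
      (ae_of_all _ fun x => sub_nonneg.2 (hf1 x)) hsub.eventuallyLE
  have g₁ := hhalf f₁ hf₁ hf₁1 h₁
  have g₀ := hhalf f₀ hf₀ hf₀1 h₀
  have j₁ : IntegrableOn (fun x => 1 - f₁ x) (Metric.closedBall c (R / 2)) volume :=
    (continuous_const.sub hf₁).continuousOn.integrableOn_compact (hK _)
  have j₀ : IntegrableOn (fun x => 1 - f₀ x) (Metric.closedBall c (R / 2)) volume :=
    (continuous_const.sub hf₀).continuousOn.integrableOn_compact (hK _)
  have jc : IntegrableOn (fun _ => (1 : ℝ)) (Metric.closedBall c (R / 2)) volume :=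
    continuous_const.continuousOn.integrableOn_compact (hK _)
  have jj : IntegrableOn (fun x => 2 * (1 - f₁ x) + 2 * (1 - f₀ x)) (Metric.closedBall c (R / 2))
      volume := (j₁.const_mul 2).add (j₀.const_mul 2)
  calc R ^ 2 / 4 * Real.pi - 4 * B
      ≤ ∫ x in Metric.closedBall c (R / 2), (1 - (2 * (1 - f₁ x) + 2 * (1 - f₀ x))) := by
        rw [integral_sub jc jj,
          integral_add (j₁.const_mul 2) (j₀.const_mul 2), integral_const_mul, integral_const_mul,
          setIntegral_const, volume_real_closedBall c (by positivity), smul_eq_mul]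
        linarith
    _ ≤ ∫ x in Metric.closedBall c (R / 2), (χ x * (f₁ x * f₀ x)) ^ 2 := by
        refine setIntegral_mono_on (jc.sub jj)
          hi.integrableOn measurableSet_closedBall fun x hx => ?_
        rw [hχ1 x hx, one_mul]
        have := hf₁0 x
        have := hf₁1 x
        have := hf₀0 x
        have := hf₀1 x
        nlinarith [mul_nonneg (sub_nonneg.2 (hf₁1 x)) (sub_nonneg.2 (hf₀1 x)),
          sq_nonneg (f₁ x * f₀ x - 1)]
    _ ≤ _ := setIntegral_le_integral hi (ae_of_all _ fun x => sq_nonneg _)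

/-- If the total flux is arbitrarily small on arbitrarily large discs, then plane waves are
approximate eigenfunctions of the magnetic gradient. -/
theorem exists_approx_eigenfunction (hΓ : ∀ x, ¬ AccPt x (𝓟 Γ)) (hα : ∀ γ ∈ Γ, 0 ≤ α γ)
    {a : Plane → Plane} (ha : IsVectorPotential Γ α a)
    (hsmall : ∀ R > 0, ∀ ε > 0, ∃ c, totalFlux Γ α (Metric.closedBall c R) < ENNReal.ofReal ε)
    (k : Plane) {ε : ℝ} (hε : 0 < ε) :
    ∃ u ∈ testFun Γ, 0 < ∫ x, ‖u x‖ ^ 2 ∧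
      ∀ j, ∫ x, ‖covDeriv a j u x - k j * u x‖ ^ 2 ≤ ε ^ 2 * ∫ x, ‖u x‖ ^ 2 := by
  classical
  obtain ⟨Cχ, hCχ, hcut⟩ := exists_cutoff
  -- The `1` reserves room for the flux term `3Cη`. The right side is half of `ε²` times the lower
  -- bound `R²π/8` for the squared norm.
  obtain ⟨R, hR, hRε⟩ : ∃ R > 0, 5 * (Cχ ^ 2 * Real.pi + 1) ≤ ε ^ 2 * (R ^ 2 * Real.pi) / 16 := by
    refine ⟨√(80 * (Cχ ^ 2 * Real.pi + 1) / (ε ^ 2 * Real.pi)), by positivity, ?_⟩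
    rw [Real.sq_sqrt (by positivity)]
    apply le_of_eq
    field_simp
    norm_num
  obtain ⟨M, hM⟩ := hcut R hR
  obtain ⟨C, hC, hamp⟩ := exists_amplitude hR M
  -- The flux is made small only after `R`, and hence `C`, is fixed: the first condition controls
  -- the energies, the second keeps the norm of `f` large.
  obtain ⟨η, hη, hη1, hη2⟩ : ∃ η > 0, 3 * (C * η) ≤ 1 ∧ 4 * (C * η) ≤ R ^ 2 * Real.pi / 8 := by
    refine ⟨min (1 / (3 * (C + 1))) (R ^ 2 * Real.pi / (32 * (C + 1))), by positivity, ?_, ?_⟩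
    · calc 3 * (C * min (1 / (3 * (C + 1))) (R ^ 2 * Real.pi / (32 * (C + 1))))
          ≤ 3 * ((C + 1) * (1 / (3 * (C + 1)))) := by
            gcongr
            · linarith
            · exact min_le_left _ _
        _ = 1 := by field_simp
    · calc 4 * (C * min (1 / (3 * (C + 1))) (R ^ 2 * Real.pi / (32 * (C + 1))))
          ≤ 4 * ((C + 1) * (R ^ 2 * Real.pi / (32 * (C + 1)))) := by
            gcongr
            · linarith
            · exact min_le_right _ _
        _ = R ^ 2 * Real.pi / 8 := by field_simp; norm_num
  obtain ⟨c, hflux⟩ := hsmall (2 * R) (by positivity) η hη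
  obtain ⟨χ, hχ, hsupp, hχ0, hχ1, hχone, hχd, hχM⟩ := hM c
  have hfin := finite_inter_of_forall_not_accPt hΓ (isCompact_closedBall c (2 * R))
  set s := hfin.toFinset with hs
  have hsmem : ∀ γ, γ ∈ s ↔ γ ∈ Γ ∧ γ ∈ Metric.closedBall c (2 * R) := fun γ => by
    rw [hs, Set.Finite.mem_toFinset, Set.mem_inter_iff]
  -- Points of zero flux still have to be avoided by test functions but contribute no power to the
  -- flux product. They are treated separately with fictitious fluxes `α₀`.
  set s₁ := s.filter (fun γ => α γ ≠ 0) with hs₁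
  set s₀ := s.filter (fun γ => α γ = 0) with hs₀
  have hs₁mem : ∀ γ, γ ∈ s₁ ↔ (γ ∈ Γ ∧ γ ∈ Metric.closedBall c (2 * R)) ∧ α γ ≠ 0 := fun γ => by
    rw [hs₁, Finset.mem_filter, hsmem]
  have hs₀mem : ∀ γ, γ ∈ s₀ ↔ (γ ∈ Γ ∧ γ ∈ Metric.closedBall c (2 * R)) ∧ α γ = 0 := fun γ => by
    rw [hs₀, Finset.mem_filter, hsmem]
  have hα₁ : ∀ γ ∈ s₁, 0 < α γ := fun γ hγ =>
    lt_of_le_of_ne (hα γ ((hs₁mem γ).1 hγ).1.1) ((hs₁mem γ).1 hγ).2.symm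
  have hsum₁ : ∑ γ ∈ s₁, α γ ≤ η := (sum_lt_of_totalFlux_lt hη hflux
    (fun γ hγ => ((hs₁mem γ).1 hγ).1) fun γ hγ => (hα₁ γ hγ).le).le
  -- Positive fluxes of total at most `η`; the `+ 1` covers an empty `s₀`. They shape `f₀` only and
  -- do not enter the potential.
  set α₀ : Plane → ℝ := fun _ => η / (s₀.card + 1) with hα₀
  have hsum₀ : ∑ γ ∈ s₀, α₀ γ ≤ η := by
    rw [hα₀, Finset.sum_const, nsmul_eq_mul, mul_div_left_comm]
    refine mul_le_of_le_one_right hη.le ((div_le_one (by positivity)).2 (by linarith))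
  obtain ⟨f₁, hf₁, hf₁s, hf₁0, hf₁1, hf₁G, hf₁i, hf₁e⟩ := hamp c s₁ α
    (fun γ hγ => ((hs₁mem γ).1 hγ).1.2) hα₁
  obtain ⟨f₀, hf₀, hf₀s, hf₀0, hf₀1, -, hf₀i, hf₀e⟩ := hamp c s₀ α₀
    (fun γ hγ => ((hs₀mem γ).1 hγ).1.2) (fun γ _ => by positivity)
  have hCη₁ : C * ∑ γ ∈ s₁, α γ ≤ C * η := mul_le_mul_of_nonneg_left hsum₁ hC
  have hCη₀ : C * ∑ γ ∈ s₀, α₀ γ ≤ C * η := mul_le_mul_of_nonneg_left hsum₀ hC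
  set f : Plane → ℝ := fun x => χ x * (f₁ x * f₀ x) with hf
  have hfs : ContDiff ℝ ∞ f := hχ.mul (hf₁.mul hf₀)
  have hfχ : tsupport f ⊆ tsupport χ := tsupport_mul_subset_left
  have hc : HasCompactSupport χ := HasCompactSupport.of_support_subset_isCompact
    (isCompact_closedBall c R) ((subset_tsupport χ).trans hsupp)
  have hfc : HasCompactSupport f := hc.mul_right
  have hR2 : Metric.closedBall c R ⊆ Metric.closedBall c (2 * R) :=
    Metric.closedBall_subset_closedBall (by linarith)
  have hfΓ : tsupport f ⊆ Γᶜ := by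
    intro x hx hxΓ
    have hxb : x ∈ Metric.closedBall c (2 * R) := hR2 (hsupp (hfχ hx))
    refine (notMem_tsupport_iff_eventuallyEq.2 ?_) hx
    by_cases h : α x = 0
    · filter_upwards [hf₀s x ((hs₀mem x).2 ⟨⟨hxΓ, hxb⟩, h⟩)] with y hy
      simp [hf, hy]
    · filter_upwards [hf₁s x ((hs₁mem x).2 ⟨⟨hxΓ, hxb⟩, h⟩)] with y hy
      simp [hf, hy]
  have hfball : tsupport f ⊆ Metric.ball c (3 / 2 * R) :=
    (hfχ.trans hsupp).trans (Metric.closedBall_subset_ball (by linarith))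
  -- Curl-free on the disc of radius `2R`. The function `f` lives within `R`, and the gauge function
  -- on the intermediate radius `3R/2`.
  set b : Plane → Plane := fun x => a x - abSum s₁ α x with hb
  have hbl : LocallyIntegrable b volume := ha.locallyIntegrable.sub (locallyIntegrable_abSum s₁ α)
  obtain ⟨φ, hφ, hφb⟩ := exists_gauge (c := c) (r := 3 / 2 * R) (ρ := 2 * R) hbl (by linarith)
    (fun ζ hζ hζc hζU => integral_sub_abSum_curl ha (fun γ hγ => ((hs₁mem γ).1 hγ).1.1)
      (fun γ hγ hγU hγα => (hs₁mem γ).2 ⟨⟨hγ, Metric.ball_subset_closedBall hγU⟩, hγα⟩) hζ hζc hζU)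
    hfc.isCompact hfball (fun x hx => ((ha.smooth x (hfΓ hx)).continuousAt).sub
      (continuousAt_abSum fun h => hfΓ hx ((hs₁mem x).1 h).1.1))
    (δ := ε / 4) (by positivity)
  have hnorm : ∀ x, ‖wavePacket φ f k x‖ ^ 2 = f x ^ 2 := fun x => by
    rw [norm_wavePacket, sq_abs]
  have hlow : R ^ 2 * Real.pi / 8 ≤ ∫ x, f x ^ 2 := by
    have := le_integral_sq_cutoff_mul hR hχ hsupp hχone hf₁.continuous hf₁0 hf₁1 hf₀.continuous
      hf₀0 hf₀1 (hf₁i.trans hCη₁) (hf₀i.trans hCη₀)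
    linarith
  refine ⟨wavePacket φ f k, wavePacket_mem_testFun hφ hfs hfball hfc hfΓ k, ?_, fun j => ?_⟩
  · simp only [hnorm]
    exact lt_of_lt_of_le (by positivity) hlow
  · simp only [hnorm]
    obtain ⟨i, hi⟩ := exists_abs_abSum_eq s₁ α j
    have hbound := integral_sq_le_of_pointwise (δ := ε / 4) (η := η) (C := C) (Cχ := Cχ)
      (G := fluxGrad s₁ α i) (j := j)
      (D := fun x => ‖covDeriv a j (wavePacket φ f k) x - k j * wavePacket φ f k x‖)
      hR hχ hsupp hχ0 hχ1 (hχd j) hf₁ hf₁0 hf₁1 hf₀ hf₀0 hf₀1 (hf₁G i)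
      ((hf₁e χ hχ hsupp hχ0 hχM j).1.trans hCη₁) ((hf₀e χ hχ hsupp hχ0 hχM j).1.trans hCη₀)
      ((hf₁e χ hχ hsupp hχ0 hχM i).2.trans hCη₁) (fun x => norm_nonneg _) (fun x => by
        refine (norm_covDeriv_wavePacket_le hφ hfs hfball k a j x).trans ?_
        by_cases hx : x ∈ tsupport f
        · have h1 := hφb x hx j
          have h2 : |pderiv j φ x - a x j| ≤ ε / 4 + |fluxGrad s₁ α i x| := by
            have h3 : pderiv j φ x - a x j = (pderiv j φ x - b x j) - abSum s₁ α x j := by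
              simp only [hb, PiLp.sub_apply]
              ring
            rw [h3, ← hi]
            exact (abs_sub _ _).trans (by linarith)
          exact add_le_add (mul_le_mul_of_nonneg_right h2 (abs_nonneg _)) le_rfl
        · have hfx : f x = 0 := image_eq_zero_of_notMem_tsupport hx
          have hfx' : χ x * (f₁ x * f₀ x) = 0 := hfx
          rw [hfx, hfx', abs_zero, mul_zero, mul_zero])
    refine hbound.trans ?_
    change 5 * ((ε / 4) ^ 2 * (∫ x, f x ^ 2) + 3 * (C * η) + Cχ ^ 2 * Real.pi) ≤ _
    -- The gauge error costs `5/16` and the remaining terms at most `1/2` of `ε² ∫ f²`.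
    have h1 : ε ^ 2 * (R ^ 2 * Real.pi / 8) ≤ ε ^ 2 * ∫ x, f x ^ 2 :=
      mul_le_mul_of_nonneg_left hlow (sq_nonneg ε)
    have h2 : 0 ≤ ε ^ 2 * ∫ x, f x ^ 2 := by positivity
    nlinarith

/-- If the total flux is arbitrarily small on arbitrarily large discs, then the spectrum of the
Hamiltonian is `[0, ∞)`. -/
theorem opSpectrum_hamiltonian_eq (hΓ : ∀ x, ¬ AccPt x (𝓟 Γ)) (hα : ∀ γ ∈ Γ, 0 ≤ α γ)
    {a : Plane → Plane} (ha : IsVectorPotential Γ α a)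
    (hsmall : ∀ R > 0, ∀ ε > 0, ∃ c, totalFlux Γ α (Metric.closedBall c R) < ENNReal.ofReal ε) :
    opSpectrum (hamiltonian ha.smooth) = {z : ℂ | ∃ t : ℝ, 0 ≤ t ∧ z = (t : ℂ)} := by
  have hc := isClosed_of_forall_not_accPt hΓ
  have h0 := volume_eq_zero_of_forall_not_accPt hΓ
  refine Set.Subset.antisymm (fun z hz => opSpectrum_hamiltonian_subset ha.smooth hc h0 hz) ?_
  rintro z ⟨t, ht, rfl⟩
  -- Any wave vector with `|k|² = t` would do.
  have := mem_opSpectrum_hamiltonian ha.smooth hc h0 (!₂[√t, 0] : Plane)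
    fun ε hε => exists_approx_eigenfunction hΓ hα ha hsmall _ hε
  simpa [Fin.sum_univ_two, Real.sq_sqrt ht] using this

end SmallFlux

/-! ### Large boxes of lattice squares with small flux -/

section Probability

lemma totalFlux_le_sum {ι : Type*} {Γ : Set Plane} {α : Plane → ℝ} {E : Set Plane}
    (s : Finset ι) (F : ι → Set Plane) (h : E ⊆ ⋃ n ∈ s, F n) :
    totalFlux Γ α E ≤ ∑ n ∈ s, totalFlux Γ α (F n) := by
  have hsub : Γ ∩ E ⊆ ⋃ n ∈ s, Γ ∩ F n := by
    intro x hx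
    have := h hx.2
    simp only [Set.mem_iUnion, Set.mem_inter_iff] at this ⊢
    obtain ⟨n, hn, hxn⟩ := this
    exact ⟨n, hn, hx.1, hxn⟩
  exact (ENNReal.tsum_mono_subtype (fun γ => ENNReal.ofReal (α γ)) hsub).trans
    (ENNReal.tsum_biUnion_le (fun γ => ENNReal.ofReal (α γ)) s fun n => Γ ∩ F n)

lemma totalFlux_le_sqrtFlux {Γ : Set Plane} {α : Plane → ℝ}
    (h : ∀ γ ∈ Γ, 0 ≤ α γ ∧ α γ < 1) : totalFlux Γ α unitSquare ≤ sqrtFlux Γ α := by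
  refine ENNReal.tsum_le_tsum fun γ => ENNReal.ofReal_le_ofReal ?_
  obtain ⟨h0, h1⟩ := h γ γ.2.1
  refine Real.le_sqrt_of_sq_le ?_
  nlinarith

lemma measurableSet_unitSquare : MeasurableSet unitSquare := by
  have : unitSquare = ⋂ j, {x : Plane | -(1 / 2) ≤ x j} ∩ {x : Plane | x j < 1 / 2} := by
    ext x
    simp [unitSquare]
  rw [this]
  exact MeasurableSet.iInter fun j =>
    (measurableSet_le measurable_const (by fun_prop)).inter
      (measurableSet_lt (by fun_prop) measurable_const)

lemma measurableSet_shift {S : Set Plane} (hS : MeasurableSet S) (n : Fin 2 → ℤ) :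
    MeasurableSet (shift S n) :=
  (MeasurableEquiv.addRight (WithLp.toLp 2 fun j => (n j : ℝ) : Plane)).measurableEmbedding
    |>.measurableSet_image.2 hS

lemma shift_zero (S : Set Plane) : shift S 0 = S := by
  have : (WithLp.toLp 2 fun _ => (0 : ℝ) : Plane) = 0 := rfl
  simp [shift, this]

lemma mem_shift_unitSquare_floor (x : Plane) :
    x ∈ shift unitSquare fun j => ⌊x j + 1 / 2⌋ := by
  refine ⟨x - WithLp.toLp 2 fun j => (⌊x j + 1 / 2⌋ : ℝ), fun j => ?_, by simp⟩
  have h1 := Int.floor_le (x j + 1 / 2)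
  have h2 := Int.lt_floor_add_one (x j + 1 / 2)
  simp only [PiLp.sub_apply]
  constructor <;> linarith

/-- The lattice points at distance at most `M` from `(i (2 M + 1), 0)`. -/
def latticeBox (M i : ℕ) : Finset (Fin 2 → ℤ) :=
  Finset.Icc (fun j => ![(i : ℤ) * (2 * M + 1), 0] j - M) (fun j => ![(i : ℤ) * (2 * M + 1), 0] j + M)

lemma mem_latticeBox {M i : ℕ} {n : Fin 2 → ℤ} :
    n ∈ latticeBox M i ↔ ∀ j, |n j - ![(i : ℤ) * (2 * M + 1), 0] j| ≤ M := by
  rw [latticeBox, Finset.mem_Icc, Pi.le_def, Pi.le_def, ← forall_and]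
  refine forall_congr' fun j => ?_
  rw [abs_le]
  constructor <;> rintro ⟨h1, h2⟩ <;> constructor <;> linarith

lemma card_latticeBox (M i : ℕ) : (latticeBox M i).card = (2 * M + 1) ^ 2 := by
  rw [latticeBox, Pi.card_Icc]
  simp only [Int.card_Icc, Fin.prod_univ_two, sq]
  congr 1 <;> omega

lemma disjoint_latticeBox (M : ℕ) {i i' : ℕ} (h : i ≠ i') :
    Disjoint (latticeBox M i) (latticeBox M i') := by
  rw [Finset.disjoint_left]
  intro n hn hn'
  have h1 := abs_le.1 (mem_latticeBox.1 hn 0)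
  have h2 := abs_le.1 (mem_latticeBox.1 hn' 0)
  simp only [Matrix.cons_val_zero] at h1 h2
  have h3 : (i : ℤ) ≠ i' := by exact_mod_cast h
  rcases lt_or_gt_of_ne h3 with h4 | h4 <;> nlinarith

/-- The lattice point of the square containing `x` is within `1/2` of `x` in each coordinate, so
within `R + 1/2 ≤ M` of the centre. -/
lemma closedBall_subset_latticeBox {M : ℕ} (i : ℕ) {R : ℝ} (hM : R + 1 ≤ M) :
    Metric.closedBall (WithLp.toLp 2 fun j => ((![(i : ℤ) * (2 * M + 1), 0] j : ℤ) : ℝ)) R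
      ⊆ ⋃ n ∈ latticeBox M i, shift unitSquare n := by
  intro x hx
  simp only [Set.mem_iUnion]
  refine ⟨_, mem_latticeBox.2 fun j => ?_, mem_shift_unitSquare_floor x⟩
  rw [Metric.mem_closedBall, dist_eq_norm] at hx
  have h1 := abs_le.1 ((PiLp.norm_apply_le (x - WithLp.toLp 2 fun j =>
    ((![(i : ℤ) * (2 * M + 1), 0] j : ℤ) : ℝ)) j).trans hx)
  rw [PiLp.sub_apply] at h1
  have h2 := Int.floor_le (x j + 1 / 2)
  have h3 := Int.lt_floor_add_one (x j + 1 / 2)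
  rify
  rw [abs_le]
  have h4 := h1.1
  have h5 := h1.2
  simp only at h4 h5
  constructor <;> push_cast at * <;> linarith

/-- Independent events of the form `X n ∈ B` with probabilities that do not depend on `n` occur
simultaneously on arbitrarily large boxes. -/
lemma ae_exists_latticeBox {Ω : Type*} [MeasurableSpace Ω] {P : Measure Ω} [IsProbabilityMeasure P]
    {X : (Fin 2 → ℤ) → Ω → ℝ≥0∞} (hX : ∀ n, Measurable (X n)) (hind : iIndepFun X P)
    {B : Set ℝ≥0∞} (hB : MeasurableSet B) {p : ℝ≥0∞} (hp : p ≠ 0)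
    (hpX : ∀ n, P (X n ⁻¹' B) = p) (M : ℕ) :
    ∀ᵐ ω ∂P, ∃ i, ∀ n ∈ latticeBox M i, X n ω ∈ B := by
  set A : ℕ → Set Ω := fun i => ⋂ n ∈ latticeBox M i, X n ⁻¹' B with hA
  have hAm : ∀ i, MeasurableSet (A i) := fun i =>
    (latticeBox M i).measurableSet_biInter fun n _ => hX n hB
  have hS : ∀ S : Finset (Fin 2 → ℤ), P (⋂ n ∈ S, X n ⁻¹' B) = p ^ S.card := by
    intro S
    rw [hind.measure_inter_preimage_eq_mul S fun _ _ => hB]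
    simp [hpX]
  have hAp : ∀ i, P (A i) = p ^ (2 * M + 1) ^ 2 := fun i => by
    rw [hA, hS, card_latticeBox]
  -- The boxes are disjoint, so the events use disjoint sets of cells, and the probabilities
  -- multiply because the cardinalities add.
  have hAi : iIndepSet A P := by
    rw [iIndepSet_iff_meas_biInter hAm]
    intro t
    have h1 : ⋂ i ∈ t, A i = ⋂ n ∈ t.biUnion (latticeBox M), X n ⁻¹' B := by
      rw [Finset.set_biInter_biUnion]
    rw [h1, hS, Finset.card_biUnion fun i _ i' _ h => disjoint_latticeBox M h]
    simp only [hAp, card_latticeBox, Finset.prod_const, Finset.sum_const, ← pow_mul, smul_eq_mul]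
    rw [mul_comm]
  -- Second Borel-Cantelli lemma: a constant positive probability has divergent sum.
  have h1 := measure_limsup_eq_one hAm hAi (by
    simp only [hAp]
    exact ENNReal.tsum_const_eq_top_of_ne_zero (pow_ne_zero _ hp))
  have h2 : ∀ᵐ ω ∂P, ω ∈ limsup A atTop :=
    (prob_compl_eq_zero_iff (MeasurableSet.measurableSet_limsup hAm)).2 h1
  filter_upwards [h2] with ω hω
  obtain ⟨i, hi⟩ := (mem_limsup_iff_frequently_mem.1 hω).exists
  refine ⟨i, fun n hn => ?_⟩
  have := Set.mem_iInter₂.1 hi n hn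
  exact this

variable {Ω : Type*} [MeasurableSpace Ω] {P : Measure Ω}
  {Γ : Ω → Set Plane} {α : Ω → Plane → ℝ}

/-- Independence of the infinite family concerns finite subfamilies only, which are enumerated by
`Fin` to match the hypothesis. -/
lemma FluxAssumptions.iIndepFun_totalFlux (h : FluxAssumptions P Γ α) :
    iIndepFun (fun (n : Fin 2 → ℤ) ω => totalFlux (Γ ω) (α ω) (shift unitSquare n)) P := by
  rw [iIndepFun_iff_finset]
  intro s
  have h1 := h.indep s.card (fun i => (s.equivFin.symm i : Fin 2 → ℤ))
    (fun i => shift unitSquare (s.equivFin.symm i))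
    (Subtype.val_injective.comp s.equivFin.symm.injective)
    (fun _ => measurableSet_shift measurableSet_unitSquare _) fun _ => subset_rfl
  have h2 := h1.precomp s.equivFin.injective
  convert h2 using 1
  funext n ω
  simp [Finset.restrict]

/-- Both alternatives yield this: the first contains it, and in the second `α ≤ √α` because the
fluxes lie in `[0, 1)`. -/
lemma FluxAssumptions.measure_totalFlux_lt_pos (h : FluxAssumptions P Γ α) {ε : ℝ} (hε : 0 < ε) :
    0 < P {ω | totalFlux (Γ ω) (α ω) unitSquare < ENNReal.ofReal ε} := by
  rcases h.small with ⟨c, -, -, hc⟩ | hs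
  · exact (hc ε hε).trans_le (measure_mono fun ω hω => hω.1)
  · exact (hs ε hε).trans_le (measure_mono fun ω hω =>
      (totalFlux_le_sqrtFlux (h.flux_mem ω)).trans_lt hω)

/-- Almost surely, there are arbitrarily large discs with arbitrarily small total flux. -/
theorem FluxAssumptions.ae_exists_totalFlux_lt [IsProbabilityMeasure P] (h : FluxAssumptions P Γ α) :
    ∀ᵐ ω ∂P, ∀ R > 0, ∀ ε > 0, ∃ c,
      totalFlux (Γ ω) (α ω) (Metric.closedBall c R) < ENNReal.ofReal ε := by
  -- Radii and thresholds are discretised to natural numbers so that a countable intersection of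
  -- almost sure events suffices.
  have h1 : ∀ᵐ ω ∂P, ∀ M m : ℕ, ∃ i, ∀ n ∈ latticeBox M i,
      totalFlux (Γ ω) (α ω) (shift unitSquare n) < ENNReal.ofReal (1 / (m + 1)) := by
    rw [ae_all_iff]
    intro M
    rw [ae_all_iff]
    intro m
    have hε : (0 : ℝ) < 1 / (m + 1) := by positivity
    refine ae_exists_latticeBox (fun n => h.measurable _
      (measurableSet_shift measurableSet_unitSquare n)) h.iIndepFun_totalFlux
      (B := Set.Iio (ENNReal.ofReal (1 / (m + 1)))) measurableSet_Iio
      (h.measure_totalFlux_lt_pos hε).ne' (fun n => ?_) M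
    have h2 := (h.identDistrib unitSquare measurableSet_unitSquare subset_rfl n 0).measure_mem_eq
      (measurableSet_Iio (a := ENNReal.ofReal (1 / (m + 1))))
    rw [h2, shift_zero]
    rfl
  filter_upwards [h1] with ω hω R hR ε hε
  obtain ⟨M, hM⟩ := exists_nat_ge (R + 1)
  -- Each of the `(2M+1)²` cells carries flux below `1/(m+1)`, and the sum must stay below `ε`.
  obtain ⟨m, hm⟩ := exists_nat_gt (((2 * M + 1) ^ 2 : ℕ) / ε)
  obtain ⟨i, hi⟩ := hω M m
  refine ⟨_, (totalFlux_le_sum _ _ (closedBall_subset_latticeBox i hM)).trans_lt ?_⟩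
  calc ∑ n ∈ latticeBox M i, totalFlux (Γ ω) (α ω) (shift unitSquare n)
      ≤ ∑ n ∈ latticeBox M i, ENNReal.ofReal (1 / (m + 1)) :=
        Finset.sum_le_sum fun n hn => (hi n hn).le
    _ = ENNReal.ofReal (((2 * M + 1) ^ 2 : ℕ) * (1 / (m + 1))) := by
        rw [Finset.sum_const, card_latticeBox, nsmul_eq_mul, ENNReal.ofReal_mul (by positivity),
          ENNReal.ofReal_natCast]
    _ < ENNReal.ofReal ε := by
        rw [ENNReal.ofReal_lt_ofReal_iff hε, mul_one_div, div_lt_iff₀ (by positivity)]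
        rw [div_lt_iff₀ hε] at hm
        nlinarith

end Probability

end RandomDelta

end

/-- The exceptional null set comes from the fluxes alone, so it serves all vector potentials at
once. -/
theorem theorem1 {Ω : Type*} [MeasurableSpace Ω] (P : MeasureTheory.Measure Ω)
    [MeasureTheory.IsProbabilityMeasure P]
    (Γ : Ω → Set RandomDelta.Plane) (α : Ω → RandomDelta.Plane → ℝ)
    (hΓα : RandomDelta.FluxAssumptions P Γ α) :
    ∀ᵐ ω ∂P, ∀ (a : RandomDelta.Plane → RandomDelta.Plane)
      (ha : RandomDelta.IsVectorPotential (Γ ω) (α ω) a),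
      RandomDelta.opSpectrum (RandomDelta.hamiltonian ha.smooth)
        = {z : ℂ | ∃ t : ℝ, 0 ≤ t ∧ z = (t : ℂ)} :=
  hΓα.ae_exists_totalFlux_lt.mono fun ω hω _ ha =>
    RandomDelta.opSpectrum_hamiltonian_eq (hΓα.discrete ω) (fun γ hγ => (hΓα.flux_mem ω γ hγ).1)
      ha hω
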